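/- **Theorem (asymptotic normality of the NP-SIMEX estimator).** *Data.* Subjects $i=1,2,\dots$ are independent and identically distributed with error-free variables $V_i=(Y_i,Z_i)$ (values in any measurable space) and a true covariate $X_i\in\mathbb R^d$. For a sample of size $n$, the procedure uses an error-prone measurement $W_i$ of $X_i$ for each $i\le n$, and a set of observed errors $\mathcal U_n=\{u_1,\dots,u_{m_n}\}$, which arise in one of three ways. (a) *Replicates:* proxies $X^*_{ij}=X_i+U_{ij}$, $j\le k$, are observed, where for each $i$ the $U_{ij}$ are independent, identically distributed, symmetric about $0$, and jointly independent of $(V_i,X_i)$. For a fixed contrast $a$ with $\sum_j a_j=0$ and $\sum_j|a_j|=1$, $W_i=\sum_j|a_j|X^*_{ij}$, $u_i=\sum_j a_jX^*_{ij}$ and $m_n=n$. (b) *Internal validation:* $W_i=X_i+U_i$ with $U_i$ independent of $(V_i,X_i)$, and $u_i=W_i-X_i$ is observed for $i\le m_n$, where $m_n\le n$. (c) *External validation:* $W_i=X_i+U_i$ as in (b), and $u_k=W'_k-X'_k$, $k\le m_n$, where $(X'_k,W'_k)$ are i.i.d. pairs independent of the main sample and $u_1$ has the distribution of $U_1$.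 Assume $m_n\to\infty$ and $n/m_n\to c$ for some finite $c$ as $n\to\infty$. *Remeasurement.* Fix a finite grid $\Lambda$ of non-negative integers and $B\ge1$. For $\lambda\in\Lambda$, $b\le B$, $i\le n$ put $\widetilde X_{bi}(\lambda)=W_i+\sum_{j=1}^{\lambda}U^*_{bi,j}$, where the $U^*_{bi,j}$ (drawn afresh for each $\lambda$) are drawn independently and with replacement from $\mathcal U_n$. Let $\widehat F_{b,\lambda}$ be the empirical distribution of $(V_i,\widetilde X_{bi}(\lambda))$, $i\le n$, and let $F_\lambda$ be the distribution of $(V_1,X_1+\sum_{j=0}^{\lambda}\widetilde U_j)$, where the $\widetilde U_j$ are independent copies of $u_1$, independent of $(V_1,X_1)$. *Estimator.* The error-free estimator is a functional $\mathbf T$, with values in $\mathbb R^p$, of the empirical distribution of the data, and $\theta=\mathbf T(F_{V,X})$, where $F_{V,X}$ is the distribution of $(V_1,X_1)$. Suppose that $\mathbf T$ admits a linear approximation at each $F_\lambda$, $\lambda\in\Lambda$: there is a function $\psi_\lambda$ with $\int\psi_\lambda\,dF_\lambda=0$ and $\int\|\psi_\lambda\|^2\,dF_\lambda<\infty$ such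 that for every $b\le B$, as $n\to\infty$, $$n^{1/2}\{\mathbf T(\widehat F_{b,\lambda})-\mathbf T(F_\lambda)\}=n^{-1/2}\sum_{i=1}^n\psi_\lambda\bigl(V_i,\widetilde X_{bi}(\lambda)\bigr)+o_p(1).$$ *Extrapolation.* Let $\mathcal G(\cdot,\gamma)$, $\gamma\in S\subseteq\mathbb R^q$, be a parametric extrapolant with values in $\mathbb R^p$ that is correctly specified: for some $\gamma_0$ in the interior of $S$, $\mathcal G(\lambda,\gamma_0)=\mathbf T(F_\lambda)$ for $\lambda\in\Lambda$, and $\mathcal G(-1,\gamma_0)=\theta$. Suppose that $\gamma_0$ is identified from the grid, that is, $\inf\{\max_{\lambda\in\Lambda}\|\mathcal G(\lambda,\gamma)-\mathcal G(\lambda,\gamma_0)\|:\gamma\in S,\ \|\gamma-\gamma_0\|\ge\varepsilon\}>0$ for each $\varepsilon>0$; that $\mathcal G(\lambda,\cdot)$ is differentiable at $\gamma_0$ for $\lambda\in\Lambda\cup\{-1\}$; and that the derivative at $\gamma_0$ of $\gamma\mapsto(\mathcal G(\lambda,\gamma))_{\lambda\in\Lambda}$ is injective. Fix weights $w_\lambda>0$,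 put $\widehat\theta(\lambda)=B^{-1}\sum_{b=1}^B\mathbf T(\widehat F_{b,\lambda})$, and let $\widehat\gamma$ be, with probability tending to one, a minimizer over $\gamma\in S$ of $\sum_{\lambda\in\Lambda}w_\lambda\|\widehat\theta(\lambda)-\mathcal G(\lambda,\gamma)\|^2$. The NP-SIMEX estimator is $\widehat\theta_{\text{NP-SIMEX}}=\mathcal G(-1,\widehat\gamma)$. *Conclusion.* As $n\to\infty$, $n^{1/2}(\widehat\theta_{\text{NP-SIMEX}}-\theta)$ converges in distribution to a (possibly degenerate) normal distribution on $\mathbb R^p$ with mean zero. -/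

import Mathlib

open MeasureTheory ProbabilityTheory Filter Topology
open scoped ENNReal

namespace NPSimex

/-- Euclidean space of dimension `d`. -/
abbrev Euc (d : ℕ) : Type := EuclideanSpace ℝ (Fin d)

noncomputable section

/-! ## Observation schemes

Subjects are indexed by `i : ℕ`, a sample of size `n` consisting of the subjects `i < n`.
`V i` collects the error-free variables `(Y_i, Z_i)` of subject `i`, `X i` is the true covariate,
`W i` is the error-prone measurement of `X i` that enters the procedure, and `u k` is the `k`-th
observed error; for a sample of size `n` the set of observed errors is `{u k : k < m n}`. -/

/-- **Replicate measurements.** For each subject the proxies `X i + U i j`, `j < k`, are observed.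
The subjects are independent and identically distributed, the errors `U i j` of a subject are
independent of its `(V i, X i)`, independent of each other, identically distributed and symmetric
around `0`. For a contrast `a` with `∑ a_j = 0` and `∑ |a_j| = 1`, the measurement is
`∑ |a_j| X*_{ij}` and the observed error is `∑ a_j X*_{ij}`. -/
structure IsReplicateSample {Ω 𝒱 : Type*} [MeasurableSpace Ω] [MeasurableSpace 𝒱] {d : ℕ}
    (P : Measure Ω) (V : ℕ → Ω → 𝒱) (X : ℕ → Ω → Euc d) (k : ℕ) (a : Fin k → ℝ)
    (U : ℕ → Fin k → Ω → Euc d) (W u : ℕ → Ω → Euc d) (m : ℕ → ℕ) : Prop where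
  measurable_V : ∀ i, Measurable (V i)
  measurable_X : ∀ i, Measurable (X i)
  measurable_U : ∀ i j, Measurable (U i j)
  indep_subjects : iIndepFun (fun i ω => ((V i ω, X i ω), fun j => U i j ω)) P
  ident_subjects : ∀ i, IdentDistrib (fun ω => ((V i ω, X i ω), fun j => U i j ω))
    (fun ω => ((V 0 ω, X 0 ω), fun j => U 0 j ω)) P P
  indep_errors : ∀ i, IndepFun (fun ω => (V i ω, X i ω)) (fun ω j => U i j ω) P
  indep_replicates : ∀ i, iIndepFun (fun j => U i j) P
  ident_replicates : ∀ i j j', IdentDistrib (U i j) (U i j') P P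
  symmetric : ∀ i j, IdentDistrib (U i j) (fun ω => -U i j ω) P P
  sum_contrast : ∑ j, a j = 0
  sum_abs_contrast : ∑ j, |a j| = 1
  measurement : ∀ i ω, W i ω = ∑ j, |a j| • (X i ω + U i j ω)
  observed_error : ∀ i ω, u i ω = ∑ j, a j • (X i ω + U i j ω)
  size : ∀ n, m n = n

/-- The additive error model with one proxy `W i = X i + U i` per subject, the error `U i = W i - X i`
being independent of `(V i, X i)`, for independent and identically distributed subjects. -/
structure IsAdditiveErrorSample {Ω 𝒱 : Type*} [MeasurableSpace Ω] [MeasurableSpace 𝒱] {d : ℕ}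
    (P : Measure Ω) (V : ℕ → Ω → 𝒱) (X W : ℕ → Ω → Euc d) : Prop where
  measurable_V : ∀ i, Measurable (V i)
  measurable_X : ∀ i, Measurable (X i)
  measurable_W : ∀ i, Measurable (W i)
  indep_subjects : iIndepFun (fun i ω => (V i ω, X i ω, W i ω)) P
  ident_subjects : ∀ i, IdentDistrib (fun ω => (V i ω, X i ω, W i ω))
    (fun ω => (V 0 ω, X 0 ω, W 0 ω)) P P
  indep_error : ∀ i, IndepFun (fun ω => (V i ω, X i ω)) (fun ω => W i ω - X i ω) P

/-- **Internal validation sample.** The true covariate is observed for the first `m n` of the `n`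
subjects, whose errors `W i - X i` form the set of observed errors. -/
structure IsInternalValidationSample {Ω 𝒱 : Type*} [MeasurableSpace Ω] [MeasurableSpace 𝒱] {d : ℕ}
    (P : Measure Ω) (V : ℕ → Ω → 𝒱) (X W u : ℕ → Ω → Euc d) (m : ℕ → ℕ) : Prop where
  model : IsAdditiveErrorSample P V X W
  observed_error : ∀ i ω, u i ω = W i ω - X i ω
  size_le : ∀ n, m n ≤ n

/-- **External validation sample.** Pairs `(X' k, W' k)` of a true covariate and its proxy are
observed in a separate, independent dataset of size `m n`; the errors have the same distribution
there as in the main sample (transportability). -/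
structure IsExternalValidationSample {Ω 𝒱 : Type*} [MeasurableSpace Ω] [MeasurableSpace 𝒱] {d : ℕ}
    (P : Measure Ω) (V : ℕ → Ω → 𝒱) (X W : ℕ → Ω → Euc d) (X' W' u : ℕ → Ω → Euc d) : Prop where
  model : IsAdditiveErrorSample P V X W
  measurable_X' : ∀ k, Measurable (X' k)
  measurable_W' : ∀ k, Measurable (W' k)
  indep_pairs : iIndepFun (fun k ω => (X' k ω, W' k ω)) P
  ident_pairs : ∀ k, IdentDistrib (fun ω => (X' k ω, W' k ω)) (fun ω => (X' 0 ω, W' 0 ω)) P P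
  indep_main : IndepFun (fun ω i => (V i ω, X i ω, W i ω)) (fun ω k => (X' k ω, W' k ω)) P
  observed_error : ∀ k ω, u k ω = W' k ω - X' k ω
  transportable : IdentDistrib (u 0) (fun ω => W 0 ω - X 0 ω) P P

/-- The three ways in which the measurements and the set of observed errors can arise. -/
def IsObservationScheme {Ω 𝒱 : Type*} [MeasurableSpace Ω] [MeasurableSpace 𝒱] {d : ℕ}
    (P : Measure Ω) (V : ℕ → Ω → 𝒱) (X W u : ℕ → Ω → Euc d) (m : ℕ → ℕ) : Prop :=
  (∃ (k : ℕ) (a : Fin k → ℝ) (U : ℕ → Fin k → Ω → Euc d), IsReplicateSample P V X k a U W u m) ∨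
  IsInternalValidationSample P V X W u m ∨
  (∃ X' W' : ℕ → Ω → Euc d, IsExternalValidationSample P V X W X' W' u)

/-! ## Remeasurement -/

/-- The random indices generated by the analyst: for sample size `n`, `I n b l i j` is the index of
the `j`-th error (`j < l`) drawn, with replacement, for subject `i < n` in the `b`-th remeasured
data set (`b < B`) at the grid point `l`. For each `n` the indices are independent, uniformly
distributed on `{0, …, m n - 1}`, and independent of the data. -/
structure IsResampling {Ω 𝒱 : Type*} [MeasurableSpace Ω] [MeasurableSpace 𝒱] {d : ℕ}
    (P : Measure Ω) (V : ℕ → Ω → 𝒱) (W u : ℕ → Ω → Euc d) (m : ℕ → ℕ) (B : ℕ) (Λ : Finset ℕ)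
    (I : (n : ℕ) → Fin B → (l : Λ) → Fin n → Fin (l : ℕ) → Ω → ℕ) : Prop where
  measurable : ∀ n b l i j, Measurable (I n b l i j)
  uniform : ∀ n, 0 < m n → ∀ b l i j, ∀ k < m n,
    P {ω | I n b l i j ω = k} = (m n : ℝ≥0∞)⁻¹
  indep : ∀ n, 0 < m n →
    iIndepFun (fun (q : Fin B × (Σ l : Λ, Fin n × Fin (l : ℕ))) =>
      I n q.1 q.2.1 q.2.2.1 q.2.2.2) P
  indep_data : ∀ n, 0 < m n →
    IndepFun (fun ω (q : Fin B × (Σ l : Λ, Fin n × Fin (l : ℕ))) =>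
      I n q.1 q.2.1 q.2.2.1 q.2.2.2 ω) (fun ω (i : ℕ) => (V i ω, W i ω, u i ω)) P

/-- The remeasured data point `(V i, W i + ∑_{j < l} u (J j))` of a subject, where `J j` is the index
of its `j`-th drawn error. -/
def remeasured {Ω 𝒱 : Type*} {d : ℕ} (V : ℕ → Ω → 𝒱) (W u : ℕ → Ω → Euc d) {l : ℕ}
    (i : ℕ) (J : Fin l → Ω → ℕ) (ω : Ω) : 𝒱 × Euc d :=
  (V i ω, W i ω + ∑ j, u (J j ω) ω)

/-- The empirical distribution `n⁻¹ ∑ δ_{x i}`. -/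
def empirical {S : Type*} [MeasurableSpace S] {n : ℕ} (x : Fin n → S) : Measure S :=
  (n : ℝ≥0∞)⁻¹ • ∑ i, Measure.dirac (x i)

/-- The distribution `F_l` of `(V, X + ∑_{j=0}^{l} U_j)`, where `μ` is the distribution of `(V, X)` and
`U_0, …, U_l` are independent with distribution `ν`, and independent of `(V, X)`. -/
def remeasuredLaw {𝒱 : Type*} [MeasurableSpace 𝒱] {d : ℕ} (μ : Measure (𝒱 × Euc d))
    (ν : Measure (Euc d)) (l : ℕ) : Measure (𝒱 × Euc d) :=
  (μ.prod (Measure.pi fun _ : Fin (l + 1) => ν)).map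
    fun p => (p.1.1, p.1.2 + ∑ j, p.2 j)

/-- The functional `T` admits a linear approximation at `F` along the empirical distributions of the
triangular array `x`, with influence function `ψ`:
`√n (T(F̂_n) - T(F)) = n^{-1/2} ∑_{i<n} ψ(x_{n,i}) + o_p(1)`, where `ψ` is centred and square-integrable
under `F`. -/
structure AdmitsLinearApproximation {Ω S : Type*} [MeasurableSpace Ω] [MeasurableSpace S] {p : ℕ}
    (P : Measure Ω) (T : Measure S → Euc p) (F : Measure S) (ψ : S → Euc p)
    (x : (n : ℕ) → Fin n → Ω → S) : Prop where
  measurable : Measurable ψ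
  square_integrable : MemLp ψ 2 F
  centred : ∫ s, ψ s ∂F = 0
  remainder : TendstoInMeasure P
    (fun (n : ℕ) ω => √(n : ℝ) • (T (empirical fun i => x n i ω) - T F)
      - (√(n : ℝ))⁻¹ • ∑ i, ψ (x n i ω)) atTop (fun _ => 0)

/-- The averaged estimate `B⁻¹ ∑_b T(F̂_{n,b,l})` at the grid point `l`. -/
def averagedEstimate {Ω 𝒱 : Type*} [MeasurableSpace 𝒱] {d p : ℕ}
    (T : Measure (𝒱 × Euc d) → Euc p) (V : ℕ → Ω → 𝒱) (W u : ℕ → Ω → Euc d) {B : ℕ} {Λ : Finset ℕ}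
    (I : (n : ℕ) → Fin B → (l : Λ) → Fin n → Fin (l : ℕ) → Ω → ℕ)
    (n : ℕ) (l : Λ) (ω : Ω) : Euc p :=
  (B : ℝ)⁻¹ • ∑ b, T (empirical fun i : Fin n => remeasured V W u i (I n b l i) ω)

/-! ## Extrapolation -/

/-- `g` is a (weighted) least squares fit of the parametric extrapolant `G(·, g)`, `g ∈ S`, to the
points `(l, y l)`, `l ∈ Λ`. -/
def IsLeastSquaresFit {p q : ℕ} (Λ : Finset ℕ) (w : Λ → ℝ) (G : ℝ → Euc q → Euc p)
    (S : Set (Euc q)) (y : Λ → Euc p) (g : Euc q) : Prop :=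
  g ∈ S ∧ ∀ g' ∈ S, ∑ l, w l * ‖y l - G ((l : ℕ) : ℝ) g‖ ^ 2 ≤
    ∑ l, w l * ‖y l - G ((l : ℕ) : ℝ) g'‖ ^ 2

/-- `Z n` converges in distribution to a (possibly degenerate) Gaussian vector with mean zero. -/
def IsAsymptoticallyCentredNormal {Ω : Type*} [MeasurableSpace Ω] {p : ℕ} (P : Measure Ω)
    [IsProbabilityMeasure P] (Z : ℕ → Ω → Euc p) : Prop :=
  ∃ (γ : Measure (Euc p)) (_ : IsGaussian γ), ∫ x, x ∂γ = 0 ∧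
    TendstoInDistribution Z atTop (id : Euc p → Euc p) (fun _ => P) γ

end

end NPSimex

/-!
# Asymptotic normality of the NP-SIMEX estimator

In each of the three observation schemes the triples `D i = (V i, W i, u i)` are independent and
identically distributed (`IsObservationScheme.iid_and_law`). The scheme only affects the joint law
of `W i` and `u i`; in all of them `(V i, W i)` has the law of `(V i, X i)` with an independent
error of the law of `u i` added. For replicates this is the symmetry of the errors: `∑ |a_j| U_j`
and `∑ a_j U_j` are equal in law. Hence a remeasured point built from distinct subjects has the
law `F_l` (`map_remeasure_pi`). Unused components of a triple do no harm, so that external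
validation data, where the triple consists of independent parts, needs no separate treatment.

*The central limit theorem.* By the linear approximation, the estimates on the grid are governed
by sums `n^{-1/2} ∑_i κ (D i, D k_1, …, D k_l)` in which the indices `k_j` are drawn with
replacement from the first `m n` data (`resampledSum`). Given the data, the summands are
independent. For bounded `κ` a quantitative central limit theorem, proved by comparing
characteristic functions factor by factor, shows that the conditional law is nearly Gaussian
around the conditional mean. When `κ` is a linear combination of products of functions of the
single arguments, the conditional mean is a polynomial in averages of the data. The delta method
(`exists_hasLinearization`) reduces it to an average over the first `n` data plus an average over
the first `m n` data, and the conditional variance converges in probability. The two averages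
overlap, in `min n (m n)` data, and are jointly asymptotically normal because `n / m n` converges
(`IsIIDSequence.tendsto_charFun_averages`).

Product kernels are dense in `L²`, so the general case follows from a tail bound for resampled
sums that depends on the kernel only through its second moment
(`IsUniformResampling.exists_tail_bound`). Under the joint law of data and indices, terms with
disjoint index tuples are uncorrelated, and two given tuples meet with probability `O(1 / m n)`.
This controls the second moment of the sum over the tuples without repetitions. A term with
repetitions can have an infinite second moment, but the expected number of these terms is
bounded, and their laws are tight. Limits of the approximating quadratic forms give
the covariance of the limit, which is obtained abstractly (`exists_tendsto_charFun_resampledSum`).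

*Extrapolation.* With the weights absorbed into the norm (`weightMap`), the fitted extrapolant is
a least squares fit in a Euclidean space. Identifiability makes it consistent, and minimality
together with injectivity of the derivative `D` makes it `√n`-consistent and then forces
`√n (γ̂ - γ₀) = A s + o_p(1)`, where `s` is the linear statistic of the estimates on the grid and `A` is the
pseudo-inverse of `D` (`leastSquares_expansion`). This argument uses differentiability at `γ₀`
alone. Thus `√n (θ̂ - θ)` is a linear function of resampled sums up to `o_p(1)`, and Lévy's
continuity theorem and Slutsky's lemma conclude.
-/

namespace NPSimex

set_option linter.unusedSectionVars false

/-! ### Characteristic functions of sums of small independent variables -/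

lemma norm_prod_sub_prod_le_sum {ι : Type*} (s : Finset ι) (a b : ι → ℂ)
    (ha : ∀ i ∈ s, ‖a i‖ ≤ 1) (hb : ∀ i ∈ s, ‖b i‖ ≤ 1) :
    ‖∏ i ∈ s, a i - ∏ i ∈ s, b i‖ ≤ ∑ i ∈ s, ‖a i - b i‖ := by
  classical
  induction s using Finset.induction_on with
  | empty => simp
  | insert j s hj ih =>
    rw [Finset.prod_insert hj, Finset.prod_insert hj, Finset.sum_insert hj]
    have h1 : ‖∏ i ∈ s, b i‖ ≤ 1 := by
      rw [norm_prod]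
      exact Finset.prod_le_one (fun _ _ => norm_nonneg _)
        fun i hi => hb i (Finset.mem_insert_of_mem hi)
    have h2 := ih (fun i hi => ha i (Finset.mem_insert_of_mem hi))
      fun i hi => hb i (Finset.mem_insert_of_mem hi)
    have h3 := ha j (Finset.mem_insert_self _ _)
    calc ‖a j * ∏ i ∈ s, a i - b j * ∏ i ∈ s, b i‖
        = ‖(a j - b j) * ∏ i ∈ s, b i + a j * (∏ i ∈ s, a i - ∏ i ∈ s, b i)‖ := by ring_nf
      _ ≤ ‖a j - b j‖ * ‖∏ i ∈ s, b i‖ + ‖a j‖ * ‖∏ i ∈ s, a i - ∏ i ∈ s, b i‖ := by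
          refine (norm_add_le _ _).trans ?_
          rw [norm_mul, norm_mul]
      _ ≤ ‖a j - b j‖ * 1 + 1 * ∑ i ∈ s, ‖a i - b i‖ := by gcongr
      _ = _ := by ring

lemma norm_cexp_mul_I_sub_le {x : ℝ} (hx : |x| ≤ 1) :
    ‖Complex.exp (x * Complex.I) - (1 + x * Complex.I - x ^ 2 / 2)‖ ≤ |x| * x ^ 2 / 4 := by
  have h := Complex.exp_bound (x := x * Complex.I) (by simpa using hx) (n := 3) (by norm_num)
  simp only [Finset.sum_range_succ, Finset.sum_range_zero, norm_mul, Complex.norm_real,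
    Complex.norm_I, mul_one, Real.norm_eq_abs] at h
  norm_num [Nat.factorial, mul_pow] at h
  have h3 : |x| ^ 3 = |x| * x ^ 2 := by rw [pow_succ', sq_abs]
  rw [h3] at h
  calc _ = ‖Complex.exp (x * Complex.I) - (1 + x * Complex.I + -(x : ℂ) ^ 2 / 2)‖ := by
        congr 2; ring
    _ ≤ _ := h
    _ ≤ _ := by nlinarith [mul_nonneg (abs_nonneg x) (sq_nonneg x)]

/-- The characteristic function of one centred variable bounded by `δ ≤ 1`, at `1`, differs from
that of the Gaussian with the same variance by at most `δ` times the variance. -/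
lemma norm_integral_cexp_sub_gaussian_le {Ω : Type*} [MeasurableSpace Ω] (P : Measure Ω)
    [IsProbabilityMeasure P] {ξ : Ω → ℝ} (hξ : Measurable ξ) {δ : ℝ} (hδ : δ ≤ 1)
    (hb : ∀ ω, |ξ ω| ≤ δ) (h0 : ∫ ω, ξ ω ∂P = 0) :
    ‖∫ ω, Complex.exp (ξ ω * Complex.I) ∂P
      - Complex.exp ((-(∫ ω, ξ ω ^ 2 ∂P) / 2 : ℝ))‖ ≤ δ * ∫ ω, ξ ω ^ 2 ∂P := by
  set v := ∫ ω, ξ ω ^ 2 ∂P with hv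
  have hδ0 : 0 ≤ δ := by
    obtain ⟨ω⟩ : Nonempty Ω := nonempty_of_isProbabilityMeasure P
    exact (abs_nonneg _).trans (hb ω)
  have hi1 : Integrable ξ P := Integrable.of_bound hξ.aestronglyMeasurable δ
    (ae_of_all _ fun ω => by simpa using hb ω)
  have hsq : ∀ ω, ξ ω ^ 2 ≤ δ ^ 2 := fun ω => sq_le_sq' (by linarith [(abs_le.1 (hb ω)).1])
    (abs_le.1 (hb ω)).2
  have hi2 : Integrable (fun ω => ξ ω ^ 2) P :=
    Integrable.of_bound (hξ.pow_const 2).aestronglyMeasurable (δ ^ 2)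
    (ae_of_all _ fun ω => by simpa using hsq ω)
  have hv0 : 0 ≤ v := integral_nonneg fun ω => sq_nonneg _
  have hvδ : v ≤ δ ^ 2 := by
    calc v ≤ ∫ _, δ ^ 2 ∂P := integral_mono hi2 (integrable_const _) hsq
      _ = δ ^ 2 := by simp
  have hie : Integrable (fun ω => Complex.exp (ξ ω * Complex.I)) P :=
    Integrable.of_bound (by fun_prop) 1 (ae_of_all _ fun ω => by
      rw [Complex.norm_exp_ofReal_mul_I])
  have hi1c : Integrable (fun ω => (ξ ω : ℂ) * Complex.I) P := hi1.ofReal.mul_const _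
  have hi2c : Integrable (fun ω => (ξ ω : ℂ) ^ 2 / 2) P := by
    have := hi2.ofReal (𝕜 := ℂ)
    simp only [Complex.coe_algebraMap, RCLike.ofReal_pow] at this
    exact (by simpa using this : Integrable (fun ω => (ξ ω : ℂ) ^ 2) P).div_const 2
  have hlin : Integrable (fun ω => (1 : ℂ) + ξ ω * Complex.I) P := (integrable_const _).add hi1c
  have hp : ∫ ω, ((1 : ℂ) + ξ ω * Complex.I - (ξ ω : ℂ) ^ 2 / 2) ∂P = 1 - (v : ℂ) / 2 := by
    rw [integral_sub hlin hi2c, integral_add (integrable_const _) hi1c,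
      integral_mul_const, integral_div, integral_complex_ofReal, h0]
    simp_rw [← Complex.ofReal_pow]
    rw [integral_complex_ofReal]
    simp [hv]
  have hA : ‖∫ ω, Complex.exp (ξ ω * Complex.I) ∂P - (1 - (v : ℂ) / 2)‖ ≤ δ * v / 4 := by
    have hpoly : Integrable (fun ω => (1 : ℂ) + ξ ω * Complex.I - (ξ ω : ℂ) ^ 2 / 2) P :=
        hlin.sub hi2c
    rw [← hp, ← integral_sub hie hpoly]
    calc _ ≤ ∫ ω, δ * ξ ω ^ 2 / 4 ∂P := by
          refine norm_integral_le_of_norm_le ((hi2.const_mul δ).div_const 4) (ae_of_all _ fun ω => ?_)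
          refine (norm_cexp_mul_I_sub_le ((hb ω).trans hδ)).trans ?_
          have := mul_le_mul_of_nonneg_right (hb ω) (sq_nonneg (ξ ω))
          linarith
      _ = _ := by rw [integral_div, integral_const_mul]
  have hB : ‖Complex.exp ((-v / 2 : ℝ)) - (1 - (v : ℂ) / 2)‖ ≤ δ * v / 4 := by
    have h1 : |(-v / 2)| ≤ 1 := by
      rw [abs_le]; constructor <;> nlinarith
    have h := Real.exp_bound h1 (n := 2) (by norm_num)
    simp only [Finset.sum_range_succ, Finset.sum_range_zero] at h
    norm_num [Nat.factorial] at h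
    have h2 : ‖Complex.exp ((-v / 2 : ℝ)) - (1 - (v : ℂ) / 2)‖ =
        |Real.exp (-v / 2) - (1 + -v / 2)| := by
      rw [← Real.norm_eq_abs, ← Complex.norm_real]
      congr 1
      push_cast
      ring
    rw [h2]
    refine h.trans ?_
    nlinarith
  calc _ = ‖(∫ ω, Complex.exp (ξ ω * Complex.I) ∂P - (1 - (v : ℂ) / 2))
        - (Complex.exp ((-v / 2 : ℝ)) - (1 - (v : ℂ) / 2))‖ := by congr 1; ring
    _ ≤ δ * v / 4 + δ * v / 4 := (norm_sub_le _ _).trans (add_le_add hA hB)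
    _ ≤ _ := by nlinarith [mul_nonneg hδ0 hv0]

/-- A quantitative central limit theorem: if `ξ i` are independent, centred and bounded by `δ ≤ 1`,
the characteristic function of their sum at `1` is close to the Gaussian one. -/
lemma norm_integral_cexp_sum_sub_gaussian_le {Ω ι : Type*} [MeasurableSpace Ω] (P : Measure Ω)
    [IsProbabilityMeasure P] [Fintype ι] {ξ : ι → Ω → ℝ} (hξ : ∀ i, Measurable (ξ i))
    (hind : iIndepFun ξ P) {δ : ℝ} (hδ : δ ≤ 1)
    (hb : ∀ i ω, |ξ i ω| ≤ δ) (h0 : ∀ i, ∫ ω, ξ i ω ∂P = 0) :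
    ‖∫ ω, Complex.exp ((∑ i, ξ i ω : ℝ) * Complex.I) ∂P
      - Complex.exp ((-(∑ i, ∫ ω, ξ i ω ^ 2 ∂P) / 2 : ℝ))‖ ≤ δ * ∑ i, ∫ ω, ξ i ω ^ 2 ∂P := by
  have h1 : ∫ ω, Complex.exp ((∑ i, ξ i ω : ℝ) * Complex.I) ∂P
      = ∏ i, ∫ ω, Complex.exp (ξ i ω * Complex.I) ∂P := by
    rw [← hind.integral_fun_prod_comp (f := fun _ x => Complex.exp ((x : ℝ) * Complex.I))
      (fun i => (hξ i).aemeasurable) (fun i => by fun_prop)]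
    congr 1 with ω
    rw [← Complex.exp_sum]
    push_cast
    rw [Finset.sum_mul]
  have h2 : Complex.exp ((-(∑ i, ∫ ω, ξ i ω ^ 2 ∂P) / 2 : ℝ))
      = ∏ i, Complex.exp ((-(∫ ω, ξ i ω ^ 2 ∂P) / 2 : ℝ)) := by
    rw [← Complex.exp_sum, ← Complex.ofReal_sum, ← Finset.sum_div, Finset.sum_neg_distrib]
  rw [h1, h2, Finset.mul_sum]
  refine (norm_prod_sub_prod_le_sum _ _ _ (fun i _ => ?_) fun i _ => ?_).trans
    (Finset.sum_le_sum fun i _ =>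
      norm_integral_cexp_sub_gaussian_le P (hξ i) hδ (hb i) (h0 i))
  · refine (norm_integral_le_of_norm_le (integrable_const (1 : ℝ)) (ae_of_all _ fun ω => ?_)).trans
      (by simp)
    rw [Complex.norm_exp_ofReal_mul_I]
  · rw [Complex.norm_exp, Complex.ofReal_re, Real.exp_le_one_iff]
    have : 0 ≤ ∫ ω, ξ i ω ^ 2 ∂P := integral_nonneg fun ω => sq_nonneg _
    linarith

/-! ### Convergence to zero in probability -/

/-- `R n → 0` in probability, for real-valued (not necessarily measurable) `R n`. -/
def IsLittleOProb {Ω : Type*} [MeasurableSpace Ω] (P : Measure Ω) (R : ℕ → Ω → ℝ) : Prop :=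
  ∀ ε > 0, Tendsto (fun n => P {ω | ε ≤ |R n ω|}) atTop (𝓝 0)

namespace IsLittleOProb

variable {Ω : Type*} [MeasurableSpace Ω] {P : Measure Ω} {R R' : ℕ → Ω → ℝ}

lemma of_eventually_le (h : IsLittleOProb P R) (hle : ∀ᶠ n in atTop, ∀ ω, |R' n ω| ≤ |R n ω|) :
    IsLittleOProb P R' := by
  intro ε hε
  refine tendsto_of_tendsto_of_tendsto_of_le_of_le' tendsto_const_nhds (h ε hε)
    (Eventually.of_forall fun _ => zero_le) ?_
  filter_upwards [hle] with n hn
  exact measure_mono fun ω (hω : ε ≤ _) => hω.trans (hn ω)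

lemma of_le (h : IsLittleOProb P R) (hle : ∀ n ω, |R' n ω| ≤ |R n ω|) : IsLittleOProb P R' :=
  h.of_eventually_le (Eventually.of_forall hle)

lemma congr' (h : IsLittleOProb P R) (he : ∀ᶠ n in atTop, ∀ ω, R' n ω = R n ω) :
    IsLittleOProb P R' :=
  h.of_eventually_le (he.mono fun n hn ω => by rw [hn])

lemma abs (h : IsLittleOProb P R) : IsLittleOProb P fun n ω => |R n ω| :=
  h.of_le fun n ω => by simp

lemma add (h : IsLittleOProb P R) (h' : IsLittleOProb P R') :
    IsLittleOProb P fun n ω => R n ω + R' n ω := by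
  intro ε hε
  have h2 := (h (ε / 2) (by positivity)).add (h' (ε / 2) (by positivity))
  rw [add_zero] at h2
  refine tendsto_of_tendsto_of_tendsto_of_le_of_le tendsto_const_nhds h2
    (fun _ => zero_le) fun n => ?_
  refine (measure_mono fun ω (hω : ε ≤ _) => ?_).trans (measure_union_le _ _)
  by_contra hcon
  simp only [Set.mem_union, Set.mem_ofPred_eq, not_or, not_le] at hcon
  linarith [abs_add_le (R n ω) (R' n ω)]

lemma zero : IsLittleOProb P fun _ _ => 0 := by
  intro ε hε
  simp [not_le.2 hε]

lemma mul_bdd (h : IsLittleOProb P R) {C : ℝ} (hC : ∀ n ω, |R' n ω| ≤ C) :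
    IsLittleOProb P fun n ω => R' n ω * R n ω := by
  intro ε hε
  have hpos : 0 < max C 1 := by positivity
  refine tendsto_of_tendsto_of_tendsto_of_le_of_le tendsto_const_nhds
    (h (ε / max C 1) (by positivity)) (fun _ => zero_le) fun n => measure_mono fun ω hω => ?_
  simp only [Set.mem_ofPred_eq, abs_mul] at hω ⊢
  rw [div_le_iff₀ hpos]
  refine hω.trans ?_
  rw [mul_comm]
  gcongr
  exact (hC n ω).trans (le_max_left _ _)

lemma const_mul (h : IsLittleOProb P R) (c : ℝ) : IsLittleOProb P fun n ω => c * R n ω :=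
  h.mul_bdd (R' := fun _ _ => c) (C := |c|) fun _ _ => le_rfl

lemma neg (h : IsLittleOProb P R) : IsLittleOProb P fun n ω => -R n ω :=
  h.of_le fun n ω => by simp

lemma sub (h : IsLittleOProb P R) (h' : IsLittleOProb P R') :
    IsLittleOProb P fun n ω => R n ω - R' n ω := by
  simpa [sub_eq_add_neg] using h.add h'.neg

lemma sum {ι : Type*} (s : Finset ι) {R : ι → ℕ → Ω → ℝ} (h : ∀ i ∈ s, IsLittleOProb P (R i)) :
    IsLittleOProb P fun n ω => ∑ i ∈ s, R i n ω := by
  classical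
  induction s using Finset.induction_on with
  | empty => simpa using zero
  | insert j s hj ih =>
    simp only [Finset.sum_insert hj]
    exact (h j (Finset.mem_insert_self _ _)).add
      (ih fun i hi => h i (Finset.mem_insert_of_mem hi))

lemma of_tendsto {r : ℕ → ℝ} (hr : Tendsto r atTop (𝓝 0)) : IsLittleOProb P fun n _ => r n := by
  intro ε hε
  refine tendsto_const_nhds.congr' ?_
  filter_upwards [(tendsto_order.1 (by simpa using hr.abs)).2 ε hε] with n hn
  simp [not_le.2 hn]

/-- Convergence to zero in `L¹` implies convergence to zero in probability. -/
lemma of_integral [IsFiniteMeasure P] (hR : ∀ᶠ n in atTop, Integrable (R n) P)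
    (h : Tendsto (fun n => ∫ ω, |R n ω| ∂P) atTop (𝓝 0)) : IsLittleOProb P R := by
  intro ε hε
  have h1 : Tendsto (fun n => ENNReal.ofReal ((∫ ω, |R n ω| ∂P) / ε)) atTop (𝓝 0) := by
    simpa using ENNReal.tendsto_ofReal (h.div_const ε)
  refine tendsto_of_tendsto_of_tendsto_of_le_of_le' tendsto_const_nhds h1
    (Eventually.of_forall fun _ => zero_le) ?_
  filter_upwards [hR] with n hn
  have := mul_meas_ge_le_integral_of_nonneg (μ := P) (ae_of_all _ fun ω => abs_nonneg (R n ω))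
    hn.abs ε
  rw [← ofReal_measureReal]
  apply ENNReal.ofReal_le_ofReal
  rw [le_div_iff₀ hε, mul_comm]
  exact this

/-- Convergence to zero in `L²` implies convergence to zero in probability. -/
lemma of_integral_sq [IsFiniteMeasure P] (hR : ∀ᶠ n in atTop, Integrable (fun ω => R n ω ^ 2) P)
    (h : Tendsto (fun n => ∫ ω, R n ω ^ 2 ∂P) atTop (𝓝 0)) : IsLittleOProb P R := by
  have h1 : IsLittleOProb P fun n ω => R n ω ^ 2 :=
    of_integral hR (by simpa using h)
  intro ε hε
  refine (h1 (ε ^ 2) (by positivity)).congr fun n => ?_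
  congr 1
  ext ω
  simp only [Set.mem_ofPred_eq, abs_pow]
  exact pow_le_pow_iff_left₀ hε.le (abs_nonneg _) (by norm_num)

end IsLittleOProb

/-- Bounded convergence: uniformly bounded functions dominated by a sequence that is `o_p(1)` have
integrals tending to zero. -/
lemma tendsto_integral_zero_of_isLittleOProb {Ω F : Type*} [MeasurableSpace Ω] {P : Measure Ω}
    [IsProbabilityMeasure P] [NormedAddCommGroup F] [NormedSpace ℝ F]
    {f : ℕ → Ω → F} {R : ℕ → Ω → ℝ} {C : ℝ}
    (hf : ∀ᶠ n in atTop, AEStronglyMeasurable (f n) P) (hC : ∀ᶠ n in atTop, ∀ ω, ‖f n ω‖ ≤ C)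
    (hR : IsLittleOProb P R) (hle : ∀ᶠ n in atTop, ∀ ω, ‖f n ω‖ ≤ |R n ω|) :
    Tendsto (fun n => ∫ ω, f n ω ∂P) atTop (𝓝 0) := by
  have hC0 : 0 ≤ max C 0 := le_max_right _ _
  rw [Metric.tendsto_nhds]
  intro ε hε
  have h1 : Tendsto (fun n => ε / 2 + max C 0 * P.real {ω | ε / 2 ≤ |R n ω|}) atTop
      (𝓝 (ε / 2 + max C 0 * 0)) := by
    refine (((ENNReal.tendsto_toReal ENNReal.zero_ne_top).comp
      (hR (ε / 2) (by positivity))).const_mul _).const_add _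
  filter_upwards [hf, hC, hle, (tendsto_order.1 h1).2 ε (by simpa using half_lt_self hε)]
    with n hfn hCn hlen hn
  rw [dist_zero_right]
  refine lt_of_le_of_lt ?_ hn
  set A := {ω | ε / 2 ≤ ‖f n ω‖} with hA
  have hAm : NullMeasurableSet A P :=
    nullMeasurableSet_le aemeasurable_const hfn.norm.aemeasurable
  have hle2 : P.real A ≤ P.real {ω | ε / 2 ≤ |R n ω|} :=
    measureReal_mono fun ω (hω : _ ≤ _) => le_trans hω (hlen ω)
  calc ‖∫ ω, f n ω ∂P‖ ≤ ∫ ω, (ε / 2 + A.indicator (fun _ => max C 0) ω) ∂P := by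
        refine norm_integral_le_of_norm_le
          ((integrable_const _).add ((integrable_const _).indicator₀ hAm)) (ae_of_all _ fun ω => ?_)
        by_cases hω : ω ∈ A
        · rw [Set.indicator_of_mem hω]
          linarith [hCn ω, le_max_left C 0]
        · rw [Set.indicator_of_notMem hω]
          simp only [hA, Set.mem_ofPred_eq, not_le] at hω
          linarith
    _ = ε / 2 + max C 0 * P.real A := by
        rw [integral_add (integrable_const _) ((integrable_const _).indicator₀ hAm),
          integral_indicator₀ hAm]
        simp [mul_comm]
    _ ≤ _ := by gcongr

/-! ### Independence of blocks -/

/-- The blocks of an independent family indexed by a sigma type are independent. -/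
lemma iIndepFun_blocks {Ω ι : Type*} [MeasurableSpace Ω] {P : Measure Ω} {κ : ι → Type*}
    {𝓧 : (i : ι) → κ i → Type*} [∀ i j, MeasurableSpace (𝓧 i j)]
    {X : (i : ι) → (j : κ i) → Ω → 𝓧 i j} (mX : ∀ i j, Measurable (X i j))
    (h : iIndepFun (fun (p : (i : ι) × κ i) ω => X p.1 p.2 ω) P) :
    iIndepFun (fun i ω j => X i j ω) P := by
  have := h.isProbabilityMeasure
  have : ∀ i j, IsProbabilityMeasure (P.map (X i j)) :=
    fun i j => Measure.isProbabilityMeasure_map (mX i j).aemeasurable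
  have hrow : ∀ i, iIndepFun (X i) P := fun i =>
    h.precomp (g := fun j : κ i => (⟨i, j⟩ : (i : ι) × κ i)) sigma_mk_injective
  have hcomp : (MeasurableEquiv.piCurry 𝓧) ∘ (fun ω p => X p.1 p.2 ω) = fun ω i j => X i j ω := by
    ext; simp [Sigma.curry]
  rw [iIndepFun_iff_map_fun_eq_infinitePi_map (by fun_prop), ← hcomp,
    ← Measure.map_map (by fun_prop) (by fun_prop),
    (iIndepFun_iff_map_fun_eq_infinitePi_map (by fun_prop)).1 h,
    Measure.infinitePi_map_piCurry (fun i j => P.map (X i j))]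
  congr with i
  rw [(iIndepFun_iff_map_fun_eq_infinitePi_map (by fun_prop)).1 (hrow i)]

/-! ### Bounded measurable functions and product kernels -/

/-- Bounded measurable real functions. -/
def IsBddMeas {E : Type*} [MeasurableSpace E] (f : E → ℝ) : Prop :=
  Measurable f ∧ ∃ C, ∀ x, |f x| ≤ C

namespace IsBddMeas

variable {E F : Type*} [MeasurableSpace E] [MeasurableSpace F] {f g : E → ℝ}

lemma const (c : ℝ) : IsBddMeas fun _ : E => c := ⟨measurable_const, |c|, fun _ => le_rfl⟩

lemma add (hf : IsBddMeas f) (hg : IsBddMeas g) : IsBddMeas fun x => f x + g x := by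
  obtain ⟨hf, C, hC⟩ := hf
  obtain ⟨hg, C', hC'⟩ := hg
  exact ⟨hf.add hg, C + C', fun x => (abs_add_le _ _).trans (add_le_add (hC x) (hC' x))⟩

lemma mul (hf : IsBddMeas f) (hg : IsBddMeas g) : IsBddMeas fun x => f x * g x := by
  obtain ⟨hf, C, hC⟩ := hf
  obtain ⟨hg, C', hC'⟩ := hg
  refine ⟨hf.mul hg, C * C', fun x => ?_⟩
  rw [abs_mul]
  exact mul_le_mul (hC x) (hC' x) (abs_nonneg _) ((abs_nonneg _).trans (hC x))

lemma const_mul (hf : IsBddMeas f) (c : ℝ) : IsBddMeas fun x => c * f x := (const c).mul hf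

lemma sub (hf : IsBddMeas f) (hg : IsBddMeas g) : IsBddMeas fun x => f x - g x := by
  simpa [sub_eq_add_neg] using hf.add (hg.const_mul (-1))

lemma sum {ι : Type*} {s : Finset ι} {f : ι → E → ℝ} (hf : ∀ i ∈ s, IsBddMeas (f i)) :
    IsBddMeas fun x => ∑ i ∈ s, f i x := by
  classical
  induction s using Finset.induction_on with
  | empty => simpa using const 0
  | insert j s hj ih =>
    simp only [Finset.sum_insert hj]
    exact (hf j (Finset.mem_insert_self _ _)).add
      (ih fun i hi => hf i (Finset.mem_insert_of_mem hi))

lemma prod {ι : Type*} {s : Finset ι} {f : ι → E → ℝ} (hf : ∀ i ∈ s, IsBddMeas (f i)) :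
    IsBddMeas fun x => ∏ i ∈ s, f i x := by
  classical
  induction s using Finset.induction_on with
  | empty => simpa using const 1
  | insert j s hj ih =>
    simp only [Finset.prod_insert hj]
    exact (hf j (Finset.mem_insert_self _ _)).mul
      (ih fun i hi => hf i (Finset.mem_insert_of_mem hi))

lemma comp {f : F → ℝ} (hf : IsBddMeas f) {φ : E → F} (hφ : Measurable φ) :
    IsBddMeas fun x => f (φ x) :=
  ⟨hf.1.comp hφ, hf.2.imp fun _ hC x => hC (φ x)⟩

lemma memLp (hf : IsBddMeas f) (μ : Measure E) [IsFiniteMeasure μ] (p : ℝ≥0∞) : MemLp f p μ := by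
  obtain ⟨hf, C, hC⟩ := hf
  exact MemLp.of_bound hf.aestronglyMeasurable C (ae_of_all _ hC)

lemma integrable (hf : IsBddMeas f) (μ : Measure E) [IsFiniteMeasure μ] : Integrable f μ :=
  (hf.memLp μ 1).integrable le_rfl

end IsBddMeas

/-- Linear combinations of the products `x ↦ ∏ j, g j (x j)` of bounded measurable functions of the
single arguments. -/
def productKernels (E : Type*) [MeasurableSpace E] (l : ℕ) : Submodule ℝ ((Fin (l + 1) → E) → ℝ) :=
  Submodule.span ℝ {κ | ∃ g : Fin (l + 1) → E → ℝ, (∀ j, IsBddMeas (g j)) ∧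
    κ = fun x => ∏ j, g j (x j)}

section productKernels

variable {E : Type*} [MeasurableSpace E] {l : ℕ} {κ κ' : (Fin (l + 1) → E) → ℝ}

lemma prod_mem_productKernels {g : Fin (l + 1) → E → ℝ} (hg : ∀ j, IsBddMeas (g j)) :
    (fun x => ∏ j, g j (x j)) ∈ productKernels E l :=
  Submodule.subset_span ⟨g, hg, rfl⟩

lemma one_mem_productKernels : (1 : (Fin (l + 1) → E) → ℝ) ∈ productKernels E l := by
  convert prod_mem_productKernels (E := E) (l := l) (g := fun _ _ => 1) fun _ => .const 1
  simp

lemma const_mem_productKernels (c : ℝ) :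
    (fun _ => c : (Fin (l + 1) → E) → ℝ) ∈ productKernels E l := by
  convert (productKernels E l).smul_mem c one_mem_productKernels
  simp

lemma isBddMeas_of_mem_productKernels (h : κ ∈ productKernels E l) : IsBddMeas κ := by
  induction h using Submodule.span_induction with
  | mem κ hκ =>
    obtain ⟨g, hg, rfl⟩ := hκ
    exact IsBddMeas.prod fun j _ => (hg j).comp (measurable_pi_apply j)
  | zero => exact .const 0
  | add _ _ _ _ h h' => exact h.add h'
  | smul c _ _ h => exact h.const_mul c

lemma mul_mem_productKernels (h : κ ∈ productKernels E l) (h' : κ' ∈ productKernels E l) :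
    κ * κ' ∈ productKernels E l := by
  have := Submodule.mul_mem_mul h h'
  rw [productKernels, Submodule.span_mul_span] at this
  refine Submodule.span_mono ?_ this
  rintro _ ⟨_, ⟨g, hg, rfl⟩, _, ⟨g', hg', rfl⟩, rfl⟩
  refine ⟨fun j x => g j x * g' j x, fun j => (hg j).mul (hg' j), ?_⟩
  ext x
  simp [Finset.prod_mul_distrib]

/-- The sets whose indicator is a product kernel form an algebra that generates the product
`σ`-algebra, so that product kernels are dense in `L²`. -/
lemma exists_productKernel_eLpNorm_sub_le (μ : Measure (Fin (l + 1) → E)) [IsFiniteMeasure μ]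
    (hκ : MemLp κ 2 μ) {ε : ℝ≥0∞} (hε : ε ≠ 0) :
    ∃ κ' ∈ productKernels E l, eLpNorm (κ - κ') 2 μ ≤ ε := by
  let 𝒜 : Set (Set (Fin (l + 1) → E)) :=
    {s | MeasurableSet s ∧ s.indicator 1 ∈ productKernels E l}
  have hcompl : ∀ s ∈ 𝒜, sᶜ ∈ 𝒜 := fun s hs => ⟨hs.1.compl, by
    rw [Set.indicator_compl]
    exact Submodule.sub_mem _ one_mem_productKernels hs.2⟩
  have halg : IsSetAlgebra 𝒜 :=
    { empty_mem := ⟨.empty, by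
        rw [Set.indicator_empty]
        exact Submodule.zero_mem _⟩
      compl_mem := fun s hs => hcompl s hs
      union_mem := fun s t hs ht => ⟨hs.1.union ht.1, by
        have : (s ∪ t).indicator (1 : (Fin (l + 1) → E) → ℝ)
            = s.indicator 1 + t.indicator 1 - s.indicator 1 * t.indicator 1 := by
          ext x
          by_cases h1 : x ∈ s <;> by_cases h2 : x ∈ t <;> simp [h1, h2]
        rw [this]
        exact Submodule.sub_mem _ (Submodule.add_mem _ hs.2 ht.2)
          (mul_mem_productKernels hs.2 ht.2)⟩ }
  have hgen : (inferInstance : MeasurableSpace (Fin (l + 1) → E))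
      = MeasurableSpace.generateFrom 𝒜 := by
    refine le_antisymm ?_ (MeasurableSpace.generateFrom_le fun s hs => hs.1)
    change MeasurableSpace.pi ≤ _
    rw [← generateFrom_pi]
    refine MeasurableSpace.generateFrom_mono ?_
    rintro _ ⟨t, ht, rfl⟩
    have ht' : ∀ j, MeasurableSet (t j) := fun j => ht j (Set.mem_univ j)
    refine ⟨MeasurableSet.univ_pi ht', ?_⟩
    convert prod_mem_productKernels (E := E) (l := l) (g := fun j => (t j).indicator 1)
      fun j => ⟨measurable_one.indicator (ht' j), 1, fun x => ?_⟩
    · rename_i x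
      classical
      by_cases hx : x ∈ Set.univ.pi t
      · rw [Set.indicator_of_mem hx, Pi.one_apply, Finset.prod_eq_one]
        intro j _
        rw [Set.indicator_of_mem (hx j (Set.mem_univ j)), Pi.one_apply]
      · rw [Set.indicator_of_notMem hx]
        simp only [Set.mem_pi, Set.mem_univ, true_implies, not_forall] at hx
        obtain ⟨j, hj⟩ := hx
        exact (Finset.prod_eq_zero (Finset.mem_univ j) (Set.indicator_of_notMem hj _)).symm
    · by_cases hx : x ∈ t j <;> simp [hx]
  have hdense := Measure.MeasureDense.of_generateFrom_isSetAlgebra_finite (μ := μ) halg hgen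
  have happrox : ∀ (c : ℝ) ⦃s : Set (Fin (l + 1) → E)⦄, MeasurableSet s → μ s < ∞ →
      ∀ {ε : ℝ≥0∞}, ε ≠ 0 → ∃ κ', eLpNorm (κ' - s.indicator fun _ => c) 2 μ ≤ ε ∧
        κ' ∈ productKernels E l := by
    intro c s hs _ ε hε
    obtain ⟨η, hη, hη'⟩ := exists_eLpNorm_indicator_le (p := 2) (μ := μ) (by simp) c hε
    have hηpos : (0 : ℝ) < η := by exact_mod_cast hη
    obtain ⟨t, ht, hst⟩ := hdense.approx s hs (measure_ne_top _ _) η hηpos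
    refine ⟨t.indicator fun _ => c, ?_, ?_⟩
    · rw [eLpNorm_indicator_sub_indicator]
      refine hη' _ ?_
      simpa [symmDiff_comm] using hst.le
    · convert (productKernels E l).smul_mem c ht.2
      ext x
      by_cases hx : x ∈ t <;> simp [hx]
  obtain ⟨κ', h1, h2⟩ := MemLp.induction_dense (by simp) (fun κ => κ ∈ productKernels E l) happrox
    (fun f g hf hg => Submodule.add_mem _ hf hg)
    (fun f hf => (isBddMeas_of_mem_productKernels hf).1.aestronglyMeasurable) hκ hε
  exact ⟨κ', h2, h1⟩

/-- Centred square-integrable kernels are `L²`-limits of centred product kernels. -/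
lemma exists_centred_productKernel_approx (μ : Measure (Fin (l + 1) → E)) [IsProbabilityMeasure μ]
    (hκ : MemLp κ 2 μ) (h0 : ∫ x, κ x ∂μ = 0) {ε : ℝ} (hε : 0 < ε) :
    ∃ κ' ∈ productKernels E l, ∫ x, κ' x ∂μ = 0 ∧ ∫ x, (κ x - κ' x) ^ 2 ∂μ ≤ ε := by
  obtain ⟨κ₁, h1, h2⟩ := exists_productKernel_eLpNorm_sub_le μ hκ (ε := ENNReal.ofReal (√ε))
    (by simpa using hε)
  have hb := isBddMeas_of_mem_productKernels h1
  set c := ∫ x, κ₁ x ∂μ with hc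
  have hd : MemLp (κ - κ₁) 2 μ := hκ.sub (hb.memLp μ 2)
  refine ⟨κ₁ - fun _ => c, Submodule.sub_mem _ h1 (const_mem_productKernels c), ?_, ?_⟩
  · simp only [Pi.sub_apply]
    rw [integral_sub (hb.integrable μ) (integrable_const _)]
    simp [hc]
  · have hmean : ∫ x, (κ - κ₁) x ∂μ = -c := by
      simp only [Pi.sub_apply]
      rw [integral_sub (hκ.integrable (by norm_num)) (hb.integrable μ), h0, zero_sub]
    have hv : ∫ x, (κ x - (κ₁ - fun _ => c : (Fin (l + 1) → E) → ℝ) x) ^ 2 ∂μ = Var[κ - κ₁; μ] := by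
      rw [variance_eq_integral hd.aestronglyMeasurable.aemeasurable, hmean]
      congr 1 with x
      simp only [Pi.sub_apply]
      ring
    have hsq : ∫ x, (κ - κ₁) x ^ 2 ∂μ ≤ ε := by
      have h3 := hd.eLpNorm_eq_integral_rpow_norm (by norm_num) (by norm_num)
      rw [h3] at h2
      have h4 := (ENNReal.ofReal_le_ofReal_iff (Real.sqrt_nonneg _)).1 h2
      have h5 : (∫ x, ‖(κ - κ₁) x‖ ^ (2 : ℝ≥0∞).toReal ∂μ) = ∫ x, (κ - κ₁) x ^ 2 ∂μ := by
        congr 1 with x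
        simp
      rw [h5] at h4
      have h6 : (∫ x, (κ - κ₁) x ^ 2 ∂μ) ^ (2 : ℝ≥0∞).toReal⁻¹
          = √(∫ x, (κ - κ₁) x ^ 2 ∂μ) := by
        rw [Real.sqrt_eq_rpow]; norm_num
      rw [h6] at h4
      exact (Real.sqrt_le_sqrt_iff hε.le).1 h4
    rw [hv]
    exact (variance_le_expectation_sq hd.aestronglyMeasurable).trans (by simpa using hsq)

end productKernels

/-! ### Linearization of conditional means of product kernels -/

/-- `D` is a sequence of independent random elements with common law `μ`. -/
structure IsIIDSequence {Ω E : Type*} [MeasurableSpace Ω] [MeasurableSpace E] (P : Measure Ω)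
    (D : ℕ → Ω → E) (μ : Measure E) : Prop where
  measurable : ∀ i, Measurable (D i)
  indep : iIndepFun D P
  map_eq : ∀ i, P.map (D i) = μ

/-- The average of `h` over the first `n` terms of the sequence `x`. -/
noncomputable def average {E : Type*} (n : ℕ) (h : E → ℝ) (x : ℕ → E) : ℝ :=
  (n : ℝ)⁻¹ * ∑ i ∈ Finset.range n, h (x i)

lemma abs_average_le {E : Type*} {h : E → ℝ} {C : ℝ} (hC : ∀ x, |h x| ≤ C) (hC0 : 0 ≤ C)
    (n : ℕ) (x : ℕ → E) : |average n h x| ≤ C := by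
  rw [average, abs_mul, abs_of_nonneg (by positivity)]
  rcases Nat.eq_zero_or_pos n with rfl | hn
  · simpa using hC0
  calc (n : ℝ)⁻¹ * |∑ i ∈ Finset.range n, h (x i)| ≤ (n : ℝ)⁻¹ * (n * C) := by
        gcongr
        refine (Finset.abs_sum_le_sum_abs _ _).trans ((Finset.sum_le_sum fun i _ => hC _).trans ?_)
        simp
    _ = C := by field_simp

lemma average_add {E : Type*} (n : ℕ) (f g : E → ℝ) (x : ℕ → E) :
    average n (fun y => f y + g y) x = average n f x + average n g x := by
  simp only [average, Finset.sum_add_distrib, mul_add]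

lemma average_const_mul {E : Type*} (n : ℕ) (c : ℝ) (f : E → ℝ) (x : ℕ → E) :
    average n (fun y => c * f y) x = c * average n f x := by
  simp only [average, ← Finset.mul_sum]
  ring

lemma average_sub_const {E : Type*} {n : ℕ} (hn : n ≠ 0) (f : E → ℝ) (c : ℝ) (x : ℕ → E) :
    average n (fun y => f y - c) x = average n f x - c := by
  have : (n : ℝ) ≠ 0 := by exact_mod_cast hn
  simp only [average, Finset.sum_sub_distrib, mul_sub, Finset.sum_const, Finset.card_range,
    nsmul_eq_mul]
  field_simp

section

variable {Ω E : Type*} [MeasurableSpace Ω] [MeasurableSpace E] {P : Measure Ω}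
  [IsProbabilityMeasure P] {D : ℕ → Ω → E} {μ : Measure E}

lemma IsIIDSequence.isProbabilityMeasure (hD : IsIIDSequence P D μ) : IsProbabilityMeasure μ := by
  rw [← hD.map_eq 0]
  exact Measure.isProbabilityMeasure_map (hD.measurable 0).aemeasurable

lemma IsIIDSequence.integral_comp (hD : IsIIDSequence P D μ) {h : E → ℝ} (hh : Measurable h)
    (i : ℕ) : ∫ ω, h (D i ω) ∂P = ∫ x, h x ∂μ := by
  rw [← hD.map_eq i, integral_map (hD.measurable i).aemeasurable hh.aestronglyMeasurable]

lemma IsIIDSequence.integral_sq_sum (hD : IsIIDSequence P D μ) {h : E → ℝ} (hh : IsBddMeas h)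
    (h0 : ∫ x, h x ∂μ = 0) (n : ℕ) :
    ∫ ω, (∑ i ∈ Finset.range n, h (D i ω)) ^ 2 ∂P = n * ∫ x, h x ^ 2 ∂μ := by
  have hL : ∀ i, MemLp (fun ω => h (D i ω)) 2 P := fun i => (hh.comp (hD.measurable i)).memLp P 2
  have hmean : ∀ i, ∫ ω, h (D i ω) ∂P = 0 := fun i => by rw [hD.integral_comp hh.1, h0]
  have hvar := IndepFun.variance_sum (μ := P) (X := fun i ω => h (D i ω)) (s := Finset.range n)
    (fun i _ => hL i) fun i _ j _ hij => (hD.indep.indepFun hij).comp hh.1 hh.1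
  have h1 : ∀ i, Var[fun ω => h (D i ω); P] = ∫ x, h x ^ 2 ∂μ := fun i => by
    rw [variance_of_integral_eq_zero (hL i).aestronglyMeasurable.aemeasurable (hmean i)]
    exact hD.integral_comp (hh.1.pow_const 2) i
  rw [variance_of_integral_eq_zero
    (memLp_finsetSum' _ fun i _ => hL i).aestronglyMeasurable.aemeasurable] at hvar
  · simpa [h1] using hvar
  · simp only [Finset.sum_apply]
    rw [integral_finsetSum _ fun i _ => (hL i).integrable (by norm_num)]
    simp [hmean]

lemma IsIIDSequence.isBddMeas_average (hD : IsIIDSequence P D μ) {h : E → ℝ} (hh : IsBddMeas h)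
    (n : ℕ) : IsBddMeas fun ω => average n h fun i => D i ω :=
  (IsBddMeas.sum fun i _ => hh.comp (hD.measurable i)).const_mul _

lemma IsIIDSequence.integral_sq_average (hD : IsIIDSequence P D μ) {h : E → ℝ} (hh : IsBddMeas h)
    (h0 : ∫ x, h x ∂μ = 0) (n : ℕ) :
    ∫ ω, (average n h fun i => D i ω) ^ 2 ∂P = (n : ℝ)⁻¹ * ∫ x, h x ^ 2 ∂μ := by
  simp only [average, mul_pow]
  rw [integral_const_mul, hD.integral_sq_sum hh h0]
  rcases Nat.eq_zero_or_pos n with rfl | hn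
  · simp
  · have : (n : ℝ) ≠ 0 := by positivity
    field_simp

lemma tendsto_inv_of_tendsto_div {k : ℕ → ℕ} {c : ℝ} (hk : Tendsto k atTop atTop)
    (hc : Tendsto (fun n : ℕ => (n : ℝ) / (k n : ℝ)) atTop (𝓝 c)) :
    Tendsto (fun n : ℕ => ((k n : ℕ) : ℝ)⁻¹) atTop (𝓝 0) ∧
    Tendsto (fun n : ℕ => √(n : ℝ) * ((k n : ℕ) : ℝ)⁻¹) atTop (𝓝 0) := by
  refine ⟨tendsto_inv_atTop_zero.comp (tendsto_natCast_atTop_atTop.comp hk), ?_⟩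
  have h1 : Tendsto (fun n : ℕ => (√(n : ℝ))⁻¹) atTop (𝓝 0) :=
    tendsto_inv_atTop_zero.comp (Real.tendsto_sqrt_atTop.comp tendsto_natCast_atTop_atTop)
  have h2 := hc.mul h1
  rw [mul_zero] at h2
  refine h2.congr' ?_
  filter_upwards [eventually_gt_atTop 0] with n hn
  have h3 : (0 : ℝ) < √(n : ℝ) := Real.sqrt_pos.2 (by exact_mod_cast hn)
  have h4 : (n : ℝ) = √(n : ℝ) * √(n : ℝ) := (Real.mul_self_sqrt (by positivity)).symm
  rw [div_mul_eq_mul_div, div_eq_mul_inv]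
  congr 1
  rw [← div_eq_mul_inv, div_eq_iff h3.ne', ← h4]

lemma IsIIDSequence.isLittleOProb_average (hD : IsIIDSequence P D μ) {h : E → ℝ}
    (hh : IsBddMeas h) (h0 : ∫ x, h x ∂μ = 0) {k : ℕ → ℕ} (hk : Tendsto k atTop atTop) :
    IsLittleOProb P fun n ω => average (k n) h fun i => D i ω := by
  refine IsLittleOProb.of_integral_sq (Eventually.of_forall fun n => ?_) ?_
  · simp only [pow_two]
    exact ((hD.isBddMeas_average hh _).mul (hD.isBddMeas_average hh _)).integrable P
  · simp only [hD.integral_sq_average hh h0]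
    simpa using (tendsto_inv_atTop_zero.comp (tendsto_natCast_atTop_atTop.comp hk)).mul_const
      (∫ x, h x ^ 2 ∂μ)

/-- Products of two centred averages are negligible at the rate `n^{-1/2}`. -/
lemma IsIIDSequence.isLittleOProb_sqrt_mul_average_mul_average (hD : IsIIDSequence P D μ)
    {h h' : E → ℝ} (hh : IsBddMeas h) (h0 : ∫ x, h x ∂μ = 0) (hh' : IsBddMeas h')
    (h0' : ∫ x, h' x ∂μ = 0) {k k' : ℕ → ℕ} {c c' : ℝ} (hk : Tendsto k atTop atTop)
    (hc : Tendsto (fun n : ℕ => (n : ℝ) / (k n : ℝ)) atTop (𝓝 c)) (hk' : Tendsto k' atTop atTop)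
    (hc' : Tendsto (fun n : ℕ => (n : ℝ) / (k' n : ℝ)) atTop (𝓝 c')) :
    IsLittleOProb P fun (n : ℕ) ω => √(n : ℝ) *
      ((average (k n) h fun i => D i ω) * average (k' n) h' fun i => D i ω) := by
  have key : ∀ {h : E → ℝ} (_ : IsBddMeas h) (_ : ∫ x, h x ∂μ = 0) {k : ℕ → ℕ} {c : ℝ}
      (_ : Tendsto k atTop atTop) (_ : Tendsto (fun n : ℕ => (n : ℝ) / (k n : ℝ)) atTop (𝓝 c)),
      IsLittleOProb P fun (n : ℕ) ω => √(n : ℝ) * (average (k n) h fun i => D i ω) ^ 2 := by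
    intro h hh h0 k c hk hc
    refine IsLittleOProb.of_integral (Eventually.of_forall fun n => ?_) ?_
    · simp only [pow_two]
      exact (((hD.isBddMeas_average hh _).mul (hD.isBddMeas_average hh _)).const_mul _).integrable P
    · have : ∀ (n : ℕ) ω, |√(n : ℝ) * (average (k n) h fun i => D i ω) ^ 2|
          = √(n : ℝ) * (average (k n) h fun i => D i ω) ^ 2 :=
        fun n ω => abs_of_nonneg (by positivity)
      simp only [this]
      simp only [integral_const_mul, hD.integral_sq_average hh h0, ← mul_assoc]
      simpa using (tendsto_inv_of_tendsto_div hk hc).2.mul_const (∫ x, h x ^ 2 ∂μ)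
  refine ((key hh h0 hk hc).add (key hh' h0' hk' hc')).of_le fun n ω => ?_
  set a := average (k n) h fun i => D i ω
  set b := average (k' n) h' fun i => D i ω
  rw [← mul_add, abs_mul, abs_mul √(n : ℝ)]
  refine mul_le_mul_of_nonneg_left ?_ (abs_nonneg _)
  rw [abs_mul, abs_of_nonneg (by positivity : 0 ≤ a ^ 2 + b ^ 2)]
  nlinarith [sq_nonneg (|a| - |b|), sq_abs a, sq_abs b, abs_nonneg a, abs_nonneg b]

lemma integral_sub_integral_eq_zero (μ : Measure E) [IsProbabilityMeasure μ] {g : E → ℝ}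
    (hg : IsBddMeas g) : ∫ x, (g x - ∫ y, g y ∂μ) ∂μ = 0 := by
  rw [integral_sub (hg.integrable μ) (integrable_const _)]
  simp

/-- The delta method for a product of averages. -/
lemma IsIIDSequence.exists_linearization_prod (hD : IsIIDSequence P D μ) {m : ℕ → ℕ} {c : ℝ}
    (hm : Tendsto m atTop atTop)
    (hc : Tendsto (fun n : ℕ => (n : ℝ) / (m n : ℝ)) atTop (𝓝 c))
    {ι : Type*} (s : Finset ι) {g : ι → E → ℝ} (hg : ∀ j ∈ s, IsBddMeas (g j)) :
    ∃ h : E → ℝ, IsBddMeas h ∧ ∫ x, h x ∂μ = 0 ∧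
      IsLittleOProb P fun (n : ℕ) ω => √(n : ℝ) * (∏ j ∈ s, (average (m n) (g j) fun i => D i ω)
        - ∏ j ∈ s, ∫ x, g j x ∂μ - average (m n) h fun i => D i ω) := by
  classical
  have := hD.isProbabilityMeasure
  induction s using Finset.induction_on with
  | empty => exact ⟨fun _ => 0, .const 0, by simp, by simpa [average] using IsLittleOProb.zero⟩
  | insert j s hj ih =>
    obtain ⟨h, hh, h0, hO⟩ := ih fun i hi => hg i (Finset.mem_insert_of_mem hi)
    have hgj := hg j (Finset.mem_insert_self _ _)
    set e := ∫ x, g j x ∂μ with he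
    set E' := ∏ i ∈ s, ∫ x, g i x ∂μ with hE'
    set gt : E → ℝ := fun x => g j x - e with hgt
    have hgtb : IsBddMeas gt := hgj.sub (.const e)
    have hgt0 : ∫ x, gt x ∂μ = 0 := integral_sub_integral_eq_zero μ hgj
    refine ⟨fun x => e * h x + E' * gt x, (hh.const_mul e).add (hgtb.const_mul E'), ?_, ?_⟩
    · rw [integral_add ((hh.const_mul e).integrable μ) ((hgtb.const_mul E').integrable μ),
        integral_const_mul, integral_const_mul, h0, hgt0]
      simp
    · obtain ⟨C, hC⟩ := hgj.2
      have hC' : ∀ x, |g j x| ≤ max C 0 := fun x => (hC x).trans (le_max_left _ _)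
      have h1 := (hD.isLittleOProb_sqrt_mul_average_mul_average hgtb hgt0 hh h0 hm hc hm hc).add
        (hO.mul_bdd (R' := fun n ω => average (m n) (g j) fun i => D i ω)
          fun n ω => abs_average_le hC' (le_max_right _ _) _ _)
      refine h1.congr' ?_
      filter_upwards [hm.eventually_ne_atTop 0] with n hn ω
      rw [Finset.prod_insert hj, Finset.prod_insert hj, average_add, average_const_mul,
        average_const_mul]
      have h2 : average (m n) gt (fun i => D i ω) = average (m n) (g j) (fun i => D i ω) - e :=
        average_sub_const hn _ _ _
      rw [← he, ← hE', h2]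
      ring

end

/-! ### Conditional means given the data -/

lemma integral_empirical {S : Type*} [MeasurableSpace S] {n : ℕ} (x : Fin n → S) {h : S → ℝ}
    (hh : Measurable h) : ∫ s, h s ∂(empirical x) = (n : ℝ)⁻¹ * ∑ i, h (x i) := by
  rw [empirical, integral_smul_measure, integral_finsetSum_measure]
  · simp [integral_dirac' _ _ hh.stronglyMeasurable]
  · exact fun i _ => integrable_dirac' hh.stronglyMeasurable (by simp)

lemma isProbabilityMeasure_empirical {S : Type*} [MeasurableSpace S] {n : ℕ} (hn : n ≠ 0)
    (x : Fin n → S) : IsProbabilityMeasure (empirical x) := by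
  constructor
  simp only [empirical, Measure.smul_apply, Measure.finsetSum_apply, measure_univ,
    Finset.sum_const, Finset.card_univ, Fintype.card_fin, smul_eq_mul, nsmul_eq_mul, mul_one]
  exact ENNReal.inv_mul_cancel (by exact_mod_cast hn) (by simp)

/-- The conditional mean `∫ κ(x, y₁, …, y_l)` of a kernel given its first argument and given the
first `m` terms `d` of the data, when the other arguments are drawn with replacement from these. -/
noncomputable def condMean {E : Type*} [MeasurableSpace E] {l : ℕ} (κ : (Fin (l + 1) → E) → ℝ)
    (m : ℕ) (d : ℕ → E) (x : E) : ℝ :=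
  ∫ y, κ (Fin.cons x y) ∂(Measure.pi fun _ : Fin l => empirical fun k : Fin m => d k)

section condMean

variable {E : Type*} [MeasurableSpace E] {l : ℕ}

lemma measurable_cons (x : E) : Measurable fun y : Fin l → E => (Fin.cons x y : Fin (l + 1) → E) :=
  measurable_pi_iff.2 fun j => by
    refine Fin.cases ?_ (fun j => ?_) j
    · simp
    · simpa using measurable_pi_apply j

lemma condMean_add {κ κ' : (Fin (l + 1) → E) → ℝ} (h : IsBddMeas κ) (h' : IsBddMeas κ') {m : ℕ}
    (hm : m ≠ 0) (d : ℕ → E) (x : E) :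
    condMean (κ + κ') m d x = condMean κ m d x + condMean κ' m d x := by
  have := isProbabilityMeasure_empirical hm fun k : Fin m => d k
  exact integral_add ((h.comp (measurable_cons x)).integrable _)
    ((h'.comp (measurable_cons x)).integrable _)

lemma condMean_smul (κ : (Fin (l + 1) → E) → ℝ) (c : ℝ) (m : ℕ) (d : ℕ → E) (x : E) :
    condMean (c • κ) m d x = c * condMean κ m d x :=
  integral_const_mul _ _

lemma condMean_prod {g : Fin (l + 1) → E → ℝ} (hg : ∀ j, IsBddMeas (g j)) {m : ℕ}
    (hm : m ≠ 0) (d : ℕ → E) (x : E) :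
    condMean (fun z => ∏ j, g j (z j)) m d x = g 0 x * ∏ j : Fin l, average m (g j.succ) d := by
  have := isProbabilityMeasure_empirical hm fun k : Fin m => d k
  simp only [condMean, Fin.prod_univ_succ, Fin.cons_zero, Fin.cons_succ]
  rw [integral_const_mul, integral_fintype_prod_eq_prod (ι := Fin l) (fun j => g j.succ)]
  congr 2 with j
  rw [integral_empirical _ (hg _).1, average,
    Fin.sum_univ_eq_sum_range (fun k => g j.succ (d k)) m]

end condMean

/-- First-order expansion of the conditional mean of a kernel `κ`: up to the constant `∫ κ`, it is
uniformly close to `f`, and its average over the subjects is `f` averaged over the `n` subjects plus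
`g` averaged over the `m n` observed errors, up to `o_p(n^{-1/2})`. So `f` and `g` are the two parts
of the first-order Hoeffding projection of `κ`. -/
structure HasLinearization {Ω E : Type*} [MeasurableSpace Ω] [MeasurableSpace E] (P : Measure Ω)
    (D : ℕ → Ω → E) (μ : Measure E) (m : ℕ → ℕ) {l : ℕ} (κ : (Fin (l + 1) → E) → ℝ)
    (f g : E → ℝ) : Prop where
  bdd_left : IsBddMeas f
  bdd_right : IsBddMeas g
  integral_left : ∫ x, f x ∂μ = 0
  integral_right : ∫ x, g x ∂μ = 0
  uniform : ∃ R, IsLittleOProb P R ∧ ∀ᶠ n in atTop, ∀ ω x,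
    |condMean κ (m n) (fun i => D i ω) x - ∫ z, κ z ∂(Measure.pi fun _ => μ) - f x| ≤ |R n ω|
  mean : IsLittleOProb P fun (n : ℕ) ω => √(n : ℝ) * ((average n
      (fun x => condMean κ (m n) (fun i => D i ω) x) fun i => D i ω)
    - ∫ z, κ z ∂(Measure.pi fun _ => μ)
    - (average n f fun i => D i ω) - average (m n) g fun i => D i ω)

section HasLinearization

variable {Ω E : Type*} [MeasurableSpace Ω] [MeasurableSpace E] {P : Measure Ω}
  [IsProbabilityMeasure P] {D : ℕ → Ω → E} {μ : Measure E} {m : ℕ → ℕ} {l : ℕ}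
  {κ κ' : (Fin (l + 1) → E) → ℝ} {f f' g g' : E → ℝ}

lemma HasLinearization.add (hD : IsIIDSequence P D μ) (hm : Tendsto m atTop atTop)
    (hκ : IsBddMeas κ) (hκ' : IsBddMeas κ')
    (h : HasLinearization P D μ m κ f g) (h' : HasLinearization P D μ m κ' f' g') :
    HasLinearization P D μ m (κ + κ') (fun x => f x + f' x) (fun x => g x + g' x) := by
  have := hD.isProbabilityMeasure
  have hI : ∫ z, (κ + κ') z ∂(Measure.pi fun _ => μ)
      = ∫ z, κ z ∂(Measure.pi fun _ => μ) + ∫ z, κ' z ∂(Measure.pi fun _ => μ) :=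
    integral_add (hκ.integrable _) (hκ'.integrable _)
  refine ⟨h.bdd_left.add h'.bdd_left, h.bdd_right.add h'.bdd_right, ?_, ?_, ?_, ?_⟩
  · rw [integral_add (h.bdd_left.integrable _) (h'.bdd_left.integrable _), h.integral_left,
      h'.integral_left, add_zero]
  · rw [integral_add (h.bdd_right.integrable _) (h'.bdd_right.integrable _), h.integral_right,
      h'.integral_right, add_zero]
  · obtain ⟨R, hR, hle⟩ := h.uniform
    obtain ⟨R', hR', hle'⟩ := h'.uniform
    refine ⟨_, hR.abs.add hR'.abs, ?_⟩
    filter_upwards [hle, hle', hm.eventually_ne_atTop 0] with n h1 h2 hn ω x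
    rw [hI, condMean_add hκ hκ' hn, abs_of_nonneg (by positivity : 0 ≤ |R n ω| + |R' n ω|)]
    refine le_trans ?_ (add_le_add (h1 ω x) (h2 ω x))
    refine le_trans (le_of_eq ?_) (abs_add_le _ _)
    congr 1
    ring
  · refine (h.mean.add h'.mean).congr' ?_
    filter_upwards [hm.eventually_ne_atTop 0] with n hn ω
    simp only [hI, condMean_add hκ hκ' hn, average_add]
    ring

lemma HasLinearization.smul (c : ℝ) (h : HasLinearization P D μ m κ f g) :
    HasLinearization P D μ m (c • κ) (fun x => c * f x) (fun x => c * g x) := by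
  have hI : ∫ z, (c • κ) z ∂(Measure.pi fun _ => μ) = c * ∫ z, κ z ∂(Measure.pi fun _ => μ) :=
    integral_const_mul _ _
  refine ⟨h.bdd_left.const_mul c, h.bdd_right.const_mul c, ?_, ?_, ?_, ?_⟩
  · rw [integral_const_mul, h.integral_left, mul_zero]
  · rw [integral_const_mul, h.integral_right, mul_zero]
  · obtain ⟨R, hR, hle⟩ := h.uniform
    refine ⟨_, hR.const_mul c, ?_⟩
    filter_upwards [hle] with n h1 ω x
    rw [hI, condMean_smul, ← mul_sub, ← mul_sub, abs_mul, abs_mul]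
    exact mul_le_mul_of_nonneg_left (h1 ω x) (abs_nonneg c)
  · refine (h.mean.const_mul c).congr' (Eventually.of_forall fun n ω => ?_)
    simp only [hI, condMean_smul, average_const_mul]
    ring

lemma HasLinearization.sum (hD : IsIIDSequence P D μ) (hm : Tendsto m atTop atTop)
    {ι : Type*} (s : Finset ι) {κ : ι → (Fin (l + 1) → E) → ℝ} {f g : ι → E → ℝ}
    (hκ : ∀ i, IsBddMeas (κ i)) (h : ∀ i, HasLinearization P D μ m (κ i) (f i) (g i)) :
    HasLinearization P D μ m (fun z => ∑ i ∈ s, κ i z) (fun x => ∑ i ∈ s, f i x)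
      (fun x => ∑ i ∈ s, g i x) := by
  classical
  induction s using Finset.induction_on with
  | empty =>
    simp only [Finset.sum_empty]
    refine ⟨.const 0, .const 0, by simp, by simp, ⟨fun _ _ => 0, .zero, ?_⟩, ?_⟩
    · simp [condMean]
    · simpa [condMean, average] using IsLittleOProb.zero
  | insert j s hj ih =>
    simp only [Finset.sum_insert hj]
    exact HasLinearization.add hD hm (hκ j) (IsBddMeas.sum fun i _ => hκ i) (h j) ih

/-- Every product kernel has a first-order expansion. -/
lemma exists_hasLinearization (hD : IsIIDSequence P D μ) (hm : Tendsto m atTop atTop) {c : ℝ}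
    (hc : Tendsto (fun n : ℕ => (n : ℝ) / (m n : ℝ)) atTop (𝓝 c))
    (hκ : κ ∈ productKernels E l) : ∃ f g, HasLinearization P D μ m κ f g := by
  have := hD.isProbabilityMeasure
  suffices H : IsBddMeas κ ∧ ∃ f g, HasLinearization P D μ m κ f g from H.2
  induction hκ using Submodule.span_induction with
  | zero =>
    refine ⟨.const 0, _, _, HasLinearization.sum (κ := fun _ : Empty => 0) (f := fun _ _ => 0)
      (g := fun _ _ => 0) hD hm ∅ (fun i => i.elim) fun i => i.elim⟩
  | add κ κ' _ _ h h' =>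
    obtain ⟨hb, f, g, h⟩ := h
    obtain ⟨hb', f', g', h'⟩ := h'
    exact ⟨hb.add hb', _, _, h.add hD hm hb hb' h'⟩
  | smul c κ _ h =>
    obtain ⟨hb, f, g, h⟩ := h
    exact ⟨hb.const_mul c, _, _, h.smul c⟩
  | mem κ hκ =>
    obtain ⟨γ, hγ, rfl⟩ := hκ
    refine ⟨isBddMeas_of_mem_productKernels (prod_mem_productKernels hγ), ?_⟩
    obtain ⟨h, hh, h0, hO⟩ := hD.exists_linearization_prod hm hc (Finset.univ : Finset (Fin l))
      (g := fun j => γ j.succ) fun j _ => hγ _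
    set e := ∫ x, γ 0 x ∂μ with he
    set E' := ∏ j : Fin l, ∫ x, γ j.succ x ∂μ with hE'
    set f₀ : E → ℝ := fun x => γ 0 x - e with hf₀
    have hfb : IsBddMeas f₀ := (hγ 0).sub (.const e)
    have hf0 : ∫ x, f₀ x ∂μ = 0 := integral_sub_integral_eq_zero μ (hγ 0)
    have hI : ∫ z : Fin (l + 1) → E, ∏ j, γ j (z j) ∂(Measure.pi fun _ => μ) = e * E' := by
      rw [integral_fintype_prod_eq_prod, Fin.prod_univ_succ]
    obtain ⟨C, hC⟩ := (hγ 0).2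
    have hC' : ∀ x, |γ 0 x| ≤ max C 0 := fun x => (hC x).trans (le_max_left _ _)
    have hid : Tendsto (fun n : ℕ => (n : ℝ) / ((id n : ℕ) : ℝ)) atTop (𝓝 1) := by
      refine tendsto_const_nhds.congr' ?_
      filter_upwards [eventually_ne_atTop 0] with n hn
      have : (n : ℝ) ≠ 0 := by exact_mod_cast hn
      simp [this]
    refine ⟨fun x => E' * f₀ x, fun x => e * h x, hfb.const_mul _, hh.const_mul _, ?_, ?_, ?_, ?_⟩
    · rw [integral_const_mul, hf0, mul_zero]
    · rw [integral_const_mul, h0, mul_zero]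
    · -- the error factorizes into `γ 0 x` times an error that does not depend on `x`
      have hq : IsLittleOProb P fun n ω =>
          ∏ j : Fin l, (average (m n) (γ j.succ) fun i => D i ω) - E' := by
        refine ((hD.isLittleOProb_average hh h0 hm).abs.add hO.abs).of_eventually_le ?_
        filter_upwards [eventually_ge_atTop 1] with n hn ω
        set a := average (m n) h fun i => D i ω
        set b := ∏ j : Fin l, (average (m n) (γ j.succ) fun i => D i ω) - E'
        have h1 : 1 ≤ √(n : ℝ) := Real.one_le_sqrt.2 (by exact_mod_cast hn)
        rw [abs_of_nonneg (by positivity : 0 ≤ |a| + |√(n : ℝ) * (b - a)|), abs_mul,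
          abs_of_nonneg (Real.sqrt_nonneg _)]
        have h2 : |b| ≤ |a| + |b - a| := by
          simpa using abs_add_le a (b - a)
        nlinarith [abs_nonneg (b - a)]
      refine ⟨_, hq.const_mul (max C 0), ?_⟩
      filter_upwards [hm.eventually_ne_atTop 0] with n hn ω x
      rw [hI, condMean_prod hγ hn]
      have : γ 0 x * ∏ j : Fin l, (average (m n) (γ j.succ) fun i => D i ω) - e * E' - E' * f₀ x
          = γ 0 x * (∏ j : Fin l, (average (m n) (γ j.succ) fun i => D i ω) - E') := by
        rw [hf₀]; ring
      rw [this, abs_mul, abs_mul, abs_of_nonneg (le_max_right C 0)]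
      gcongr
      exact hC' x
    · have h1 := (hD.isLittleOProb_sqrt_mul_average_mul_average hfb hf0 hh h0 tendsto_id hid hm
        hc).add (hO.mul_bdd (R' := fun n ω => average n (γ 0) fun i => D i ω)
          fun n ω => abs_average_le hC' (le_max_right _ _) _ _)
      refine h1.congr' ?_
      filter_upwards [hm.eventually_ne_atTop 0, eventually_ne_atTop 0] with n hn hn' ω
      have h2 : average n f₀ (fun i => D i ω) = average n (γ 0) (fun i => D i ω) - e :=
        average_sub_const hn' _ _ _
      have h3 : (average n (fun x => condMean (fun z => ∏ j, γ j (z j)) (m n) (fun i => D i ω) x)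
          fun i => D i ω) = (average n (γ 0) fun i => D i ω)
            * ∏ j : Fin l, (average (m n) (γ j.succ) fun i => D i ω) := by
        simp only [condMean_prod hγ hn, average, ← Finset.sum_mul]
        ring
      rw [hI, h3, average_const_mul, average_const_mul, h2, id, h2]
      ring

end HasLinearization

/-! ### Resampling -/

section Fubini

variable {Ω α β F : Type*} [MeasurableSpace Ω] [MeasurableSpace α] [MeasurableSpace β]
  {P : Measure Ω} [IsProbabilityMeasure P] [NormedAddCommGroup F] [NormedSpace ℝ F]
  {X : Ω → α} {Y : Ω → β} {h : α × β → F}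

/-- Fubini's theorem for a function of two independent random elements, whose second argument is
integrated last. -/
lemma integral_indepFun_eq (hX : Measurable X) (hY : Measurable Y) (hXY : IndepFun X Y P)
    (hh : StronglyMeasurable h) (hint : Integrable (fun ω => h (X ω, Y ω)) P) :
    ∫ ω, h (X ω, Y ω) ∂P = ∫ ω', ∫ ω, h (X ω, Y ω') ∂P ∂P := by
  have hmap := (indepFun_iff_map_prod_eq_prod_map_map hX.aemeasurable hY.aemeasurable).1 hXY
  have hXp := Measure.isProbabilityMeasure_map (μ := P) hX.aemeasurable
  have hYp := Measure.isProbabilityMeasure_map (μ := P) hY.aemeasurable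
  have hint' : Integrable h ((P.map X).prod (P.map Y)) := by
    rw [← hmap, integrable_map_measure hh.aestronglyMeasurable (hX.prodMk hY).aemeasurable]
    exact hint
  rw [← integral_map (φ := fun ω => (X ω, Y ω)) (hX.prodMk hY).aemeasurable
    hh.aestronglyMeasurable, hmap, integral_prod_symm _ hint',
    integral_map hY.aemeasurable hh.integral_prod_left'.aestronglyMeasurable]
  congr 1 with ω'
  exact integral_map hX.aemeasurable
    (hh.comp_measurable (measurable_prodMk_right (y := Y ω'))).aestronglyMeasurable

lemma stronglyMeasurable_integral_indepFun (hX : Measurable X) (hY : Measurable Y)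
    (hh : StronglyMeasurable h) : StronglyMeasurable fun ω' => ∫ ω, h (X ω, Y ω') ∂P := by
  have hXp := Measure.isProbabilityMeasure_map (μ := P) hX.aemeasurable
  have h1 : StronglyMeasurable fun y => ∫ x, h (x, y) ∂(P.map X) := hh.integral_prod_left'
  convert h1.comp_measurable hY using 2 with ω'
  exact (integral_map hX.aemeasurable
    (hh.comp_measurable (measurable_prodMk_right (y := Y ω'))).aestronglyMeasurable).symm

end Fubini

/-- Indices `J n a i j` (`j < r a`) that are drawn for the subjects `i < n` in the replication `a`
of the resampling: for each `n` they are independent, uniformly distributed on `{0, …, m n - 1}` and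
independent of the data `D`. -/
structure IsUniformResampling {Ω E A : Type*} [MeasurableSpace Ω] [MeasurableSpace E]
    (P : Measure Ω) (D : ℕ → Ω → E) (m : ℕ → ℕ) (r : A → ℕ)
    (J : (n : ℕ) → (a : A) → Fin n → Fin (r a) → Ω → ℕ) : Prop where
  measurable : ∀ n a i j, Measurable (J n a i j)
  uniform : ∀ n, 0 < m n → ∀ a i j, ∀ k < m n, P {ω | J n a i j ω = k} = (m n : ℝ≥0∞)⁻¹
  indep : ∀ n, 0 < m n → iIndepFun
    (fun q : Σ s : A × Fin n, Fin (r s.1) => J n q.1.1 q.1.2 q.2) P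
  indep_data : ∀ n, 0 < m n → IndepFun
    (fun ω (q : Σ s : A × Fin n, Fin (r s.1)) => J n q.1.1 q.1.2 q.2 ω) (fun ω i => D i ω) P

/-- The argument `(d i, d k₁, …, d k_l)` of a kernel. -/
def kernelArg {E : Type*} {l : ℕ} (d : ℕ → E) (i : ℕ) (k : Fin l → ℕ) : Fin (l + 1) → E :=
  Fin.cons (d i) fun j => d (k j)

/-- The normalized sum of the kernels `κ a` at the resampled data. -/
noncomputable def resampledSum {Ω E A : Type*} [Fintype A] {r : A → ℕ} (D : ℕ → Ω → E)
    (J : (n : ℕ) → (a : A) → Fin n → Fin (r a) → Ω → ℕ) (κ : (a : A) → (Fin (r a + 1) → E) → ℝ)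
    (n : ℕ) (ω : Ω) : ℝ :=
  (√(n : ℝ))⁻¹ * ∑ s : A × Fin n,
    κ s.1 (kernelArg (fun i => D i ω) s.2 fun j => J n s.1 s.2 j ω)

section

variable {Ω E A : Type*} [MeasurableSpace Ω] [MeasurableSpace E] [Fintype A] {P : Measure Ω}
  [IsProbabilityMeasure P] {D : ℕ → Ω → E} {μ : Measure E} {m : ℕ → ℕ} {r : A → ℕ}
  {J : (n : ℕ) → (a : A) → Fin n → Fin (r a) → Ω → ℕ}

lemma measurable_kernelArg {l : ℕ} (i : ℕ) :
    Measurable fun p : (Fin l → ℕ) × (ℕ → E) => kernelArg p.2 i p.1 := by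
  refine measurable_pi_iff.2 fun j => ?_
  refine Fin.cases ?_ (fun j => ?_) j
  · simp only [kernelArg, Fin.cons_zero]
    fun_prop
  · simp only [kernelArg, Fin.cons_succ]
    have : Measurable fun q : ℕ × (ℕ → E) => q.2 q.1 :=
      measurable_from_prod_countable_right fun k => measurable_pi_apply k
    exact this.comp (f := fun p : (Fin l → ℕ) × (ℕ → E) => (p.1 j, p.2)) (by fun_prop)

lemma IsUniformResampling.map_index (hJ : IsUniformResampling P D m r J) {n : ℕ} (hn : 0 < m n)
    (a : A) (i : Fin n) (j : Fin (r a)) :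
    P.map (J n a i j) = empirical fun k : Fin (m n) => (k : ℕ) := by
  have h1 := Measure.isProbabilityMeasure_map (μ := P) (hJ.measurable n a i j).aemeasurable
  have h2 := isProbabilityMeasure_empirical hn.ne' fun k : Fin (m n) => (k : ℕ)
  refine (Measure.eq_of_le_of_isProbabilityMeasure ?_).symm
  refine Measure.le_iff.2 fun s hs => ?_
  classical
  rw [Measure.map_apply (hJ.measurable n a i j) hs, empirical]
  simp only [Measure.smul_apply, Measure.finsetSum_apply, Measure.dirac_apply' _ hs, smul_eq_mul]
  calc (m n : ℝ≥0∞)⁻¹ * ∑ k : Fin (m n), s.indicator 1 (k : ℕ)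
      = ∑ k ∈ ({k : Fin (m n) | (k : ℕ) ∈ s} : Finset (Fin (m n))),
          P (J n a i j ⁻¹' {(k : ℕ)}) := by
        rw [Finset.mul_sum, Finset.sum_filter]
        refine Finset.sum_congr rfl fun k _ => ?_
        by_cases hk : (k : ℕ) ∈ s
        · rw [Set.indicator_of_mem hk, if_pos hk, Pi.one_apply, mul_one]
          exact (hJ.uniform n hn a i j k k.2).symm
        · rw [Set.indicator_of_notMem hk, if_neg hk, mul_zero]
    _ = P (⋃ k ∈ ({k : Fin (m n) | (k : ℕ) ∈ s} : Finset (Fin (m n))),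
          J n a i j ⁻¹' {(k : ℕ)}) := by
        rw [measure_biUnion_finset]
        · intro k _ k' _ hkk'
          change Disjoint _ _
          refine Set.disjoint_left.2 fun ω h h' => hkk' (Fin.ext ?_)
          simp only [Set.mem_preimage, Set.mem_singleton_iff] at h h'
          exact h.symm.trans h'
        · exact fun k _ => hJ.measurable n a i j (measurableSet_singleton (k : ℕ))
    _ ≤ P (J n a i j ⁻¹' s) := by
        refine measure_mono fun ω hω => ?_
        simp only [Set.mem_iUnion, Set.mem_preimage, Set.mem_singleton_iff, Finset.mem_filter_univ,
          exists_prop] at hω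
        obtain ⟨k, hk, h⟩ := hω
        rw [Set.mem_preimage, h]
        exact hk

lemma map_empirical {S S' : Type*} [MeasurableSpace S] [MeasurableSpace S'] {n : ℕ} (x : Fin n → S)
    {φ : S → S'} (hφ : Measurable φ) :
    (empirical x).map φ = empirical fun i => φ (x i) := by
  ext s hs
  rw [Measure.map_apply hφ hs]
  simp only [empirical, Measure.smul_apply, Measure.finsetSum_apply, Measure.dirac_apply' _ hs,
    Measure.dirac_apply' _ (hφ hs)]
  rfl

/-- Given the data `d`, the drawn data points are independent with the empirical distribution. -/
lemma IsUniformResampling.map_draws (hJ : IsUniformResampling P D m r J) {n : ℕ} (hn : 0 < m n)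
    (a : A) (i : Fin n) (d : ℕ → E) :
    P.map (fun ω j => d (J n a i j ω))
      = Measure.pi fun _ : Fin (r a) => empirical fun k : Fin (m n) => d k := by
  have hd : Measurable d := measurable_from_nat
  have hind : iIndepFun (fun j => J n a i j) P := (hJ.indep n hn).precomp
    (g := fun j => (⟨(a, i), j⟩ : Σ s : A × Fin n, Fin (r s.1)))
    fun j j' h => by simpa using h
  have h2 := (hind.comp (fun _ => d) fun _ => hd).map_fun_eq_pi_map
    fun j => (hd.comp (hJ.measurable n a i j)).aemeasurable
  have h3 : (fun ω j => d (J n a i j ω)) = fun ω j => (d ∘ J n a i j) ω := rfl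
  rw [h3, h2]
  congr with j : 1
  rw [← Measure.map_map hd (hJ.measurable n a i j), hJ.map_index hn, map_empirical _ hd]

lemma IsUniformResampling.integral_kernel (hJ : IsUniformResampling P D m r J) {n : ℕ}
    (hn : 0 < m n) (a : A) (i : Fin n) (d : ℕ → E) {κ : (Fin (r a + 1) → E) → ℝ}
    (hκ : Measurable κ) :
    ∫ ω, κ (kernelArg d i fun j => J n a i j ω) ∂P = condMean κ (m n) d (d i) := by
  have hd : Measurable d := measurable_from_nat
  rw [condMean, ← hJ.map_draws hn a i d, integral_map]
  · rfl
  · exact (measurable_pi_iff.2 fun j => hd.comp (hJ.measurable n a i j)).aemeasurable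
  · exact (hκ.comp (measurable_cons _)).aestronglyMeasurable

lemma measurable_kernel_index {l : ℕ} (d : ℕ → E) (i : ℕ) {κ : (Fin (l + 1) → E) → ℝ}
    (hκ : Measurable κ) : Measurable fun k : Fin l → ℕ => κ (kernelArg d i k) :=
  hκ.comp ((measurable_kernelArg i).comp (measurable_id.prodMk measurable_const))

lemma abs_condMean_le {l : ℕ} {κ : (Fin (l + 1) → E) → ℝ} {C : ℝ} (hC : ∀ z, |κ z| ≤ C)
    {m : ℕ} (hm : m ≠ 0) (d : ℕ → E) (x : E) : |condMean κ m d x| ≤ C := by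
  have := isProbabilityMeasure_empirical hm fun k : Fin m => d k
  have h := norm_integral_le_of_norm_le_const (μ := Measure.pi fun _ : Fin l =>
    empirical fun k : Fin m => d k) (f := fun y => κ (Fin.cons x y)) (C := C)
    (ae_of_all _ fun y => hC _)
  simpa [condMean] using h

end

/-! ### The central limit theorem for product kernels -/

lemma abs_exp_neg_half_sub_le {x : ℝ} (hx : 0 ≤ x) (y : ℝ) :
    |Real.exp (-x / 2) - Real.exp (-y / 2)| ≤ Real.exp |y| * |x - y| := by
  have key : ∀ a b : ℝ, Real.exp a - Real.exp b ≤ Real.exp a * |a - b| := fun a b => by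
    have h1 := Real.add_one_le_exp (b - a)
    have h2 : Real.exp b = Real.exp a * Real.exp (b - a) := by rw [← Real.exp_add]; ring_nf
    have h3 := Real.exp_pos a
    rw [h2]
    nlinarith [le_abs_self (a - b)]
  have h1 : Real.exp (-x / 2) ≤ Real.exp |y| :=
    Real.exp_le_exp.2 (by linarith [abs_nonneg y])
  have h2 : Real.exp (-y / 2) ≤ Real.exp |y| :=
    Real.exp_le_exp.2 (by linarith [neg_abs_le y, abs_nonneg y])
  have h3 : |(-x / 2) - (-y / 2)| ≤ |x - y| := by
    rw [show (-x / 2) - (-y / 2) = -((x - y) / 2) by ring, abs_neg, abs_div, abs_two]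
    linarith [abs_nonneg (x - y)]
  have h4 : |(-y / 2) - (-x / 2)| ≤ |x - y| := by rw [abs_sub_comm]; exact h3
  rw [abs_sub_le_iff]
  exact ⟨(key _ _).trans (mul_le_mul h1 h3 (abs_nonneg _) (Real.exp_pos _).le),
    (key _ _).trans (mul_le_mul h2 h4 (abs_nonneg _) (Real.exp_pos _).le)⟩

lemma norm_cexp_ofReal_mul_I_sub_le (x y : ℝ) :
    ‖Complex.exp (x * Complex.I) - Complex.exp (y * Complex.I)‖ ≤ |x - y| := by
  have h : Complex.exp (x * Complex.I) - Complex.exp (y * Complex.I)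
      = Complex.exp (y * Complex.I) * (Complex.exp (Complex.I * ((x - y : ℝ) : ℂ)) - 1) := by
    rw [mul_sub, ← Complex.exp_add, mul_one]
    congr 2
    push_cast
    ring
  rw [h, norm_mul, Complex.norm_exp_ofReal_mul_I, one_mul]
  exact Real.norm_exp_I_mul_ofReal_sub_one_le

lemma average_sum {E ι : Type*} (n : ℕ) (s : Finset ι) (f : ι → E → ℝ) (x : ℕ → E) :
    average n (fun y => ∑ i ∈ s, f i y) x = ∑ i ∈ s, average n (f i) x := by
  simp only [average, ← Finset.mul_sum]
  rw [Finset.sum_comm]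

lemma sqrt_mul_inv_self (x : ℝ) : √x * x⁻¹ = (√x)⁻¹ := by
  rw [← div_eq_mul_inv, Real.sqrt_div_self', one_div]

lemma tendsto_overlap_variance {m : ℕ → ℕ} {c : ℝ} (hm : Tendsto m atTop atTop)
    (hc : Tendsto (fun n : ℕ => (n : ℝ) / (m n : ℝ)) atTop (𝓝 c)) (x y z : ℝ) :
    Tendsto (fun n : ℕ => n * (√(n : ℝ) * (n : ℝ)⁻¹) ^ 2 * x
      + m n * (√(n : ℝ) * (m n : ℝ)⁻¹) ^ 2 * y
      + 2 * ((min n (m n) : ℕ) * ((√(n : ℝ) * (n : ℝ)⁻¹) * (√(n : ℝ) * (m n : ℝ)⁻¹)) * z)) atTop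
      (𝓝 (x + c * y + 2 * (min c 1 * z))) := by
  have h1 : Tendsto (fun n : ℕ => x + (n / m n : ℝ) * y + 2 * (min (n / m n : ℝ) 1 * z)) atTop
      (𝓝 (x + c * y + 2 * (min c 1 * z))) :=
    ((hc.mul_const _).const_add _).add
      (((hc.min tendsto_const_nhds).mul_const _).const_mul _)
  refine h1.congr' ?_
  filter_upwards [eventually_ne_atTop 0, hm.eventually_ne_atTop 0] with n hn hmn
  have h2 : (n : ℝ) ≠ 0 := by exact_mod_cast hn
  have h3 : (m n : ℝ) ≠ 0 := by exact_mod_cast hmn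
  have h4 : √(n : ℝ) * √(n : ℝ) = n := Real.mul_self_sqrt (by positivity)
  have e1 : (n : ℝ) * (√(n : ℝ) * (n : ℝ)⁻¹) ^ 2 = 1 := by
    rw [mul_pow, pow_two √(n : ℝ), h4]; field_simp
  have e2 : (m n : ℝ) * (√(n : ℝ) * (m n : ℝ)⁻¹) ^ 2 = n / m n := by
    rw [mul_pow, pow_two √(n : ℝ), h4]; field_simp
  have e3 : ((min n (m n) : ℕ) : ℝ) * ((√(n : ℝ) * (n : ℝ)⁻¹) * (√(n : ℝ) * (m n : ℝ)⁻¹))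
      = min (n / m n : ℝ) 1 := by
    have h5 : (√(n : ℝ) * (n : ℝ)⁻¹) * (√(n : ℝ) * (m n : ℝ)⁻¹) = (m n : ℝ)⁻¹ := by
      rw [show √(n : ℝ) * (n : ℝ)⁻¹ * (√(n : ℝ) * (m n : ℝ)⁻¹)
        = (√(n : ℝ) * √(n : ℝ)) * (n : ℝ)⁻¹ * (m n : ℝ)⁻¹ by ring, h4, mul_inv_cancel₀ h2, one_mul]
    rw [h5, ← div_eq_mul_inv, Nat.cast_min, ← min_div_div_right (by positivity), div_self h3]
  rw [e1, e2, e3, one_mul]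

section

variable {Ω E A : Type*} [MeasurableSpace Ω] [MeasurableSpace E] [Fintype A] {P : Measure Ω}
  [IsProbabilityMeasure P] {D : ℕ → Ω → E} {μ : Measure E} {m : ℕ → ℕ} {r : A → ℕ}
  {J : (n : ℕ) → (a : A) → Fin n → Fin (r a) → Ω → ℕ}

/-- Two averages over overlapping initial segments of an i.i.d. sequence are jointly asymptotically
normal; the covariance of the limit reflects the size `min n (m n)` of the overlap. -/
lemma IsIIDSequence.tendsto_charFun_averages (hD : IsIIDSequence P D μ) {c : ℝ}
    (hm : Tendsto m atTop atTop)
    (hc : Tendsto (fun n : ℕ => (n : ℝ) / (m n : ℝ)) atTop (𝓝 c)) {F G : E → ℝ}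
    (hF : IsBddMeas F) (hG : IsBddMeas G) (hF0 : ∫ x, F x ∂μ = 0) (hG0 : ∫ x, G x ∂μ = 0) :
    Tendsto (fun n : ℕ => ∫ ω, Complex.exp ((√(n : ℝ) * ((average n F fun i => D i ω)
        + average (m n) G fun i => D i ω) : ℝ) * Complex.I) ∂P) atTop
      (𝓝 (Complex.exp ((-(∫ x, F x ^ 2 ∂μ + c * ∫ x, G x ^ 2 ∂μ
        + 2 * (min c 1 * ∫ x, F x * G x ∂μ)) / 2 : ℝ)))) := by
  have := hD.isProbabilityMeasure
  set α : ℕ → ℝ := fun n => √(n : ℝ) * (n : ℝ)⁻¹ with hα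
  set β : ℕ → ℝ := fun n => √(n : ℝ) * (m n : ℝ)⁻¹ with hβ
  have hid : Tendsto (fun n : ℕ => (n : ℝ) / ((id n : ℕ) : ℝ)) atTop (𝓝 1) := by
    refine tendsto_const_nhds.congr' ?_
    filter_upwards [eventually_ne_atTop 0] with n hn
    have : (n : ℝ) ≠ 0 := by exact_mod_cast hn
    simp [this]
  have hα0 : Tendsto α atTop (𝓝 0) := (tendsto_inv_of_tendsto_div tendsto_id hid).2
  have hβ0 : Tendsto β atTop (𝓝 0) := (tendsto_inv_of_tendsto_div hm hc).2
  have hαp : ∀ n, 0 ≤ α n := fun n => by positivity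
  have hβp : ∀ n, 0 ≤ β n := fun n => by positivity
  obtain ⟨CF, hCF⟩ := hF.2
  obtain ⟨CG, hCG⟩ := hG.2
  -- the summand of the index `i` in the linear combination of the two averages
  set a : ℕ → ℕ → ℝ := fun n i => if i < n then α n else 0 with ha
  set b : ℕ → ℕ → ℝ := fun n i => if i < m n then β n else 0 with hb
  have ha1 : ∀ n i, |a n i| ≤ α n := fun n i => by
    simp only [ha]; split_ifs
    · exact (abs_of_nonneg (hαp n)).le
    · simpa using hαp n
  have hb1 : ∀ n i, |b n i| ≤ β n := fun n i => by
    simp only [hb]; split_ifs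
    · exact (abs_of_nonneg (hβp n)).le
    · simpa using hβp n
  set ξ : (n : ℕ) → Fin (max n (m n)) → Ω → ℝ :=
    fun n i ω => a n i * F (D i ω) + b n i * G (D i ω) with hξ
  have hxb : ∀ n i, IsBddMeas fun x => a n i * F x + b n i * G x :=
    fun n i => (hF.const_mul _).add (hG.const_mul _)
  have hsub : ∀ {N k : ℕ}, k ≤ N → ∀ h : ℕ → ℝ,
      ∑ i : Fin N, (if (i : ℕ) < k then h i else 0) = ∑ i ∈ Finset.range k, h i := by
    intro N k hk h
    rw [Fin.sum_univ_eq_sum_range (fun i => if i < k then h i else 0) N, ← Finset.sum_filter]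
    congr 1
    ext i
    simp only [Finset.mem_filter, Finset.mem_range]
    omega
  have hsum : ∀ n ω, ∑ i, ξ n i ω = √(n : ℝ) * ((average n F fun i => D i ω)
        + average (m n) G fun i => D i ω) := by
    intro n ω
    simp only [hξ, ha, hb, Finset.sum_add_distrib, ite_mul, zero_mul]
    rw [hsub (le_max_left _ _) fun i => α n * F (D i ω),
      hsub (le_max_right _ _) fun i => β n * G (D i ω), ← Finset.mul_sum, ← Finset.mul_sum,
      average, average]
    ring
  set V : ℕ → ℝ := fun n => ∑ i, ∫ ω, ξ n i ω ^ 2 ∂P with hV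
  have hVeq : ∀ n, V n = n * α n ^ 2 * ∫ x, F x ^ 2 ∂μ + m n * β n ^ 2 * ∫ x, G x ^ 2 ∂μ
      + 2 * ((min n (m n) : ℕ) * (α n * β n) * ∫ x, F x * G x ∂μ) := by
    intro n
    have h1 : ∀ i : Fin (max n (m n)), ∫ ω, ξ n i ω ^ 2 ∂P
        = (if (i : ℕ) < n then α n ^ 2 else 0) * ∫ x, F x ^ 2 ∂μ
          + (if (i : ℕ) < m n then β n ^ 2 else 0) * ∫ x, G x ^ 2 ∂μ
          + 2 * ((if (i : ℕ) < min n (m n) then α n * β n else 0) * ∫ x, F x * G x ∂μ) := by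
      intro i
      have h2 := hD.integral_comp ((hxb n i).1.pow_const 2) i
      simp only [hξ] at h2 ⊢
      rw [h2]
      have hFF : Integrable (fun x => F x ^ 2) μ := by
        simpa only [pow_two] using (hF.mul hF).integrable μ
      have hGG : Integrable (fun x => G x ^ 2) μ := by
        simpa only [pow_two] using (hG.mul hG).integrable μ
      have hFG := (hF.mul hG).integrable μ
      have h3 : ∀ x, (a n i * F x + b n i * G x) ^ 2
          = a n i ^ 2 * F x ^ 2 + b n i ^ 2 * G x ^ 2 + 2 * (a n i * b n i) * (F x * G x) :=
        fun x => by ring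
      simp only [h3]
      have hAB : Integrable (fun x => a n i ^ 2 * F x ^ 2 + b n i ^ 2 * G x ^ 2) μ :=
        (hFF.const_mul _).add (hGG.const_mul _)
      rw [integral_add hAB (hFG.const_mul _), integral_add (hFF.const_mul _) (hGG.const_mul _),
        integral_const_mul, integral_const_mul, integral_const_mul]
      have e1 : a n i ^ 2 = if (i : ℕ) < n then α n ^ 2 else 0 := by
        simp only [ha]; split_ifs <;> simp
      have e2 : b n i ^ 2 = if (i : ℕ) < m n then β n ^ 2 else 0 := by
        simp only [hb]; split_ifs <;> simp
      have e3 : a n i * b n i = if (i : ℕ) < min n (m n) then α n * β n else 0 := by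
        simp only [ha, hb, lt_min_iff]
        by_cases h5 : (i : ℕ) < n <;> by_cases h6 : (i : ℕ) < m n <;> simp [h5, h6]
      rw [e1, e2, e3]
      ring
    simp only [hV, h1, Finset.sum_add_distrib, ← Finset.mul_sum, ← Finset.sum_mul]
    rw [hsub (le_max_left _ _) fun _ => α n ^ 2, hsub (le_max_right _ _) fun _ => β n ^ 2,
      hsub ((min_le_left _ _).trans (le_max_left _ _)) fun _ => α n * β n]
    simp
  have hVlim : Tendsto V atTop (𝓝 (∫ x, F x ^ 2 ∂μ + c * ∫ x, G x ^ 2 ∂μ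
        + 2 * (min c 1 * ∫ x, F x * G x ∂μ))) := by
    simp only [funext hVeq]
    exact tendsto_overlap_variance hm hc _ _ _
  have hδ : Tendsto (fun n => |CF| * α n + |CG| * β n) atTop (𝓝 0) := by
    simpa using (hα0.const_mul |CF|).add (hβ0.const_mul |CG|)
  have hmain : ∀ᶠ n : ℕ in atTop, ‖(∫ ω, Complex.exp ((√(n : ℝ) * ((average n F fun i => D i ω)
        + average (m n) G fun i => D i ω) : ℝ) * Complex.I) ∂P)
        - Complex.exp ((-(V n) / 2 : ℝ))‖ ≤ (|CF| * α n + |CG| * β n) * V n := by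
    filter_upwards [(tendsto_order.1 hδ).2 1 one_pos] with n hn
    have hind : iIndepFun (ξ n) P := by
      have h1 : iIndepFun (fun i : Fin (max n (m n)) => D i) P :=
        hD.indep.precomp (g := fun i : Fin (max n (m n)) => (i : ℕ)) Fin.val_injective
      exact h1.comp (fun i x => a n i * F x + b n i * G x) fun i => (hxb n i).1
    have := norm_integral_cexp_sum_sub_gaussian_le P (ξ := ξ n)
      (fun i => (hxb n i).1.comp (hD.measurable i)) hind hn.le (fun i ω => ?_) fun i => ?_
    · simpa only [hsum] using this
    · refine (abs_add_le _ _).trans ?_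
      rw [abs_mul, abs_mul, mul_comm |CF|, mul_comm |CG|]
      exact add_le_add
        (mul_le_mul (ha1 n i) ((hCF _).trans (le_abs_self _)) (abs_nonneg _) (hαp n))
        (mul_le_mul (hb1 n i) ((hCG _).trans (le_abs_self _)) (abs_nonneg _) (hβp n))
    · have h2 := hD.integral_comp (hxb n i).1 i
      simp only [hξ] at h2 ⊢
      rw [h2, integral_add ((hF.integrable μ).const_mul _) ((hG.integrable μ).const_mul _),
        integral_const_mul, integral_const_mul, hF0, hG0]
      simp
  have hexp : Tendsto (fun n => Complex.exp ((-(V n) / 2 : ℝ))) atTop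
      (𝓝 (Complex.exp ((-(∫ x, F x ^ 2 ∂μ + c * ∫ x, G x ^ 2 ∂μ
        + 2 * (min c 1 * ∫ x, F x * G x ∂μ)) / 2 : ℝ)))) :=
    (Complex.continuous_exp.comp Complex.continuous_ofReal).continuousAt.tendsto.comp
      (hVlim.neg.div_const 2)
  have hdiff : Tendsto (fun n : ℕ => (∫ ω, Complex.exp ((√(n : ℝ) * ((average n F fun i => D i ω)
        + average (m n) G fun i => D i ω) : ℝ) * Complex.I) ∂P)
        - Complex.exp ((-(V n) / 2 : ℝ))) atTop (𝓝 0) :=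
    squeeze_zero_norm' hmain (by simpa using hδ.mul hVlim)
  simpa using hdiff.add hexp

/-- The conditional central limit theorem given the data `d`: the characteristic function of the
resampled sum, with respect to the resampling only. -/
lemma IsUniformResampling.norm_charFun_sub_le (hJ : IsUniformResampling P D m r J)
    {κ : (a : A) → (Fin (r a + 1) → E) → ℝ} (hκ : ∀ a, Measurable (κ a)) {K : ℝ}
    (hK0 : 0 ≤ K) (hK : ∀ a z, |κ a z| ≤ K) {n : ℕ} (hn : 0 < n) (hmn : 0 < m n)
    (hsmall : (√(n : ℝ))⁻¹ * (2 * K) ≤ 1) (d : ℕ → E) :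
    0 ≤ ∑ a, average n (fun x => condMean (κ a * κ a) (m n) d x - condMean (κ a) (m n) d x ^ 2) d ∧
    ‖∫ ω, Complex.exp (((√(n : ℝ))⁻¹ * ∑ s : A × Fin n,
        κ s.1 (kernelArg d s.2 fun j => J n s.1 s.2 j ω) : ℝ) * Complex.I) ∂P
      - Complex.exp ((√(n : ℝ) * ∑ a, average n (condMean (κ a) (m n) d) d : ℝ) * Complex.I)
        * Complex.exp ((-(∑ a, average n (fun x => condMean (κ a * κ a) (m n) d x
          - condMean (κ a) (m n) d x ^ 2) d) / 2 : ℝ))‖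
      ≤ (√(n : ℝ))⁻¹ * (2 * K) * (Fintype.card A * K ^ 2) := by
  have hnr : (0 : ℝ) < n := by exact_mod_cast hn
  have hsq : 0 < √(n : ℝ) := Real.sqrt_pos.2 hnr
  have hsqq : √(n : ℝ) * √(n : ℝ) = n := Real.mul_self_sqrt hnr.le
  set M : A → E → ℝ := fun a => condMean (κ a) (m n) d with hM
  set Q : A → E → ℝ := fun a => condMean (κ a * κ a) (m n) d with hQ
  have hMK : ∀ a x, |M a x| ≤ K := fun a x => abs_condMean_le (hK a) hmn.ne' d x
  have hQK : ∀ a x, |Q a x| ≤ K ^ 2 := fun a x => abs_condMean_le (fun z => by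
    rw [Pi.mul_apply, abs_mul, pow_two]
    exact mul_le_mul (hK a z) (hK a z) (abs_nonneg _) ((abs_nonneg _).trans (hK a z))) hmn.ne' d x
  set Z : A × Fin n → Ω → ℝ := fun s ω => κ s.1 (kernelArg d s.2 fun j => J n s.1 s.2 j ω) with hZ
  have hZm : ∀ s, Measurable (Z s) := fun s =>
    (measurable_kernel_index d s.2 (hκ s.1)).comp
      (measurable_pi_iff.2 fun j => hJ.measurable n s.1 s.2 j)
  have hZb : ∀ s, IsBddMeas (Z s) := fun s => ⟨hZm s, K, fun ω => hK _ _⟩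
  have hZ1 : ∀ s, ∫ ω, Z s ω ∂P = M s.1 (d s.2) := fun s =>
    hJ.integral_kernel hmn s.1 s.2 d (hκ s.1)
  have hZ2 : ∀ s, ∫ ω, Z s ω * Z s ω ∂P = Q s.1 (d s.2) := fun s =>
    hJ.integral_kernel hmn s.1 s.2 d ((hκ s.1).mul (hκ s.1))
  set ξ : A × Fin n → Ω → ℝ := fun s ω => (√(n : ℝ))⁻¹ * (Z s ω - M s.1 (d s.2)) with hξ
  have hξ2 : ∀ s, ∫ ω, ξ s ω ^ 2 ∂P = (n : ℝ)⁻¹ * (Q s.1 (d s.2) - M s.1 (d s.2) ^ 2) := by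
    intro s
    have h1 : ∀ ω, ξ s ω ^ 2 = (n : ℝ)⁻¹ * (Z s ω * Z s ω - 2 * M s.1 (d s.2) * Z s ω
        + M s.1 (d s.2) ^ 2) := fun ω => by
      have : ((√(n : ℝ))⁻¹) ^ 2 = (n : ℝ)⁻¹ := by rw [inv_pow, pow_two, hsqq]
      simp only [hξ, mul_pow, this]
      ring
    simp only [h1]
    have i1 : Integrable (fun ω => Z s ω * Z s ω) P := ((hZb s).mul (hZb s)).integrable P
    have i2 : Integrable (fun ω => 2 * M s.1 (d s.2) * Z s ω) P :=
        ((hZb s).integrable P).const_mul _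
    have i3 : Integrable (fun ω => Z s ω * Z s ω - 2 * M s.1 (d s.2) * Z s ω) P := i1.sub i2
    rw [integral_const_mul, integral_add i3 (integrable_const _), integral_sub i1 i2,
      integral_const_mul, hZ1, hZ2]
    simp only [integral_const, probReal_univ, smul_eq_mul]
    ring
  have hS2 : ∑ s, ∫ ω, ξ s ω ^ 2 ∂P
      = ∑ a, average n (fun x => Q a x - M a x ^ 2) d := by
    simp only [hξ2]
    rw [Fintype.sum_prod_type]
    refine Finset.sum_congr rfl fun a _ => ?_
    rw [average, Finset.mul_sum,
      ← Fin.sum_univ_eq_sum_range (fun i => (n : ℝ)⁻¹ * (Q a (d i) - M a (d i) ^ 2)) n]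
  have hS2nonneg : 0 ≤ ∑ s, ∫ ω, ξ s ω ^ 2 ∂P :=
    Finset.sum_nonneg fun s _ => integral_nonneg fun ω => sq_nonneg _
  refine ⟨hS2 ▸ hS2nonneg, ?_⟩
  have hS2le : ∑ s, ∫ ω, ξ s ω ^ 2 ∂P ≤ Fintype.card A * K ^ 2 := by
    calc ∑ s, ∫ ω, ξ s ω ^ 2 ∂P ≤ ∑ s : A × Fin n, (n : ℝ)⁻¹ * K ^ 2 := by
          refine Finset.sum_le_sum fun s _ => ?_
          rw [hξ2]
          have := (abs_le.1 (hQK s.1 (d s.2))).2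
          gcongr
          nlinarith [sq_nonneg (M s.1 (d s.2))]
      _ = _ := by
          simp only [Finset.sum_const, Finset.card_univ, Fintype.card_prod, Fintype.card_fin,
            nsmul_eq_mul, Nat.cast_mul]
          field_simp
  have hind : iIndepFun ξ P := by
    have h1 := iIndepFun_blocks (X := fun (s : A × Fin n) (j : Fin (r s.1)) => J n s.1 s.2 j)
      (fun s j => hJ.measurable n s.1 s.2 j) (hJ.indep n hmn)
    exact h1.comp (fun s k => (√(n : ℝ))⁻¹ * (κ s.1 (kernelArg d s.2 k) - M s.1 (d s.2)))
      fun s => ((measurable_kernel_index d s.2 (hκ s.1)).sub_const _).const_mul _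
  have hLY := norm_integral_cexp_sum_sub_gaussian_le P (ξ := ξ)
    (fun s => ((hZm s).sub_const _).const_mul _) hind hsmall (fun s ω => ?_) fun s => ?_
  · have hsplit : ∀ ω, ((√(n : ℝ))⁻¹ * ∑ s, Z s ω : ℝ)
        = √(n : ℝ) * ∑ a, average n (M a) d + ∑ s, ξ s ω := by
      intro ω
      have h1 : √(n : ℝ) * ∑ a, average n (M a) d
          = (√(n : ℝ))⁻¹ * ∑ s : A × Fin n, M s.1 (d s.2) := by
        rw [Fintype.sum_prod_type]
        simp only [average, ← Finset.mul_sum]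
        rw [← mul_assoc]
        rw [sqrt_mul_inv_self]
        congr 1
        refine Finset.sum_congr rfl fun a _ => ?_
        rw [← Fin.sum_univ_eq_sum_range (fun i => M a (d i)) n]
      rw [h1]
      simp only [hξ, ← Finset.mul_sum, Finset.sum_sub_distrib]
      ring
    have h2 : ∫ ω, Complex.exp (((√(n : ℝ))⁻¹ * ∑ s, Z s ω : ℝ) * Complex.I) ∂P
        = Complex.exp ((√(n : ℝ) * ∑ a, average n (M a) d : ℝ) * Complex.I)
          * ∫ ω, Complex.exp ((∑ s, ξ s ω : ℝ) * Complex.I) ∂P := by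
      rw [← integral_const_mul]
      congr 1 with ω
      rw [hsplit, ← Complex.exp_add]
      congr 1
      push_cast
      ring
    rw [h2, ← hS2, ← mul_sub, norm_mul, Complex.norm_exp_ofReal_mul_I, one_mul]
    refine hLY.trans ?_
    gcongr
  · have h1 : |Z s ω - M s.1 (d s.2)| ≤ 2 * K :=
      (abs_sub _ _).trans (by linarith [hK s.1 (kernelArg d s.2 fun j =>
          J n s.1 s.2 j ω), hMK s.1 (d s.2)])
    rw [hξ, abs_mul, abs_of_pos (inv_pos.2 hsq)]
    gcongr
  · simp only [hξ]
    rw [integral_const_mul, integral_sub ((hZb s).integrable P) (integrable_const _), hZ1]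
    simp

end

section

variable {Ω E A : Type*} [MeasurableSpace Ω] [MeasurableSpace E] [Fintype A] {P : Measure Ω}
  [IsProbabilityMeasure P] {D : ℕ → Ω → E} {μ : Measure E} {m : ℕ → ℕ} {r : A → ℕ}
  {J : (n : ℕ) → (a : A) → Fin n → Fin (r a) → Ω → ℕ}

/-- The asymptotic variance of the resampled sum of the kernels `κ a` with first-order projections
`f a` and `g a`: the variance of the resampling given the data, plus that of the two averages of the
data, the covariance of which is weighted by the limiting overlap of the two samples. -/
noncomputable def limitVariance (μ : Measure E) (c : ℝ) (κ : (a : A) → (Fin (r a + 1) → E) → ℝ)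
    (f g : A → E → ℝ) : ℝ :=
  ∑ a, (∫ z, κ a z * κ a z ∂(Measure.pi fun _ => μ) - ∫ x, f a x * f a x ∂μ)
    + (∫ x, (∑ a, f a x) * ∑ a, f a x ∂μ + c * ∫ x, (∑ a, g a x) * ∑ a, g a x ∂μ
      + 2 * (min c 1 * ∫ x, (∑ a, f a x) * ∑ a, g a x ∂μ))

lemma HasLinearization.isLittleOProb_average_condMean (hD : IsIIDSequence P D μ)
    (hm : Tendsto m atTop atTop) {l : ℕ} {κ : (Fin (l + 1) → E) → ℝ} {f g : E → ℝ}
    (h : HasLinearization P D μ m κ f g) :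
    IsLittleOProb P fun n ω => (average n (condMean κ (m n) fun i => D i ω) fun i => D i ω)
      - ∫ z, κ z ∂(Measure.pi fun _ => μ) := by
  have h1 := (h.mean.abs.add (hD.isLittleOProb_average h.bdd_left h.integral_left
    tendsto_id).abs).add (hD.isLittleOProb_average h.bdd_right h.integral_right hm).abs
  refine h1.of_eventually_le ?_
  filter_upwards [eventually_ge_atTop 1] with n hn ω
  have h2 : 1 ≤ √(n : ℝ) := Real.one_le_sqrt.2 (by exact_mod_cast hn)
  simp only [id]
  set x := average n (condMean κ (m n) fun i => D i ω) fun i => D i ω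
  set y := average n f fun i => D i ω
  set z := average (m n) g fun i => D i ω
  set I₀ := ∫ z, κ z ∂(Measure.pi fun _ => μ)
  change |x - I₀| ≤ |(|√(n : ℝ) * (x - I₀ - y - z)| + |y| + |z|)|
  rw [abs_of_nonneg (by positivity : 0 ≤ |√(n : ℝ) * (x - I₀ - y - z)| + |y| + |z|), abs_mul,
    abs_of_nonneg (Real.sqrt_nonneg _)]
  have h3 : |x - I₀| ≤ |x - I₀ - y - z| + |y| + |z| := by
    calc |x - I₀| = |(x - I₀ - y - z) + y + z| := by ring_nf
      _ ≤ _ := (abs_add_le _ _).trans (by gcongr; exact abs_add_le _ _)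
  nlinarith [abs_nonneg (x - I₀ - y - z)]

lemma HasLinearization.isLittleOProb_average_condMean_sq (hD : IsIIDSequence P D μ)
    (hm : Tendsto m atTop atTop) {l : ℕ} {κ : (Fin (l + 1) → E) → ℝ} {f g : E → ℝ} {K : ℝ}
    (hK : ∀ z, |κ z| ≤ K) (h0 : ∫ z, κ z ∂(Measure.pi fun _ => μ) = 0)
    (h : HasLinearization P D μ m κ f g) :
    IsLittleOProb P fun n ω => (average n (fun x => condMean κ (m n) (fun i => D i ω) x ^ 2)
      fun i => D i ω) - ∫ x, f x * f x ∂μ := by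
  have := hD.isProbabilityMeasure
  obtain ⟨C, hC⟩ := h.bdd_left.2
  obtain ⟨R, hR, hle⟩ := h.uniform
  have hff := h.bdd_left.mul h.bdd_left
  have h1 := hD.isLittleOProb_average (hff.sub (.const (∫ x, f x * f x ∂μ)))
    (integral_sub_integral_eq_zero μ hff) tendsto_id
  refine ((hR.const_mul (K + C)).abs.add h1.abs).of_eventually_le ?_
  filter_upwards [hle, eventually_ne_atTop 0, hm.eventually_ne_atTop 0] with n h2 hn hmn ω
  simp only [h0, sub_zero] at h2
  have h3 : average n (fun x => condMean κ (m n) (fun i => D i ω) x ^ 2) (fun i => D i ω)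
      - ∫ x, f x * f x ∂μ
      = average n (fun x => condMean κ (m n) (fun i => D i ω) x ^ 2 + (-1) * (f x * f x))
          (fun i => D i ω)
        + average n (fun x => f x * f x - ∫ x, f x * f x ∂μ) fun i => D i ω := by
    rw [average_sub_const hn, average_add, average_const_mul]
    ring
  rw [h3]
  simp only [id]
  rw [abs_of_nonneg (a := |_| + |_|) (by positivity)]
  refine (abs_add_le _ _).trans (add_le_add ?_ le_rfl)
  refine abs_average_le (fun x => ?_) (abs_nonneg _) _ _
  have h4 := abs_condMean_le hK hmn (fun i => D i ω) x
  have h5 : condMean κ (m n) (fun i => D i ω) x ^ 2 + (-1) * (f x * f x)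
      = (condMean κ (m n) (fun i => D i ω) x + f x)
        * (condMean κ (m n) (fun i => D i ω) x - f x) := by ring
  have h6 : |condMean κ (m n) (fun i => D i ω) x + f x| ≤ K + C :=
    (abs_add_le _ _).trans (add_le_add h4 (hC x))
  rw [h5, abs_mul, abs_mul]
  exact mul_le_mul (h6.trans (le_abs_self _)) (h2 ω x) (abs_nonneg _) (abs_nonneg _)

lemma measurable_index_family (hJ : IsUniformResampling P D m r J) (n : ℕ) :
    Measurable fun ω (q : Σ s : A × Fin n, Fin (r s.1)) => J n q.1.1 q.1.2 q.2 ω :=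
  measurable_pi_iff.2 fun q => hJ.measurable n q.1.1 q.1.2 q.2

/-- The **central limit theorem** for resampled sums of centred product kernels. -/
theorem tendsto_charFun_resampledSum_productKernels (hD : IsIIDSequence P D μ) {c : ℝ}
    (hm : Tendsto m atTop atTop)
    (hc : Tendsto (fun n : ℕ => (n : ℝ) / (m n : ℝ)) atTop (𝓝 c))
    (hJ : IsUniformResampling P D m r J) {κ : (a : A) → (Fin (r a + 1) → E) → ℝ}
    (hκ : ∀ a, κ a ∈ productKernels E (r a)) (h0 : ∀ a, ∫ z, κ a z ∂(Measure.pi fun _ => μ) = 0)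
    {f g : A → E → ℝ} (hlin : ∀ a, HasLinearization P D μ m (κ a) (f a) (g a)) :
    Tendsto (fun n => ∫ ω, Complex.exp ((resampledSum D J κ n ω : ℝ) * Complex.I) ∂P) atTop
      (𝓝 (Complex.exp ((-(limitVariance μ c κ f g) / 2 : ℝ)))) := by
  have := hD.isProbabilityMeasure
  have hb := fun a => isBddMeas_of_mem_productKernels (hκ a)
  obtain ⟨K, hK0, hK⟩ : ∃ K : ℝ, 0 ≤ K ∧ ∀ a z, |κ a z| ≤ K := by
    choose C hC using fun a => (hb a).2
    exact ⟨∑ a, |C a|, Finset.sum_nonneg fun _ _ => abs_nonneg _, fun a z =>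
      ((hC a z).trans (le_abs_self _)).trans
        (Finset.single_le_sum (f := fun a => |C a|) (fun _ _ => abs_nonneg _) (Finset.mem_univ a))⟩
  set F : E → ℝ := fun x => ∑ a, f a x with hF
  set G : E → ℝ := fun x => ∑ a, g a x with hG
  have hFb : IsBddMeas F := IsBddMeas.sum fun a _ => (hlin a).bdd_left
  have hGb : IsBddMeas G := IsBddMeas.sum fun a _ => (hlin a).bdd_right
  have hF0 : ∫ x, F x ∂μ = 0 := by
    simp only [hF]
    rw [integral_finsetSum _ fun a _ => (hlin a).bdd_left.integrable μ]
    simp [fun a => (hlin a).integral_left]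
  have hG0 : ∫ x, G x ∂μ = 0 := by
    simp only [hG]
    rw [integral_finsetSum _ fun a _ => (hlin a).bdd_right.integrable μ]
    simp [fun a => (hlin a).integral_right]
  set v := ∑ a, (∫ z, κ a z * κ a z ∂(Measure.pi fun _ => μ) - ∫ x, f a x * f a x ∂μ) with hv
  -- conditional mean, conditional variance, and the linear part, as functions of the data
  set T : ℕ → Ω → ℝ := fun n ω =>
    √(n : ℝ) * ∑ a, average n (condMean (κ a) (m n) fun i => D i ω) fun i => D i ω with hT
  set s2 : ℕ → Ω → ℝ := fun n ω => ∑ a, average n (fun x =>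
    condMean (κ a * κ a) (m n) (fun i => D i ω) x - condMean (κ a) (m n) (fun i => D i ω) x ^ 2)
      fun i => D i ω with hs2
  set L : ℕ → Ω → ℝ := fun n ω =>
    √(n : ℝ) * ((average n F fun i => D i ω) + average (m n) G fun i => D i ω) with hL
  have hTL : IsLittleOProb P fun n ω => T n ω - L n ω := by
    refine (IsLittleOProb.sum Finset.univ fun a _ => (hlin a).mean).congr'
      (Eventually.of_forall fun n ω => ?_)
    simp only [hT, hL, hF, hG, h0, average_sum, ← Finset.mul_sum, Finset.sum_sub_distrib,
      Finset.sum_const_zero]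
    ring
  have hs2v : IsLittleOProb P fun n ω => s2 n ω - v := by
    choose f' g' hlin' using fun a =>
      exists_hasLinearization hD hm hc (mul_mem_productKernels (hκ a) (hκ a))
    refine (IsLittleOProb.sum Finset.univ fun a _ =>
      ((hlin' a).isLittleOProb_average_condMean hD hm).sub
        ((hlin a).isLittleOProb_average_condMean_sq hD hm (hK a) (h0 a))).congr'
      (Eventually.of_forall fun n ω => ?_)
    simp only [hs2, hv, sub_eq_add_neg, average_add, Finset.sum_add_distrib, Finset.sum_neg_distrib,
      Pi.mul_apply, neg_add, neg_neg]
    have h1 : ∀ a, average n (fun x => -condMean (κ a) (m n) (fun i => D i ω) x ^ 2)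
        (fun i => D i ω) = -average n (fun x => condMean (κ a) (m n) (fun i => D i ω) x ^ 2)
        (fun i => D i ω) := fun a => by
      have := average_const_mul n (-1) (fun x => condMean (κ a) (m n) (fun i => D i ω) x ^ 2)
        (fun i => D i ω)
      simpa using this
    simp only [h1, Finset.sum_neg_distrib]
    ring
  set inner : ℕ → Ω → ℂ := fun n ω' => ∫ ω, Complex.exp (((√(n : ℝ))⁻¹ * ∑ s : A × Fin n,
    κ s.1 (kernelArg (fun i => D i ω') s.2 fun j =>
        J n s.1 s.2 j ω) : ℝ) * Complex.I) ∂P with hinner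
  have hDm : Measurable fun ω i => D i ω := measurable_pi_iff.2 hD.measurable
  -- the characteristic function as a function of indices and data
  set h : (n : ℕ) → ((Σ s : A × Fin n, Fin (r s.1)) → ℕ) × (ℕ → E) → ℂ := fun n p =>
    Complex.exp (((√(n : ℝ))⁻¹ * ∑ s : A × Fin n,
      κ s.1 (kernelArg p.2 s.2 fun j => p.1 ⟨s, j⟩) : ℝ) * Complex.I) with hh
  have hhm : ∀ n, Measurable (h n) := by
    intro n
    have h1 : ∀ s : A × Fin n, Measurable fun p : ((Σ s : A × Fin n, Fin (r s.1)) → ℕ) × (ℕ → E) =>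
        κ s.1 (kernelArg p.2 s.2 fun j => p.1 ⟨s, j⟩) := fun s =>
      (hb s.1).1.comp ((measurable_kernelArg (l := r s.1) s.2).comp
        (f := fun p : ((Σ s : A × Fin n, Fin (r s.1)) → ℕ) × (ℕ → E) =>
          ((fun j => p.1 ⟨s, j⟩ : Fin (r s.1) → ℕ), p.2)) (by fun_prop))
    have h2 : Measurable fun p : ((Σ s : A × Fin n, Fin (r s.1)) → ℕ) × (ℕ → E) =>
        (√(n : ℝ))⁻¹ * ∑ s : A × Fin n, κ s.1 (kernelArg p.2 s.2 fun j => p.1 ⟨s, j⟩) :=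
      (Finset.measurable_fun_sum _ fun s _ => h1 s).const_mul _
    exact Complex.measurable_exp.comp ((Complex.measurable_ofReal.comp h2).mul_const _)
  have hfub : ∀ᶠ n in atTop, ∫ ω, Complex.exp ((resampledSum D J κ n ω : ℝ) * Complex.I) ∂P
      = ∫ ω', inner n ω' ∂P := by
    filter_upwards [hm.eventually_gt_atTop 0] with n hmn
    refine integral_indepFun_eq (measurable_index_family hJ n) hDm (hJ.indep_data n hmn)
      (hhm n).stronglyMeasurable ?_
    refine Integrable.of_bound ((hhm n).comp
      ((measurable_index_family hJ n).prodMk hDm)).aestronglyMeasurable 1 (ae_of_all _ fun ω => ?_)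
    simp only [hh]
    rw [Complex.norm_exp_ofReal_mul_I]
  have hinm : ∀ n, StronglyMeasurable (inner n) := fun n =>
    stronglyMeasurable_integral_indepFun (measurable_index_family hJ n) hDm
      (hhm n).stronglyMeasurable
  have hLm : ∀ n, Measurable (L n) := fun n =>
    ((hD.isBddMeas_average hFb n).1.add (hD.isBddMeas_average hGb (m n)).1).const_mul _
  have hev : Complex.exp ((-v / 2 : ℝ)) = ((Real.exp (-v / 2) : ℝ) : ℂ) := by
    rw [Complex.ofReal_exp]
  have hsq : Tendsto (fun n : ℕ => (√(n : ℝ))⁻¹) atTop (𝓝 0) :=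
    tendsto_inv_atTop_zero.comp (Real.tendsto_sqrt_atTop.comp tendsto_natCast_atTop_atTop)
  have hsm : Tendsto (fun n : ℕ => (√(n : ℝ))⁻¹ * (2 * K)) atTop (𝓝 0) := by
    simpa using hsq.mul_const (2 * K)
  have hR : IsLittleOProb P fun (n : ℕ) ω => (√(n : ℝ))⁻¹ * (2 * K) * (Fintype.card A * K ^ 2)
      + |T n ω - L n ω| + Real.exp |v| * |s2 n ω - v| :=
    ((IsLittleOProb.of_tendsto (by simpa using hsm.mul_const (Fintype.card A * K ^ 2))).add
      hTL.abs).add (hs2v.abs.const_mul _)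
  have hzero : Tendsto (fun n => ∫ ω', (inner n ω' - Complex.exp ((L n ω' : ℝ) * Complex.I)
      * Complex.exp ((-v / 2 : ℝ))) ∂P) atTop (𝓝 0) := by
    refine tendsto_integral_zero_of_isLittleOProb (C := 1 + Real.exp (-v / 2))
      (Eventually.of_forall fun n => ?_) (Eventually.of_forall fun n ω => ?_) hR ?_
    · have := hLm n
      exact (hinm n).aestronglyMeasurable.sub (by fun_prop)
    · refine (norm_sub_le _ _).trans (add_le_add ?_ ?_)
      · refine (norm_integral_le_of_norm_le (integrable_const (1 : ℝ))
          (ae_of_all _ fun ω => ?_)).trans (by simp)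
        rw [Complex.norm_exp_ofReal_mul_I]
      · rw [norm_mul, Complex.norm_exp_ofReal_mul_I, one_mul, hev, Complex.norm_real,
          Real.norm_eq_abs, abs_of_pos (Real.exp_pos _)]
    · filter_upwards [eventually_gt_atTop 0, hm.eventually_gt_atTop 0,
        (tendsto_order.1 hsm).2 1 one_pos] with n hn hmn hsmall ω
      obtain ⟨hpos, hle⟩ := hJ.norm_charFun_sub_le (fun a => (hb a).1) hK0 hK hn hmn hsmall.le
        fun i => D i ω
      have h1 : ‖Complex.exp ((T n ω : ℝ) * Complex.I) * Complex.exp ((-(s2 n ω) / 2 : ℝ))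
          - Complex.exp ((L n ω : ℝ) * Complex.I) * Complex.exp ((-v / 2 : ℝ))‖
          ≤ |T n ω - L n ω| + Real.exp |v| * |s2 n ω - v| := by
        have h2 : ‖Complex.exp ((-(s2 n ω) / 2 : ℝ))‖ ≤ 1 := by
          rw [← Complex.ofReal_exp, Complex.norm_real, Real.norm_eq_abs,
            abs_of_pos (Real.exp_pos _), Real.exp_le_one_iff]
          have : 0 ≤ s2 n ω := hpos
          linarith
        have h3 : ‖Complex.exp ((-(s2 n ω) / 2 : ℝ)) - Complex.exp ((-v / 2 : ℝ))‖
            ≤ Real.exp |v| * |s2 n ω - v| := by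
          rw [← Complex.ofReal_exp, ← Complex.ofReal_exp, ← Complex.ofReal_sub, Complex.norm_real]
          exact abs_exp_neg_half_sub_le hpos v
        calc _ = ‖(Complex.exp ((T n ω : ℝ) * Complex.I) - Complex.exp ((L n ω : ℝ) * Complex.I))
                * Complex.exp ((-(s2 n ω) / 2 : ℝ)) + Complex.exp ((L n ω : ℝ) * Complex.I)
                * (Complex.exp ((-(s2 n ω) / 2 : ℝ)) - Complex.exp ((-v / 2 : ℝ)))‖ := by
              congr 1; ring
          _ ≤ |T n ω - L n ω| * 1 + 1 * (Real.exp |v| * |s2 n ω - v|) := by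
              refine (norm_add_le _ _).trans ?_
              rw [norm_mul, norm_mul, Complex.norm_exp_ofReal_mul_I]
              exact add_le_add (mul_le_mul (norm_cexp_ofReal_mul_I_sub_le _ _) h2 (norm_nonneg _)
                (abs_nonneg _)) (mul_le_mul_of_nonneg_left h3 zero_le_one)
          _ = _ := by ring
      rw [abs_of_nonneg (by positivity), add_assoc]
      refine le_trans ?_ (add_le_add hle h1)
      refine le_trans (le_of_eq ?_) (norm_add_le _ _)
      congr 1
      simp only [hinner, hT, hs2]
      ring
  have hlim := hD.tendsto_charFun_averages hm hc hFb hGb hF0 hG0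
  have hsum := hzero.add (hlim.mul_const (Complex.exp ((-v / 2 : ℝ))))
  have hval : Complex.exp ((-(limitVariance μ c κ f g) / 2 : ℝ))
      = 0 + Complex.exp ((-(∫ x, F x ^ 2 ∂μ + c * ∫ x, G x ^ 2 ∂μ
        + 2 * (min c 1 * ∫ x, F x * G x ∂μ)) / 2 : ℝ)) * Complex.exp ((-v / 2 : ℝ)) := by
    rw [zero_add, ← Complex.exp_add, ← Complex.ofReal_add]
    congr 2
    simp only [limitVariance, pow_two, hv, hF, hG]
    ring
  rw [hval]
  refine hsum.congr' ?_
  filter_upwards [hfub] with n hn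
  have hLi : Integrable (fun ω => Complex.exp ((L n ω : ℝ) * Complex.I)
      * Complex.exp ((-v / 2 : ℝ))) P := by
    refine Integrable.mul_const (Integrable.of_bound ?_ 1 (ae_of_all _ fun ω => ?_)) _
    · have := hLm n
      fun_prop
    · rw [Complex.norm_exp_ofReal_mul_I]
  have hini : Integrable (inner n) P := by
    refine Integrable.of_bound (hinm n).aestronglyMeasurable 1 (ae_of_all _ fun ω => ?_)
    refine (norm_integral_le_of_norm_le (integrable_const (1 : ℝ))
      (ae_of_all _ fun ω => ?_)).trans (by simp)
    rw [Complex.norm_exp_ofReal_mul_I]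
  rw [hn, integral_sub hini hLi, integral_mul_const]
  simp only [hL]
  ring

lemma integral_sum_mul_sum {β ι : Type*} [MeasurableSpace β] (ρ : Measure β)
    [IsProbabilityMeasure ρ] [Fintype ι] (t : ι → ℝ) {h k : ι → β → ℝ}
    (hh : ∀ s, IsBddMeas (h s)) (hk : ∀ s, IsBddMeas (k s)) :
    ∫ x, (∑ s, t s * h s x) * ∑ s, t s * k s x ∂ρ
      = ∑ s, ∑ s', t s * t s' * ∫ x, h s x * k s' x ∂ρ := by
  have hi : ∀ s s', Integrable (fun x => t s * t s' * (h s x * k s' x)) ρ := fun s s' =>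
    (((hh s).mul (hk s')).integrable ρ).const_mul _
  calc ∫ x, (∑ s, t s * h s x) * ∑ s, t s * k s x ∂ρ
      = ∫ x, ∑ s, ∑ s', t s * t s' * (h s x * k s' x) ∂ρ := by
        congr 1 with x
        rw [Finset.sum_mul_sum]
        exact Finset.sum_congr rfl fun s _ => Finset.sum_congr rfl fun s' _ => by ring
    _ = _ := by
        rw [integral_finsetSum _ fun s _ => integrable_finsetSum _ fun s' _ => hi s s']
        refine Finset.sum_congr rfl fun s _ => ?_
        rw [integral_finsetSum _ fun s' _ => hi s s']
        exact Finset.sum_congr rfl fun s' _ => integral_const_mul _ _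

/-- The limit theorem for resampled sums of linear combinations of centred product kernels: the
limiting variance is a quadratic form in the coefficients. -/
theorem exists_matrix_tendsto_charFun_productKernels (hD : IsIIDSequence P D μ) {c : ℝ}
    (hm : Tendsto m atTop atTop)
    (hc : Tendsto (fun n : ℕ => (n : ℝ) / (m n : ℝ)) atTop (𝓝 c))
    (hJ : IsUniformResampling P D m r J) {ι : Type*} [Fintype ι]
    {κ : ι → (a : A) → (Fin (r a + 1) → E) → ℝ}
    (hκ : ∀ s a, κ s a ∈ productKernels E (r a))
    (h0 : ∀ s a, ∫ z, κ s a z ∂(Measure.pi fun _ => μ) = 0) :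
    ∃ M : ι → ι → ℝ, ∀ t : ι → ℝ, Tendsto (fun n => ∫ ω, Complex.exp
      ((resampledSum D J (fun a z => ∑ s, t s * κ s a z) n ω : ℝ) * Complex.I) ∂P) atTop
      (𝓝 (Complex.exp ((-(∑ s, ∑ s', t s * t s' * M s s') / 2 : ℝ)))) := by
  have := hD.isProbabilityMeasure
  choose f g hlin using fun s a => exists_hasLinearization hD hm hc (hκ s a)
  have hb := fun s a => isBddMeas_of_mem_productKernels (hκ s a)
  refine ⟨fun s s' => ∑ a, (∫ z, κ s a z * κ s' a z ∂(Measure.pi fun _ => μ)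
      - ∫ x, f s a x * f s' a x ∂μ)
    + (∫ x, (∑ a, f s a x) * ∑ a, f s' a x ∂μ + c * ∫ x, (∑ a, g s a x) * ∑ a, g s' a x ∂μ
      + 2 * (min c 1 * ∫ x, (∑ a, f s a x) * ∑ a, g s' a x ∂μ)), fun t => ?_⟩
  have hmem : ∀ a, (fun z => ∑ s, t s * κ s a z) ∈ productKernels E (r a) := fun a => by
    have : (fun z => ∑ s, t s * κ s a z) = ∑ s, t s • κ s a := by
      ext z; simp
    rw [this]
    exact Submodule.sum_mem _ fun s _ => Submodule.smul_mem _ _ (hκ s a)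
  have hcent : ∀ a, ∫ z, ∑ s, t s * κ s a z ∂(Measure.pi fun _ => μ) = 0 := fun a => by
    rw [integral_finsetSum _ fun s _ => ((hb s a).integrable _).const_mul _]
    simp [integral_const_mul, h0]
  have hl : ∀ a, HasLinearization P D μ m (fun z => ∑ s, t s * κ s a z)
      (fun x => ∑ s, t s * f s a x) (fun x => ∑ s, t s * g s a x) := fun a => by
    refine HasLinearization.sum hD hm Finset.univ (κ := fun s z => t s * κ s a z)
      (fun s => (hb s a).const_mul _) fun s => (hlin s a).smul _
  have key := tendsto_charFun_resampledSum_productKernels hD hm hc hJ hmem hcent hl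
  convert key using 5
  rw [limitVariance]
  have hF : ∀ s, IsBddMeas fun x => ∑ a, f s a x := fun s =>
    IsBddMeas.sum fun a _ => (hlin s a).bdd_left
  have hG : ∀ s, IsBddMeas fun x => ∑ a, g s a x := fun s =>
    IsBddMeas.sum fun a _ => (hlin s a).bdd_right
  have hcomm : ∀ (f : ι → A → E → ℝ) (x : E),
      ∑ a, ∑ s, t s * f s a x = ∑ s, t s * ∑ a, f s a x := fun f x => by
    rw [Finset.sum_comm]
    exact Finset.sum_congr rfl fun s _ => (Finset.mul_sum _ _ _).symm
  simp only [hcomm]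
  rw [integral_sum_mul_sum μ t hF hF, integral_sum_mul_sum μ t hG hG,
    integral_sum_mul_sum μ t hF hG]
  have h1 : ∀ a, ∫ z, (∑ s, t s * κ s a z) * ∑ s, t s * κ s a z ∂(Measure.pi fun _ => μ)
      - ∫ x, (∑ s, t s * f s a x) * ∑ s, t s * f s a x ∂μ
      = ∑ s, ∑ s', t s * t s' * (∫ z, κ s a z * κ s' a z ∂(Measure.pi fun _ => μ)
        - ∫ x, f s a x * f s' a x ∂μ) := fun a => by
    rw [integral_sum_mul_sum _ t (fun s => hb s a) (fun s => hb s a),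
      integral_sum_mul_sum μ t (fun s => (hlin s a).bdd_left) fun s => (hlin s a).bdd_left]
    simp only [← Finset.sum_sub_distrib, mul_sub]
  have h2 : ∀ Y : A → ι → ι → ℝ, ∑ a, ∑ s, ∑ s', t s * t s' * Y a s s'
      = ∑ s, ∑ s', t s * t s' * ∑ a, Y a s s' := fun Y => by
    rw [Finset.sum_comm]
    refine Finset.sum_congr rfl fun s _ => ?_
    rw [Finset.sum_comm]
    exact Finset.sum_congr rfl fun s' _ => (Finset.mul_sum _ _ _).symm
  have h3 : ∀ Y₁ Y₂ Y₃ Y₄ : ι → ι → ℝ,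
      ∑ s, ∑ s', t s * t s' * (Y₁ s s' + (Y₂ s s' + c * Y₃ s s' + 2 * (min c 1 * Y₄ s s')))
      = ∑ s, ∑ s', t s * t s' * Y₁ s s' + (∑ s, ∑ s', t s * t s' * Y₂ s s'
        + c * ∑ s, ∑ s', t s * t s' * Y₃ s s'
        + 2 * (min c 1 * ∑ s, ∑ s', t s * t s' * Y₄ s s')) := fun Y₁ Y₂ Y₃ Y₄ => by
    simp only [Finset.mul_sum, ← Finset.sum_add_distrib]
    exact Finset.sum_congr rfl fun s _ => Finset.sum_congr rfl fun s' _ => by ring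
  simp only [h1]
  rw [h2, ← h3]

end

/-! ### Tail bounds for resampled sums of square-integrable kernels -/

lemma lintegral_indepFun_eq {Ω α β : Type*} [MeasurableSpace Ω] [MeasurableSpace α]
    [MeasurableSpace β] {P : Measure Ω} [IsProbabilityMeasure P] {X : Ω → α} {Y : Ω → β}
    {h : α × β → ℝ≥0∞} (hX : Measurable X) (hY : Measurable Y) (hXY : IndepFun X Y P)
    (hh : Measurable h) :
    ∫⁻ ω, h (X ω, Y ω) ∂P = ∫⁻ ω', ∫⁻ ω, h (X ω', Y ω) ∂P ∂P := by
  have hmap := (indepFun_iff_map_prod_eq_prod_map_map hX.aemeasurable hY.aemeasurable).1 hXY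
  have hXp := Measure.isProbabilityMeasure_map (μ := P) hX.aemeasurable
  have hYp := Measure.isProbabilityMeasure_map (μ := P) hY.aemeasurable
  rw [← lintegral_map (g := fun ω => (X ω, Y ω)) hh (hX.prodMk hY), hmap,
    lintegral_prod _ hh.aemeasurable, lintegral_map hh.lintegral_prod_right' hX]
  congr 1 with ω'
  exact lintegral_map (hh.comp measurable_prodMk_left) hY

lemma kernelArg_eq {E : Type*} {l : ℕ} (d : ℕ → E) (i : ℕ) (k : Fin l → ℕ) :
    kernelArg d i k = fun j => d ((Fin.cons i k : Fin (l + 1) → ℕ) j) := by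
  ext j
  refine Fin.cases ?_ (fun j => ?_) j <;> simp [kernelArg]

section

variable {Ω E : Type*} [MeasurableSpace Ω] [MeasurableSpace E] {P : Measure Ω}
  [IsProbabilityMeasure P] {D : ℕ → Ω → E} {μ : Measure E} {l : ℕ} {κ : (Fin (l + 1) → E) → ℝ}

lemma IsIIDSequence.map_comp_injective (hD : IsIIDSequence P D μ) {ι : Type*} [Fintype ι]
    {k : ι → ℕ} (hk : Function.Injective k) :
    P.map (fun ω j => D (k j) ω) = Measure.pi fun _ => μ := by
  have := hD.isProbabilityMeasure
  have h := (hD.indep.precomp hk).map_fun_eq_pi_map fun j => (hD.measurable (k j)).aemeasurable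
  refine h.trans ?_
  congr with j : 1
  exact hD.map_eq (k j)

lemma IsIIDSequence.measurable_comp (hD : IsIIDSequence P D μ) {ι : Type*} (k : ι → ℕ) :
    Measurable fun ω j => D (k j) ω :=
  measurable_pi_iff.2 fun j => hD.measurable (k j)

lemma IsIIDSequence.memLp_kernel (hD : IsIIDSequence P D μ) {k : Fin (l + 1) → ℕ}
    (hk : Function.Injective k) (hκ : MemLp κ 2 (Measure.pi fun _ => μ)) :
    MemLp (fun ω => κ fun j => D (k j) ω) 2 P := by
  rw [← hD.map_comp_injective hk] at hκ
  exact hκ.comp_of_map (hD.measurable_comp k).aemeasurable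

lemma IsIIDSequence.integral_kernel (hD : IsIIDSequence P D μ) {k : Fin (l + 1) → ℕ}
    (hk : Function.Injective k) {h : (Fin (l + 1) → E) → ℝ} (hh : Measurable h) :
    ∫ ω, h (fun j => D (k j) ω) ∂P = ∫ z, h z ∂(Measure.pi fun _ => μ) := by
  rw [← hD.map_comp_injective hk, integral_map (hD.measurable_comp k).aemeasurable
    hh.aestronglyMeasurable]

open Classical in
/-- Centred kernels are uncorrelated at disjoint index tuples; otherwise `2 x y ≤ x² + y²` is used. -/
lemma IsIIDSequence.integral_mul_kernel_le (hD : IsIIDSequence P D μ) (hm : Measurable κ)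
    (hκ : MemLp κ 2 (Measure.pi fun _ => μ)) (h0 : ∫ z, κ z ∂(Measure.pi fun _ => μ) = 0)
    {k k' : Fin (l + 1) → ℕ} (hk : Function.Injective k) (hk' : Function.Injective k') :
    ∫ ω, κ (fun j => D (k j) ω) * κ (fun j => D (k' j) ω) ∂P
      ≤ (∫ z, κ z ^ 2 ∂(Measure.pi fun _ => μ)) * if ∃ j j', k j = k' j' then 1 else 0 := by
  have hi := hD.memLp_kernel hk hκ
  have hi' := hD.memLp_kernel hk' hκ
  split_ifs with h
  · have h1 := hD.integral_kernel hk (hm.pow_const 2)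
    have h2 := hD.integral_kernel hk' (hm.pow_const 2)
    calc _ ≤ ∫ ω, (1 / 2 * κ (fun j => D (k j) ω) ^ 2 + 1 / 2 * κ (fun j =>
        D (k' j) ω) ^ 2) ∂P := by
          refine integral_mono (hi.integrable_mul hi')
            ((hi.integrable_sq.const_mul _).add (hi'.integrable_sq.const_mul _)) fun ω => ?_
          have := two_mul_le_add_sq (κ fun j => D (k j) ω) (κ fun j => D (k' j) ω)
          simp only
          linarith
      _ = _ := by
          rw [integral_add (hi.integrable_sq.const_mul _) (hi'.integrable_sq.const_mul _),
            integral_const_mul, integral_const_mul, h1, h2]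
          ring
  · push Not at h
    have hdisj : Disjoint (Finset.univ.image k) (Finset.univ.image k') := by
      refine Finset.disjoint_left.2 fun x hx hx' => ?_
      obtain ⟨j, _, rfl⟩ := Finset.mem_image.1 hx
      obtain ⟨j', _, h'⟩ := Finset.mem_image.1 hx'
      exact h j j' h'.symm
    have hind := (hD.indep.indepFun_finset _ _ hdisj hD.measurable).comp
      (φ := fun x : (Finset.univ.image k) → E =>
        κ fun j => x ⟨k j, Finset.mem_image_of_mem k (Finset.mem_univ j)⟩)
      (ψ := fun x : (Finset.univ.image k') → E =>
        κ fun j => x ⟨k' j, Finset.mem_image_of_mem k' (Finset.mem_univ j)⟩)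
      (hm.comp (by fun_prop)) (hm.comp (by fun_prop))
    have h1 := hind.integral_fun_mul_eq_mul_integral
      hi.aestronglyMeasurable hi'.aestronglyMeasurable
    refine (h1.trans ?_).le
    have h2 := hD.integral_kernel hk hm
    simp only [Function.comp_def, mul_zero]
    rw [h2, h0, zero_mul]

open Classical in
/-- The second moment of a sum of centred kernels is at most the second moment of the kernel times
the number of pairs of index tuples that meet. -/
lemma IsIIDSequence.lintegral_sq_sum_kernel_le (hD : IsIIDSequence P D μ) (hm : Measurable κ)
    (hκ : MemLp κ 2 (Measure.pi fun _ => μ)) (h0 : ∫ z, κ z ∂(Measure.pi fun _ => μ) = 0)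
    {ι : Type*} (s : Finset ι) {k : ι → Fin (l + 1) → ℕ} (hk : ∀ i ∈ s, Function.Injective (k i)) :
    ∫⁻ ω, ENNReal.ofReal ((∑ i ∈ s, κ fun j => D (k i j) ω) ^ 2) ∂P
      ≤ ENNReal.ofReal (∫ z, κ z ^ 2 ∂(Measure.pi fun _ => μ))
        * ∑ i ∈ s, ∑ i' ∈ s, if ∃ j j', k i j = k i' j' then 1 else 0 := by
  have hi : ∀ i ∈ s, MemLp (fun ω => κ fun j => D (k i j) ω) 2 P := fun i hi =>
    hD.memLp_kernel (hk i hi) hκ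
  have hsum := memLp_finsetSum s hi
  have hint : ∀ i ∈ s, ∀ i' ∈ s, Integrable (fun ω =>
      (κ fun j => D (k i j) ω) * κ fun j => D (k i' j) ω) P := fun i h i' h' =>
    (hi i h).integrable_mul (hi i' h')
  rw [← ofReal_integral_eq_lintegral_ofReal hsum.integrable_sq (ae_of_all _ fun ω => sq_nonneg _)]
  have hv : 0 ≤ ∫ z, κ z ^ 2 ∂(Measure.pi fun _ => μ) := integral_nonneg fun _ => sq_nonneg _
  have h1 : ∫ ω, (∑ i ∈ s, κ fun j => D (k i j) ω) ^ 2 ∂P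
      ≤ (∫ z, κ z ^ 2 ∂(Measure.pi fun _ => μ))
        * ∑ i ∈ s, ∑ i' ∈ s, if ∃ j j', k i j = k i' j' then 1 else 0 := by
    simp only [pow_two (∑ i ∈ s, _), Finset.sum_mul_sum]
    rw [integral_finsetSum _ fun i h => integrable_finsetSum _ (hint i h)]
    simp only [Finset.mul_sum]
    refine Finset.sum_le_sum fun i h => ?_
    rw [integral_finsetSum _ (hint i h)]
    exact Finset.sum_le_sum fun i' h' => hD.integral_mul_kernel_le hm hκ h0 (hk i h) (hk i' h')
  refine (ENNReal.ofReal_le_ofReal h1).trans (le_of_eq ?_)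
  rw [ENNReal.ofReal_mul hv, ENNReal.ofReal_sum_of_nonneg fun i _ => Finset.sum_nonneg fun i' _ => by
    split_ifs <;> norm_num]
  congr 1
  refine Finset.sum_congr rfl fun i _ => ?_
  rw [ENNReal.ofReal_sum_of_nonneg fun i' _ => by split_ifs <;> norm_num]
  refine Finset.sum_congr rfl fun i' _ => ?_
  split_ifs <;> simp

/-- A real function is uniformly tight over all index tuples, because every tuple factors through an
injective one, so that only finitely many laws occur. -/
lemma IsIIDSequence.exists_tail_le (hD : IsIIDSequence P D μ) (hm : Measurable κ) {τ : ℝ≥0∞}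
    (hτ : τ ≠ 0) : ∃ T : ℝ, 0 < T ∧ ∀ k : Fin (l + 1) → ℕ,
      P {ω | T < |κ fun j => D (k j) ω|} ≤ τ := by
  have := hD.isProbabilityMeasure
  have h1 : ∀ k : Fin (l + 1) → Fin (l + 1), Tendsto (fun T : ℕ =>
      (Measure.pi fun _ : Fin (l + 1) => μ) {z | (T : ℝ) < |κ fun j => z (k j)|}) atTop (𝓝 0) := by
    intro k
    have hk : Measurable fun z : Fin (l + 1) → E => |κ fun j => z (k j)| :=
      (hm.comp (by fun_prop)).abs
    have h := tendsto_measure_iInter_atTop (μ := Measure.pi fun _ : Fin (l + 1) => μ)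
      (s := fun T : ℕ => {z | (T : ℝ) < |κ fun j => z (k j)|})
      (fun T => (measurableSet_lt measurable_const hk).nullMeasurableSet)
      (fun T T' hT z (hz : (T' : ℝ) < _) =>
        show (T : ℝ) < _ from lt_of_le_of_lt (by exact_mod_cast hT) hz) ⟨0, measure_ne_top _ _⟩
    have he : ⋂ T : ℕ, {z : Fin (l + 1) → E | (T : ℝ) < |κ fun j => z (k j)|} = ∅ := by
      refine Set.eq_empty_iff_forall_notMem.2 fun z hz => ?_
      obtain ⟨T, hT⟩ := exists_nat_gt |κ fun j => z (k j)|
      exact lt_asymm hT (Set.mem_iInter.1 hz T)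
    rwa [he, measure_empty] at h
  have h2 : ∀ᶠ T : ℕ in atTop, 0 < T ∧ ∀ k : Fin (l + 1) → Fin (l + 1),
      (Measure.pi fun _ : Fin (l + 1) => μ) {z | (T : ℝ) < |κ fun j => z (k j)|} ≤ τ :=
    (eventually_gt_atTop 0).and <| eventually_all.2 fun k =>
        ((tendsto_order.1 (h1 k)).2 τ (pos_iff_ne_zero.2 hτ)).mono
      fun T hT => hT.le
  obtain ⟨T, hT0, hT⟩ := h2.exists
  refine ⟨T, Nat.cast_pos.2 hT0, fun k => ?_⟩
  obtain ⟨t, hkt, ht⟩ := Infinite.exists_superset_card_eq (Finset.univ.image k) (l + 1)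
    (Finset.card_image_le.trans (by simp))
  let e := t.equivFinOfCardEq ht
  have hk : ∀ j, k j ∈ t := fun j => hkt (Finset.mem_image_of_mem k (Finset.mem_univ j))
  have hinj : Function.Injective fun j => (e.symm j : ℕ) :=
    Subtype.val_injective.comp e.symm.injective
  have h3 := hT fun j => e ⟨k j, hk j⟩
  have hk' : Measurable fun z : Fin (l + 1) → E => |κ fun j => z (e ⟨k j, hk j⟩)| :=
    (hm.comp (by fun_prop)).abs
  rw [← hD.map_comp_injective hinj, Measure.map_apply (hD.measurable_comp _)
    (measurableSet_lt measurable_const hk')] at h3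
  simpa using h3

/-- The index tuple `(i, k₁, …, k_l)` of the subject `i`, for which the indices `x i = (k₁, …, k_l)`
were drawn. -/
def indexTuple {n : ℕ} (x : Fin n → Fin l → ℕ) (i : Fin n) : Fin (l + 1) → ℕ :=
  Fin.cons (i : ℕ) (x i)

variable {n : ℕ} {X : Ω → Fin n → Fin l → ℕ} {ε : ℝ≥0∞}

lemma measurableSet_setOf_countable {β : Type*} [Countable β] [MeasurableSpace β]
    [MeasurableSingletonClass β] {Y : Ω → β} (hY : Measurable Y) (p : β → Prop) :
    MeasurableSet {ω | p (Y ω)} :=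
  hY (Set.to_countable {y | p y}).measurableSet

lemma measurable_select {ι : Type*} (k : ι → ℕ) : Measurable fun (y : ℕ → E) j => y (k j) :=
  measurable_pi_iff.2 fun j => measurable_pi_apply (k j)

lemma measure_exists_exists_le (p : Fin (l + 1) → Fin (l + 1) → Ω → Prop)
    (h : ∀ j j', P {ω | p j j' ω} ≤ ε) :
    P {ω | ∃ j j', p j j' ω} ≤ (l + 1 : ℝ≥0∞) ^ 2 * ε := by
  have h1 : {ω | ∃ j j', p j j' ω} = ⋃ j, ⋃ j', {ω | p j j' ω} := by
    ext ω; simp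
  rw [h1]
  calc P (⋃ j, ⋃ j', {ω | p j j' ω}) ≤ ∑ j, ∑ j', P {ω | p j j' ω} :=
        (measure_iUnion_fintype_le _ _).trans
          (Finset.sum_le_sum fun j _ => measure_iUnion_fintype_le _ _)
    _ ≤ ∑ j : Fin (l + 1), ∑ j' : Fin (l + 1), ε :=
        Finset.sum_le_sum fun j _ => Finset.sum_le_sum fun j' _ => h j j'
    _ = (l + 1 : ℝ≥0∞) ^ 2 * ε := by
        simp only [Finset.sum_const, Finset.card_univ, Fintype.card_fin, nsmul_eq_mul]
        push_cast
        ring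

lemma measure_not_injective_le
    (hε : ∀ i i' j j', (i, j) ≠ (i', j') →
        P {ω | indexTuple (X ω) i j = indexTuple (X ω) i' j'} ≤ ε)
    (i : Fin n) :
    P {ω | ¬ Function.Injective (indexTuple (X ω) i)} ≤ (l + 1 : ℝ≥0∞) ^ 2 * ε := by
  refine (measure_mono fun ω hω => ?_).trans (measure_exists_exists_le
    (fun j j' ω => j ≠ j' ∧ indexTuple (X ω) i j = indexTuple (X ω) i j') fun j j' => ?_)
  · simp only [Set.mem_ofPred_eq, Function.Injective, not_forall] at hω
    obtain ⟨j, j', h, hne⟩ := hω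
    exact ⟨j, j', hne, h⟩
  · by_cases h : j = j'
    · simp [h]
    · simpa [h] using hε i i j j' (by simpa using h)

open Classical in
lemma lintegral_overlap_le (hX : Measurable X)
    (hε : ∀ i i' j j', (i, j) ≠ (i', j') →
        P {ω | indexTuple (X ω) i j = indexTuple (X ω) i' j'} ≤ ε) :
    ∫⁻ ω, (∑ i : Fin n, ∑ i' : Fin n, if ∃ j j', indexTuple (X ω) i j = indexTuple (X ω) i' j'
      then 1 else 0) ∂P ≤ n + n * (n * ((l + 1 : ℝ≥0∞) ^ 2 * ε)) := by
  have hms : ∀ i i', MeasurableSet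
      {ω | ∃ j j', indexTuple (X ω) i j = indexTuple (X ω) i' j'} := fun i i' =>
    measurableSet_setOf_countable hX fun x => ∃ j j', indexTuple x i j = indexTuple x i' j'
  have hmm : ∀ i i', Measurable fun ω => if ∃ j j', indexTuple (X ω) i j = indexTuple (X ω) i' j'
      then (1 : ℝ≥0∞) else 0 := fun i i' =>
          Measurable.ite (hms i i') measurable_const measurable_const
  rw [lintegral_finsetSum _ fun i _ => Finset.measurable_fun_sum _ fun i' _ => hmm i i']
  have h1 : ∀ i i', ∫⁻ ω, (if ∃ j j', indexTuple (X ω) i j = indexTuple (X ω) i' j'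
      then (1 : ℝ≥0∞) else 0) ∂P ≤ (if i = i' then 1 else 0) + (l + 1 : ℝ≥0∞) ^ 2 * ε := by
    intro i i'
    have h2 : ∫⁻ ω, (if ∃ j j', indexTuple (X ω) i j = indexTuple (X ω) i' j'
      then (1 : ℝ≥0∞) else 0) ∂P
        = P {ω | ∃ j j', indexTuple (X ω) i j = indexTuple (X ω) i' j'} := by
      rw [← lintegral_indicator_one (hms i i')]
      simp [Set.indicator_apply]
    rw [h2]
    split_ifs with h
    · exact prob_le_one.trans le_self_add
    · rw [zero_add]
      exact measure_exists_exists_le _ fun j j' => hε i i' j j' (by simp [h])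
  calc _ ≤ ∑ i : Fin n, ∑ i' : Fin n, ((if i = i' then 1 else 0) + (l + 1 : ℝ≥0∞) ^ 2 * ε) := by
        refine Finset.sum_le_sum fun i _ => ?_
        rw [lintegral_finsetSum _ fun i' _ => hmm i i']
        exact Finset.sum_le_sum fun i' _ => h1 i i'
    _ = _ := by
        simp [Finset.sum_add_distrib]

open Classical in
lemma measurable_sum_injective (hm : Measurable κ) :
    Measurable fun p : (Fin n → Fin l → ℕ) × (ℕ → E) =>
      ∑ i with Function.Injective (indexTuple p.1 i), κ fun j => p.2 (indexTuple p.1 i j) := by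
  refine measurable_from_prod_countable_right fun x => ?_
  change Measurable fun y : ℕ → E =>
    ∑ i with Function.Injective (indexTuple x i), κ fun j => y (indexTuple x i j)
  refine Finset.measurable_fun_sum (f := fun i (y : ℕ → E) => κ fun j => y (indexTuple x i j)) _
    fun i _ => ?_
  exact hm.comp (measurable_select (indexTuple x i))

open Classical in
/-- Second moment of the part of the sum over the subjects with distinct indices. -/
lemma IsIIDSequence.lintegral_sq_sum_injective_le (hD : IsIIDSequence P D μ) (hm : Measurable κ)
    (hκ : MemLp κ 2 (Measure.pi fun _ => μ)) (h0 : ∫ z, κ z ∂(Measure.pi fun _ => μ) = 0)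
    (hX : Measurable X) (hXD : IndepFun X (fun ω i => D i ω) P)
    (hε : ∀ i i' j j', (i, j) ≠ (i', j') →
        P {ω | indexTuple (X ω) i j = indexTuple (X ω) i' j'} ≤ ε) :
    ∫⁻ ω, ENNReal.ofReal ((∑ i with Function.Injective (indexTuple (X ω) i),
        κ fun j => D (indexTuple (X ω) i j) ω) ^ 2) ∂P
      ≤ ENNReal.ofReal (∫ z, κ z ^ 2 ∂(Measure.pi fun _ => μ))
        * (n + n * (n * ((l + 1 : ℝ≥0∞) ^ 2 * ε))) := by
  have hDm : Measurable fun ω i => D i ω := measurable_pi_iff.2 hD.measurable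
  have hh : Measurable fun p : (Fin n → Fin l → ℕ) × (ℕ → E) => ENNReal.ofReal
      ((∑ i with Function.Injective (indexTuple p.1 i), κ fun j => p.2 (indexTuple p.1 i j)) ^ 2) :=
    ENNReal.measurable_ofReal.comp ((measurable_sum_injective hm).pow_const 2)
  rw [lintegral_indepFun_eq hX hDm hXD hh]
  calc _ ≤ ∫⁻ ω', ENNReal.ofReal (∫ z, κ z ^ 2 ∂(Measure.pi fun _ => μ))
        * ∑ i : Fin n, ∑ i' : Fin n, (if ∃ j j', indexTuple (X ω') i j = indexTuple (X ω') i' j'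
          then 1 else 0) ∂P := by
        refine lintegral_mono fun ω' => ?_
        refine (hD.lintegral_sq_sum_kernel_le hm hκ h0
          (Finset.univ.filter fun i => Function.Injective (indexTuple (X ω') i))
          (k := fun i => indexTuple (X ω') i) fun i hi => (Finset.mem_filter.1 hi).2).trans ?_
        refine mul_le_mul' le_rfl ?_
        exact (Finset.sum_le_sum fun i _ =>
            Finset.sum_le_sum_of_subset (Finset.subset_univ _)).trans
          (Finset.sum_le_sum_of_subset (Finset.subset_univ _))
    _ ≤ _ := by
        rw [lintegral_const_mul' _ _ ENNReal.ofReal_ne_top]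
        exact mul_le_mul' le_rfl (lintegral_overlap_le hX hε)

/-- The subjects with repeated indices are so few that their terms are unlikely to be large. -/
lemma IsIIDSequence.measure_exists_not_injective_le (hD : IsIIDSequence P D μ) (hm : Measurable κ)
    (hX : Measurable X) (hXD : IndepFun X (fun ω i => D i ω) P)
    (hε : ∀ i i' j j', (i, j) ≠ (i', j') →
        P {ω | indexTuple (X ω) i j = indexTuple (X ω) i' j'} ≤ ε)
    {T : ℝ} {τ : ℝ≥0∞} (hT : ∀ k : Fin (l + 1) → ℕ, P {ω | T < |κ fun j => D (k j) ω|} ≤ τ) :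
    P {ω | ∃ i, ¬ Function.Injective (indexTuple (X ω) i) ∧
      T < |κ fun j => D (indexTuple (X ω) i j) ω|} ≤ n * ((l + 1 : ℝ≥0∞) ^ 2 * ε) * τ := by
  have hDm : Measurable fun ω i => D i ω := measurable_pi_iff.2 hD.measurable
  have h1 : ∀ i, P {ω | ¬ Function.Injective (indexTuple (X ω) i) ∧
      T < |κ fun j => D (indexTuple (X ω) i j) ω|} ≤ (l + 1 : ℝ≥0∞) ^ 2 * ε * τ := by
    intro i
    set s : Set ((Fin n → Fin l → ℕ) × (ℕ → E)) := {p | ¬ Function.Injective (indexTuple p.1 i) ∧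
      T < |κ fun j => p.2 (indexTuple p.1 i j)|} with hs
    have hsm : MeasurableSet s := by
      have hf : Measurable fun p : (Fin n → Fin l → ℕ) × (ℕ → E) =>
          |κ fun j => p.2 (indexTuple p.1 i j)| :=
        measurable_from_prod_countable_right fun x =>
            (hm.comp (measurable_select (indexTuple x i))).abs
      exact (measurableSet_setOf_countable (measurable_fst
        (α := Fin n → Fin l → ℕ) (β := ℕ → E))
        fun x => ¬ Function.Injective (indexTuple x i)).inter (measurableSet_lt measurable_const hf)
    have hms : MeasurableSet {ω | ¬ Function.Injective (indexTuple (X ω) i)} :=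
      measurableSet_setOf_countable hX fun x => ¬ Function.Injective (indexTuple x i)
    calc P {ω | ¬ Function.Injective (indexTuple (X ω) i) ∧
          T < |κ fun j => D (indexTuple (X ω) i j) ω|}
        = ∫⁻ ω, s.indicator 1 (X ω, fun i => D i ω) ∂P := by
          exact (lintegral_indicator_one ((hX.prodMk hDm) hsm)).symm
      _ = ∫⁻ ω', ∫⁻ ω, s.indicator 1 (X ω', fun i => D i ω) ∂P ∂P :=
          lintegral_indepFun_eq hX hDm hXD (measurable_one.indicator hsm)
      _ ≤ ∫⁻ ω', {ω | ¬ Function.Injective (indexTuple (X ω) i)}.indicator 1 ω' * τ ∂P := by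
          refine lintegral_mono fun ω' => ?_
          by_cases h : Function.Injective (indexTuple (X ω') i)
          · simp [hs, h]
          · have h2 : ∀ ω, s.indicator (1 : (Fin n → Fin l → ℕ) × (ℕ → E) → ℝ≥0∞) (X ω', fun i =>
              D i ω)
                = {ω | T < |κ fun j => D (indexTuple (X ω') i j) ω|}.indicator 1 ω := fun ω => by
              simp [hs, h, Set.indicator_apply]
            simp only [h2]
            have h3 : Measurable fun ω => |κ fun j => D (indexTuple (X ω') i j) ω| :=
              (hm.comp (hD.measurable_comp _)).abs
            rw [lintegral_indicator_one (measurableSet_lt measurable_const h3),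
                Set.indicator_of_mem (by exact h), Pi.one_apply,
              one_mul]
            exact hT _
      _ ≤ (l + 1 : ℝ≥0∞) ^ 2 * ε * τ := by
          rw [lintegral_mul_const _ (measurable_one.indicator hms), lintegral_indicator_one hms]
          exact mul_le_mul' (measure_not_injective_le hε i) le_rfl
  have h2 : {ω | ∃ i, ¬ Function.Injective (indexTuple (X ω) i) ∧
      T < |κ fun j => D (indexTuple (X ω) i j) ω|} = ⋃ i, {ω | ¬ Function.Injective
        (indexTuple (X ω) i) ∧ T < |κ fun j => D (indexTuple (X ω) i j) ω|} := by
    ext ω; simp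
  rw [h2]
  refine (measure_iUnion_fintype_le _ _).trans ((Finset.sum_le_sum fun i _ => h1 i).trans ?_)
  simp [mul_assoc]

open Classical in
lemma lintegral_card_not_injective_le (hX : Measurable X)
    (hε : ∀ i i' j j', (i, j) ≠ (i', j') →
        P {ω | indexTuple (X ω) i j = indexTuple (X ω) i' j'} ≤ ε) :
    ∫⁻ ω, ((Finset.univ.filter fun i => ¬ Function.Injective (indexTuple (X ω) i)).card : ℝ≥0∞) ∂P
      ≤ n * ((l + 1 : ℝ≥0∞) ^ 2 * ε) := by
  have hms : ∀ i, MeasurableSet {ω | ¬ Function.Injective (indexTuple (X ω) i)} := fun i =>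
    measurableSet_setOf_countable hX fun x => ¬ Function.Injective (indexTuple x i)
  have h1 : ∀ ω, ((Finset.univ.filter fun i =>
      ¬ Function.Injective (indexTuple (X ω) i)).card : ℝ≥0∞)
      = ∑ i, {ω | ¬ Function.Injective (indexTuple (X ω) i)}.indicator 1 ω := fun ω => by
    simp [Set.indicator_apply, Finset.sum_ite]
  simp only [h1]
  rw [lintegral_finsetSum _ fun i _ => measurable_one.indicator (hms i)]
  simp only [lintegral_indicator_one (hms _)]
  refine (Finset.sum_le_sum fun i _ => measure_not_injective_le hε i).trans ?_
  simp

/-- Tail bound for a resampled sum: the first term of the bound comes from the subjects with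
distinct indices, the second from large terms and the last from many small terms among the other
subjects. -/
lemma IsIIDSequence.measure_le_abs_sum_kernel_le (hD : IsIIDSequence P D μ) (hm : Measurable κ)
    (hκ : MemLp κ 2 (Measure.pi fun _ => μ)) (h0 : ∫ z, κ z ∂(Measure.pi fun _ => μ) = 0)
    (hn : 0 < n) (hX : Measurable X) (hXD : IndepFun X (fun ω i => D i ω) P)
    (hε : ∀ i i' j j', (i, j) ≠ (i', j') →
        P {ω | indexTuple (X ω) i j = indexTuple (X ω) i' j'} ≤ ε)
    {T η : ℝ} (hη : 0 < η) (hT0 : 0 < T) {τ : ℝ≥0∞}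
    (hT : ∀ k : Fin (l + 1) → ℕ, P {ω | T < |κ fun j => D (k j) ω|} ≤ τ) :
    P {ω | η ≤ |(√(n : ℝ))⁻¹ * ∑ i, κ fun j => D (indexTuple (X ω) i j) ω|}
      ≤ ENNReal.ofReal (4 * (∫ z, κ z ^ 2 ∂(Measure.pi fun _ => μ)) / η ^ 2)
          * (1 + n * ((l + 1 : ℝ≥0∞) ^ 2 * ε))
        + n * ((l + 1 : ℝ≥0∞) ^ 2 * ε) * τ
        + n * ((l + 1 : ℝ≥0∞) ^ 2 * ε) * ENNReal.ofReal (2 * T / η * (√(n : ℝ))⁻¹) := by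
  classical
  have hDm : Measurable fun ω i => D i ω := measurable_pi_iff.2 hD.measurable
  have hn' : (0 : ℝ) < n := by exact_mod_cast hn
  have hsq : 0 < √(n : ℝ) := Real.sqrt_pos.2 hn'
  have hv : 0 ≤ ∫ z, κ z ^ 2 ∂(Measure.pi fun _ => μ) := integral_nonneg fun _ => sq_nonneg _
  set v := ∫ z, κ z ^ 2 ∂(Measure.pi fun _ => μ)
  set good : Ω → ℝ := fun ω => ∑ i with Function.Injective (indexTuple (X ω) i),
    κ fun j => D (indexTuple (X ω) i j) ω with hgood
  set N : Ω → ℕ := fun ω => (Finset.univ.filter fun i =>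
    ¬ Function.Injective (indexTuple (X ω) i)).card with hN
  have hsub : {ω | η ≤ |(√(n : ℝ))⁻¹ * ∑ i, κ fun j => D (indexTuple (X ω) i j) ω|}
      ⊆ ({ω | ENNReal.ofReal (η ^ 2 / 4 * n) ≤ ENNReal.ofReal (good ω ^ 2)} ∪
        {ω | ∃ i, ¬ Function.Injective (indexTuple (X ω) i) ∧
          T < |κ fun j => D (indexTuple (X ω) i j) ω|}) ∪
        {ω | ENNReal.ofReal (η * √(n : ℝ) / (2 * T)) ≤ (N ω : ℝ≥0∞)} := by
    intro ω hω
    by_contra hcon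
    simp only [Set.mem_union, Set.mem_ofPred_eq, not_or, not_le, not_exists, not_and, not_lt] at hcon
    obtain ⟨⟨h1, h2⟩, h3⟩ := hcon
    rw [ENNReal.ofReal_lt_ofReal_iff (by positivity)] at h1
    rw [← ENNReal.ofReal_natCast, ENNReal.ofReal_lt_ofReal_iff (by positivity),
      lt_div_iff₀ (by positivity)] at h3
    have h4 : |good ω| < η / 2 * √(n : ℝ) := by
      refine abs_lt_of_sq_lt_sq ?_ (by positivity)
      rw [mul_pow, Real.sq_sqrt hn'.le]
      linarith
    have h5 : |∑ i with ¬ Function.Injective (indexTuple (X ω) i),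
        κ fun j => D (indexTuple (X ω) i j) ω| ≤ N ω * T := by
      refine (Finset.abs_sum_le_sum_abs _ _).trans
        ((Finset.sum_le_sum fun i hi => h2 i (Finset.mem_filter.1 hi).2).trans ?_)
      simp [hN]
    have h6 : |∑ i, κ fun j => D (indexTuple (X ω) i j) ω| < η * √(n : ℝ) := by
      rw [← Finset.sum_filter_add_sum_filter_not _
        fun i => Function.Injective (indexTuple (X ω) i)]
      refine (abs_add_le _ _).trans_lt ?_
      have : |good ω| + N ω * T < η * √(n : ℝ) := by linarith
      exact (add_le_add le_rfl h5).trans_lt this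
    have h7 : η ≤ |(√(n : ℝ))⁻¹ * ∑ i, κ fun j => D (indexTuple (X ω) i j) ω| := hω
    rw [abs_mul, abs_of_pos (inv_pos.2 hsq), inv_mul_eq_div, le_div_iff₀ hsq] at h7
    exact absurd h7 (not_le.2 h6)
  refine (measure_mono hsub).trans ((measure_union_le _ _).trans
    (add_le_add ((measure_union_le _ _).trans (add_le_add ?_ ?_)) ?_))
  · have hgm : Measurable good := (measurable_sum_injective hm).comp (hX.prodMk hDm)
    have hpos : 0 < η ^ 2 / 4 * n := by positivity
    refine (meas_ge_le_lintegral_div (ENNReal.measurable_ofReal.comp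
      (hgm.pow_const 2)).aemeasurable (ENNReal.ofReal_pos.2 hpos).ne' ENNReal.ofReal_ne_top).trans ?_
    refine (ENNReal.div_le_div_right
      (hD.lintegral_sq_sum_injective_le hm hκ h0 hX hXD hε) _).trans (le_of_eq ?_)
    have h1 : (n : ℝ≥0∞) + n * (n * ((l + 1 : ℝ≥0∞) ^ 2 * ε))
        = ENNReal.ofReal n * (1 + n * ((l + 1 : ℝ≥0∞) ^ 2 * ε)) := by
      rw [ENNReal.ofReal_natCast]; ring
    rw [h1, ← mul_assoc, ← ENNReal.ofReal_mul hv, ENNReal.div_eq_inv_mul, ← mul_assoc,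
      ← ENNReal.ofReal_inv_of_pos hpos, ← ENNReal.ofReal_mul (by positivity)]
    congr 2
    field_simp
  · exact hD.measure_exists_not_injective_le hm hX hXD hε hT
  · have hNm : Measurable fun ω => (N ω : ℝ≥0∞) :=
      (measurable_of_countable fun x : Fin n → Fin l → ℕ => ((Finset.univ.filter fun i =>
        ¬ Function.Injective (indexTuple x i)).card : ℝ≥0∞)).comp hX
    have hpos : 0 < η * √(n : ℝ) / (2 * T) := by positivity
    refine (meas_ge_le_lintegral_div hNm.aemeasurable (ENNReal.ofReal_pos.2 hpos).ne'
      ENNReal.ofReal_ne_top).trans ?_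
    refine (ENNReal.div_le_div_right (lintegral_card_not_injective_le hX hε) _).trans (le_of_eq ?_)
    rw [ENNReal.div_eq_inv_mul, mul_comm, ← ENNReal.ofReal_inv_of_pos hpos]
    congr 2
    field_simp

end

section

variable {Ω E A : Type*} [MeasurableSpace Ω] [MeasurableSpace E] [Fintype A] {P : Measure Ω}
  [IsProbabilityMeasure P] {D : ℕ → Ω → E} {μ : Measure E} {m : ℕ → ℕ} {r : A → ℕ}
  {J : (n : ℕ) → (a : A) → Fin n → Fin (r a) → Ω → ℕ}

lemma IsUniformResampling.measure_index_eq_le (hJ : IsUniformResampling P D m r J) {n : ℕ}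
    (hn : 0 < m n) (a : A) (i : Fin n) (j : Fin (r a)) (k : ℕ) :
    P {ω | J n a i j ω = k} ≤ (m n : ℝ≥0∞)⁻¹ := by
  by_cases hk : k < m n
  · exact (hJ.uniform n hn a i j k hk).le
  · have h1 : P {ω | J n a i j ω = k} = P.map (J n a i j) {k} :=
      (Measure.map_apply (hJ.measurable n a i j) (measurableSet_singleton k)).symm
    rw [h1, hJ.map_index hn, empirical]
    simp only [Measure.smul_apply, Measure.finsetSum_apply, smul_eq_mul]
    rw [Finset.sum_eq_zero fun k' _ => ?_]
    · simp
    · rw [Measure.dirac_apply' _ (measurableSet_singleton k), Set.indicator_of_notMem]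
      simp only [Set.mem_singleton_iff]
      have := k'.2
      lia

lemma IsUniformResampling.measure_indexTuple_eq_le (hJ : IsUniformResampling P D m r J) {n : ℕ}
    (hn : 0 < m n) (a : A) (i i' : Fin n) (j j' : Fin (r a + 1)) (h : (i, j) ≠ (i', j')) :
    P {ω | indexTuple (fun i j => J n a i j ω) i j = indexTuple (fun i j => J n a i j ω) i' j'}
      ≤ (m n : ℝ≥0∞)⁻¹ := by
  induction j using Fin.cases with
  | zero =>
    induction j' using Fin.cases with
    | zero =>
      have h1 : (i : ℕ) ≠ i' := fun h' => h (by rw [Fin.ext h'])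
      simp [indexTuple, h1]
    | succ j' =>
      simp only [indexTuple, Fin.cons_zero, Fin.cons_succ, eq_comm (a := (i : ℕ))]
      exact hJ.measure_index_eq_le hn a i' j' i
  | succ j =>
    induction j' using Fin.cases with
    | zero =>
      simp only [indexTuple, Fin.cons_zero, Fin.cons_succ]
      exact hJ.measure_index_eq_le hn a i j i'
    | succ j' =>
      simp only [indexTuple, Fin.cons_succ]
      have hne : (⟨(a, i), j⟩ : Σ s : A × Fin n, Fin (r s.1)) ≠ ⟨(a, i'), j'⟩ := by
        intro h'
        apply h
        simp only [Sigma.mk.injEq, Prod.mk.injEq, true_and] at h'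
        obtain ⟨rfl, h2⟩ := h'
        rw [eq_of_heq h2]
      have hind := (hJ.indep n hn).indepFun hne
      set s : Set (ℕ × ℕ) := {p | p.1 = p.2}
      have hs : MeasurableSet s := s.to_countable.measurableSet
      have hm := hJ.measurable n a i j
      have hm' := hJ.measurable n a i' j'
      calc P {ω | J n a i j ω = J n a i' j' ω}
          = ∫⁻ ω, s.indicator 1 (J n a i j ω, J n a i' j' ω) ∂P :=
            (lintegral_indicator_one ((hm.prodMk hm') hs)).symm
        _ = ∫⁻ ω', ∫⁻ ω, s.indicator 1 (J n a i j ω', J n a i' j' ω) ∂P ∂P :=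
            lintegral_indepFun_eq hm hm' hind (measurable_one.indicator hs)
        _ ≤ ∫⁻ _, (m n : ℝ≥0∞)⁻¹ ∂P := by
            refine lintegral_mono fun ω' => ?_
            refine le_trans (le_of_eq ?_) (hJ.measure_index_eq_le hn a i' j' (J n a i j ω'))
            have h1 : MeasurableSet {ω | J n a i' j' ω = J n a i j ω'} :=
              hm' (measurableSet_singleton (J n a i j ω'))
            rw [← lintegral_indicator_one h1]
            simp [s, Set.indicator_apply, eq_comm]
        _ = (m n : ℝ≥0∞)⁻¹ := by simp

lemma eventually_mul_inv_le {c : ℝ} (hm : Tendsto m atTop atTop)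
    (hc : Tendsto (fun n : ℕ => (n : ℝ) / (m n : ℝ)) atTop (𝓝 c)) :
    ∀ᶠ n : ℕ in atTop, (n : ℝ≥0∞) * (m n : ℝ≥0∞)⁻¹ ≤ ENNReal.ofReal (c + 1) := by
  filter_upwards [(tendsto_order.1 hc).2 (c + 1) (by linarith), hm.eventually_gt_atTop 0]
    with n hn hmn
  have : (0 : ℝ) < m n := by exact_mod_cast hmn
  rw [← div_eq_mul_inv, ← ENNReal.ofReal_natCast n, ← ENNReal.ofReal_natCast (m n),
    ← ENNReal.ofReal_div_of_pos this]
  exact ENNReal.ofReal_le_ofReal hn.le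

/-- Tail bound for the sum over a single replication. -/
lemma IsUniformResampling.eventually_measure_replication_le (hJ : IsUniformResampling P D m r J)
    (hD : IsIIDSequence P D μ) {c : ℝ} (hm : Tendsto m atTop atTop)
    (hc : Tendsto (fun n : ℕ => (n : ℝ) / (m n : ℝ)) atTop (𝓝 c)) (a : A)
    {κ : (Fin (r a + 1) → E) → ℝ} (hκm : Measurable κ)
    (hκ : MemLp κ 2 (Measure.pi fun _ => μ)) (h0 : ∫ z, κ z ∂(Measure.pi fun _ => μ) = 0)
    {η : ℝ} (hη : 0 < η) {δ : ℝ≥0∞} (hδ : δ ≠ 0) :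
    ∀ᶠ n : ℕ in atTop, P {ω | η ≤ |(√(n : ℝ))⁻¹ * ∑ i : Fin n,
        κ (kernelArg (fun i => D i ω) i fun j => J n a i j ω)|}
      ≤ ENNReal.ofReal (4 * (∫ z, κ z ^ 2 ∂(Measure.pi fun _ => μ)) / η ^ 2)
          * (1 + (r a + 1 : ℝ≥0∞) ^ 2 * ENNReal.ofReal (c + 1)) + δ := by
  set C : ℝ≥0∞ := (r a + 1 : ℝ≥0∞) ^ 2 * ENNReal.ofReal (c + 1) with hC
  have hCt : C ≠ ∞ := ENNReal.mul_ne_top (by finiteness) ENNReal.ofReal_ne_top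
  obtain ⟨τ, hτ0, hτ⟩ : ∃ τ : ℝ≥0∞, τ ≠ 0 ∧ C * τ ≤ δ / 2 := by
    have h1 : Tendsto (fun τ : ℝ≥0∞ => C * τ) (𝓝 0) (𝓝 (C * 0)) :=
      ENNReal.Tendsto.const_mul tendsto_id (Or.inr hCt)
    rw [mul_zero] at h1
    have h2 := (tendsto_order.1 h1).2 (δ / 2) (ENNReal.half_pos hδ)
    obtain ⟨τ, hτ, hτ'⟩ := ((h2.filter_mono nhdsWithin_le_nhds).and
      (self_mem_nhdsWithin (s := Set.Ioi (0 : ℝ≥0∞)))).exists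
    exact ⟨τ, (ne_of_gt hτ'), hτ.le⟩
  obtain ⟨T, hT0, hT⟩ := hD.exists_tail_le hκm hτ0
  have hsmall : Tendsto (fun n : ℕ =>
      C * ENNReal.ofReal (2 * T / η * (√(n : ℝ))⁻¹)) atTop (𝓝 0) := by
    have h1 : Tendsto (fun n : ℕ => (√(n : ℝ))⁻¹) atTop (𝓝 0) :=
      tendsto_inv_atTop_zero.comp (Real.tendsto_sqrt_atTop.comp tendsto_natCast_atTop_atTop)
    have h2 := ENNReal.Tendsto.const_mul (a := C)
      (ENNReal.tendsto_ofReal (h1.const_mul (2 * T / η))) (Or.inr hCt)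
    simpa using h2
  filter_upwards [eventually_mul_inv_le hm hc, eventually_gt_atTop 0, hm.eventually_gt_atTop 0,
    (tendsto_order.1 hsmall).2 _ (ENNReal.half_pos hδ)] with n hR hn hmn hs
  have hX : Measurable fun ω (i : Fin n) j => J n a i j ω :=
    measurable_pi_iff.2 fun i => measurable_pi_iff.2 fun j => hJ.measurable n a i j
  have hXD : IndepFun (fun ω (i : Fin n) j => J n a i j ω) (fun ω i => D i ω) P :=
    (hJ.indep_data n hmn).comp
      (φ := fun (x : (Σ s : A × Fin n, Fin (r s.1)) → ℕ) (i : Fin n) (j : Fin (r a)) =>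
        x ⟨(a, i), j⟩) (measurable_pi_iff.2 fun i => measurable_pi_iff.2 fun j =>
          measurable_pi_apply _) measurable_id
  have key := hD.measure_le_abs_sum_kernel_le hκm hκ h0 hn hX hXD
    (hJ.measure_indexTuple_eq_le hmn a) hη hT0 hT
  have hρ : (n : ℝ≥0∞) * ((r a + 1 : ℝ≥0∞) ^ 2 * (m n : ℝ≥0∞)⁻¹) ≤ C := by
    rw [hC, mul_left_comm]
    exact mul_le_mul' le_rfl hR
  simp only [kernelArg_eq]
  refine key.trans ?_
  rw [add_assoc]
  refine add_le_add (mul_le_mul' le_rfl (add_le_add le_rfl hρ)) ?_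
  calc _ ≤ C * τ + C * ENNReal.ofReal (2 * T / η * (√(n : ℝ))⁻¹) :=
        add_le_add (mul_le_mul' hρ le_rfl) (mul_le_mul' hρ le_rfl)
    _ ≤ δ / 2 + δ / 2 := add_le_add hτ hs.le
    _ = δ := ENNReal.add_halves δ

/-- **Tail bound** for resampled sums of centred square-integrable kernels, with a constant that
does not depend on the kernels. -/
lemma IsUniformResampling.exists_tail_bound (hJ : IsUniformResampling P D m r J)
    (hD : IsIIDSequence P D μ) {c : ℝ} (hm : Tendsto m atTop atTop)
    (hc : Tendsto (fun n : ℕ => (n : ℝ) / (m n : ℝ)) atTop (𝓝 c)) :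
    ∃ C : ℝ, 0 ≤ C ∧ ∀ κ : (a : A) → (Fin (r a + 1) → E) → ℝ, (∀ a, Measurable (κ a)) →
      (∀ a, MemLp (κ a) 2 (Measure.pi fun _ => μ)) →
      (∀ a, ∫ z, κ a z ∂(Measure.pi fun _ => μ) = 0) → ∀ η > 0, ∀ δ > 0,
      ∀ᶠ n : ℕ in atTop, P.real {ω | η ≤ |resampledSum D J κ n ω|}
        ≤ C * (∑ a, ∫ z, κ a z ^ 2 ∂(Measure.pi fun _ => μ)) / η ^ 2 + δ := by
  set M : ℝ := Fintype.card A + 1 with hM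
  have hM0 : 0 < M := by positivity
  set K : A → ℝ := fun a => 1 + (r a + 1) ^ 2 * max (c + 1) 0 with hK
  have hK0 : ∀ a, 0 ≤ K a := fun a => by positivity
  refine ⟨4 * M ^ 2 * ∑ a, K a, by positivity, fun κ hκm hκ h0 η hη δ hδ => ?_⟩
  set v : A → ℝ := fun a => ∫ z, κ a z ^ 2 ∂(Measure.pi fun _ => μ) with hv
  have hv0 : ∀ a, 0 ≤ v a := fun a => integral_nonneg fun _ => sq_nonneg _
  have h1 := fun a => hJ.eventually_measure_replication_le hD hm hc a (hκm a) (hκ a) (h0 a)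
    (div_pos hη hM0) (δ := ENNReal.ofReal (δ / M)) (by
      simpa using div_pos hδ hM0)
  filter_upwards [eventually_all.2 h1] with n hn
  set S : A → Ω → ℝ := fun a ω => (√(n : ℝ))⁻¹ * ∑ i : Fin n,
    κ a (kernelArg (fun i => D i ω) i fun j => J n a i j ω) with hS
  have hsum : ∀ ω, resampledSum D J κ n ω = ∑ a, S a ω := fun ω => by
    rw [resampledSum, Fintype.sum_prod_type, Finset.mul_sum]
  have hsub : {ω | η ≤ |resampledSum D J κ n ω|} ⊆ ⋃ a, {ω | η / M ≤ |S a ω|} := by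
    intro ω hω
    by_contra hcon
    simp only [Set.mem_iUnion, Set.mem_ofPred_eq, not_exists, not_le] at hcon
    have h2 : η ≤ |∑ a, S a ω| := by rw [← hsum]; exact hω
    have h3 : |∑ a, S a ω| ≤ Fintype.card A * (η / M) := by
      refine (Finset.abs_sum_le_sum_abs _ _).trans
        ((Finset.sum_le_sum fun a _ => (hcon a).le).trans ?_)
      simp
    have h4 : (Fintype.card A : ℝ) * (η / M) < η := by
      rw [mul_div_assoc', div_lt_iff₀ hM0, hM]
      linarith
    linarith
  have hone : ∀ a, P.real {ω | η / M ≤ |S a ω|} ≤ 4 * v a / (η / M) ^ 2 * K a + δ / M := by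
    intro a
    have hKa : 1 + (r a + 1 : ℝ≥0∞) ^ 2 * ENNReal.ofReal (c + 1) = ENNReal.ofReal (K a) := by
      have h2 : ENNReal.ofReal (c + 1) = ENNReal.ofReal (max (c + 1) 0) := by
        rcases le_total (c + 1) 0 with h | h
        · rw [max_eq_right h, ENNReal.ofReal_of_nonpos h, ENNReal.ofReal_zero]
        · rw [max_eq_left h]
      rw [hK, h2, ENNReal.ofReal_add zero_le_one (by positivity), ENNReal.ofReal_one,
        ENNReal.ofReal_mul (by positivity), ENNReal.ofReal_pow (by positivity),
        ENNReal.ofReal_add (by positivity) zero_le_one, ENNReal.ofReal_one, ENNReal.ofReal_natCast]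
    have h3 : 0 ≤ 4 * v a / (η / M) ^ 2 := by
      have := hv0 a
      positivity
    have h4 := hn a
    rw [hKa, ← ENNReal.ofReal_mul h3, ← ENNReal.ofReal_add (mul_nonneg h3 (hK0 a))
      (by positivity)] at h4
    exact ENNReal.toReal_le_of_le_ofReal
      (add_nonneg (mul_nonneg h3 (hK0 a)) (by positivity)) h4
  calc P.real {ω | η ≤ |resampledSum D J κ n ω|} ≤ ∑ a, P.real {ω | η / M ≤ |S a ω|} :=
        (measureReal_mono hsub).trans (measureReal_iUnion_fintype_le _)
    _ ≤ ∑ a, (4 * v a / (η / M) ^ 2 * (∑ a, K a) + δ / M) := by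
        refine Finset.sum_le_sum fun a _ => (hone a).trans (add_le_add ?_ le_rfl)
        refine mul_le_mul_of_nonneg_left (Finset.single_le_sum (fun a _ => hK0 a)
          (Finset.mem_univ a)) (by have := hv0 a; positivity)
    _ ≤ 4 * M ^ 2 * (∑ a, K a) * (∑ a, v a) / η ^ 2 + δ := by
        rw [Finset.sum_add_distrib]
        refine add_le_add (le_of_eq ?_) ?_
        · rw [Finset.mul_sum, Finset.sum_div]
          refine Finset.sum_congr rfl fun a _ => ?_
          field_simp
        · simp only [Finset.sum_const, Finset.card_univ, nsmul_eq_mul]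
          rw [mul_div_assoc', div_le_iff₀ hM0, hM]
          linarith

end

/-! ### The central limit theorem for square-integrable kernels -/

/-- Interchange of limits: if `χ n` is approximated, uniformly for large `n`, by sequences with
limits `e N`, then both `e` and `χ` converge, to the same limit. -/
lemma exists_tendsto_of_eventually_approx {F : Type*} [NormedAddCommGroup F] [CompleteSpace F]
    {χ : ℕ → F} {χ' : ℕ → ℕ → F} {e : ℕ → F} (h1 : ∀ N, Tendsto (χ' N) atTop (𝓝 (e N)))
    (h2 : ∀ ε > 0, ∀ᶠ N in atTop, ∀ᶠ n in atTop, ‖χ n - χ' N n‖ ≤ ε) :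
    ∃ x, Tendsto e atTop (𝓝 x) ∧ Tendsto χ atTop (𝓝 x) := by
  have hcau : CauchySeq e := by
    refine Metric.cauchySeq_iff.2 fun ε hε => ?_
    obtain ⟨N₀, hN₀⟩ := eventually_atTop.1 (h2 (ε / 3) (by positivity))
    refine ⟨N₀, fun N hN N' hN' => ?_⟩
    rw [dist_eq_norm]
    have h3 : ‖e N - e N'‖ ≤ ε / 3 + ε / 3 := by
      refine le_of_tendsto ((h1 N).sub (h1 N')).norm ?_
      filter_upwards [hN₀ N hN, hN₀ N' hN'] with n ha hb
      calc ‖χ' N n - χ' N' n‖ = ‖(χ n - χ' N' n) - (χ n - χ' N n)‖ := by congr 1; abel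
        _ ≤ ε / 3 + ε / 3 := (norm_sub_le _ _).trans (add_le_add hb ha)
    linarith
  obtain ⟨x, hx⟩ := cauchySeq_tendsto_of_complete hcau
  refine ⟨x, hx, Metric.tendsto_nhds.2 fun ε hε => ?_⟩
  obtain ⟨N, hN, hN'⟩ := ((h2 (ε / 4) (by positivity)).and
    (Metric.tendsto_nhds.1 hx (ε / 4) (by positivity))).exists
  filter_upwards [hN, Metric.tendsto_nhds.1 (h1 N) (ε / 4) (by positivity)] with n ha hb
  rw [dist_eq_norm] at hb hN' ⊢
  calc ‖χ n - x‖ = ‖(χ n - χ' N n) + (χ' N n - e N) + (e N - x)‖ := by congr 1; abel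
    _ ≤ ‖χ n - χ' N n‖ + ‖χ' N n - e N‖ + ‖e N - x‖ := norm_add₃_le
    _ < ε := by linarith

/-- A pointwise limit of quadratic forms is a quadratic form. -/
lemma exists_symm_of_tendsto_quadratic {ι : Type*} [Fintype ι] {M : ℕ → ι → ι → ℝ}
    {q : (ι → ℝ) → ℝ}
    (h : ∀ t, Tendsto (fun N => ∑ s, ∑ s', t s * t s' * M N s s') atTop (𝓝 (q t))) :
    ∃ M' : ι → ι → ℝ, (∀ s s', M' s s' = M' s' s) ∧ ∀ t, q t = ∑ s, ∑ s', t s * t s' * M' s s' := by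
  classical
  set Q : ℕ → (ι → ℝ) → ℝ := fun N t => ∑ s, ∑ s', t s * t s' * M N s s' with hQ
  set δ : ι → ι → ℝ := fun s => Pi.single s 1 with hδ
  have hpol : ∀ N s s', M N s s' + M N s' s = Q N (δ s + δ s') - Q N (δ s) - Q N (δ s') := by
    intro N s s'
    have h1 : ∀ a b : ι, ∑ x, ∑ y, δ a x * δ b y * M N x y = M N a b := fun a b => by
      simp [hδ, Pi.single_apply, ite_mul]
    simp only [hQ, Pi.add_apply, add_mul, mul_add, Finset.sum_add_distrib, h1]
    ring
  refine ⟨fun s s' => (q (δ s + δ s') - q (δ s) - q (δ s')) / 2, fun s s' => ?_, fun t => ?_⟩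
  · simp only [add_comm (δ s) (δ s')]; ring
  · refine tendsto_nhds_unique (h t) ?_
    have hsym : ∀ N, ∑ s, ∑ s', t s * t s' * M N s s'
        = ∑ s, ∑ s', t s * t s' * ((Q N (δ s + δ s') - Q N (δ s) - Q N (δ s')) / 2) := by
      intro N
      have h2 : ∑ s, ∑ s', t s * t s' * M N s s' = ∑ s, ∑ s', t s * t s' * M N s' s := by
        rw [Finset.sum_comm]
        exact Finset.sum_congr rfl fun s _ => Finset.sum_congr rfl fun s' _ => by ring
      simp only [← hpol, add_div, mul_add, Finset.sum_add_distrib, mul_div_assoc', ← Finset.sum_div]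
      rw [← h2]
      ring
    simp only [hsym]
    exact tendsto_finsetSum _ fun s _ => tendsto_finsetSum _ fun s' _ =>
      ((((h _).sub (h _)).sub (h _)).div_const 2).const_mul _

lemma norm_integral_cexp_sub_le {Ω : Type*} [MeasurableSpace Ω] {P : Measure Ω}
    [IsProbabilityMeasure P] {X Y : Ω → ℝ} (hX : Measurable X) (hY : Measurable Y) {η : ℝ}
    (hη : 0 ≤ η) :
    ‖∫ ω, Complex.exp ((X ω : ℝ) * Complex.I) ∂P - ∫ ω, Complex.exp ((Y ω : ℝ) * Complex.I) ∂P‖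
      ≤ η + 2 * P.real {ω | η ≤ |X ω - Y ω|} := by
  have hi : ∀ {Z : Ω → ℝ}, Measurable Z →
      Integrable (fun ω => Complex.exp ((Z ω : ℝ) * Complex.I)) P := fun hZ =>
    Integrable.of_bound (by fun_prop) 1 (ae_of_all _ fun ω => by
      rw [Complex.norm_exp_ofReal_mul_I])
  have hs : MeasurableSet {ω | η ≤ |X ω - Y ω|} := measurableSet_le measurable_const (hX.sub hY).abs
  rw [← integral_sub (hi hX) (hi hY)]
  calc _ ≤ ∫ ω, (η + 2 * {ω | η ≤ |X ω - Y ω|}.indicator 1 ω) ∂P := by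
        refine norm_integral_le_of_norm_le ((integrable_const _).add
          (((integrable_const (1 : ℝ)).indicator hs).const_mul 2)) (ae_of_all _ fun ω => ?_)
        by_cases h : η ≤ |X ω - Y ω|
        · rw [Set.indicator_of_mem (by exact h), Pi.one_apply]
          refine (norm_sub_le _ _).trans ?_
          rw [Complex.norm_exp_ofReal_mul_I, Complex.norm_exp_ofReal_mul_I]
          linarith
        · rw [Set.indicator_of_notMem (by exact h), mul_zero, add_zero]
          exact (norm_cexp_ofReal_mul_I_sub_le _ _).trans (not_le.1 h).le
    _ = _ := by
        have h1 : Integrable (fun ω => 2 * {ω | η ≤ |X ω - Y ω|}.indicator (1 : Ω → ℝ) ω) P :=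
          ((integrable_const (1 : ℝ)).indicator hs).const_mul 2
        rw [integral_add (integrable_const _) h1, integral_const_mul, integral_indicator_one hs]
        simp

lemma integral_sq_sum_le {β ι : Type*} [MeasurableSpace β] {ρ : Measure β} [Fintype ι] (t : ι → ℝ)
    {h : ι → β → ℝ} (hh : ∀ s, MemLp (h s) 2 ρ) :
    ∫ x, (∑ s, t s * h s x) ^ 2 ∂ρ ≤ (∑ s, t s ^ 2) * ∑ s, ∫ x, h s x ^ 2 ∂ρ := by
  rw [← integral_finsetSum _ fun s _ => (hh s).integrable_sq, ← integral_const_mul]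
  exact integral_mono_of_nonneg (ae_of_all _ fun x => sq_nonneg _)
    ((integrable_finsetSum _ fun s _ => (hh s).integrable_sq).const_mul _)
    (ae_of_all _ fun x => Finset.sum_mul_sq_le_sq_mul_sq _ _ _)

section

variable {Ω E A : Type*} [MeasurableSpace Ω] [MeasurableSpace E] [Fintype A] {P : Measure Ω}
  [IsProbabilityMeasure P] {D : ℕ → Ω → E} {μ : Measure E} {m : ℕ → ℕ} {r : A → ℕ}
  {J : (n : ℕ) → (a : A) → Fin n → Fin (r a) → Ω → ℕ}

lemma IsUniformResampling.measurable_resampledSum (hJ : IsUniformResampling P D m r J)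
    (hD : IsIIDSequence P D μ) {κ : (a : A) → (Fin (r a + 1) → E) → ℝ}
    (hκ : ∀ a, Measurable (κ a)) (n : ℕ) : Measurable (resampledSum D J κ n) := by
  refine (Finset.measurable_fun_sum _ fun s _ => ?_).const_mul _
  exact (hκ s.1).comp ((measurable_kernelArg (l := r s.1) s.2).comp
    ((measurable_pi_iff.2 fun j => hJ.measurable n s.1 s.2 j).prodMk
      (measurable_pi_iff.2 hD.measurable)))

lemma resampledSum_sub (κ κ' : (a : A) → (Fin (r a + 1) → E) → ℝ) (n : ℕ) (ω : Ω) :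
    resampledSum D J κ n ω - resampledSum D J κ' n ω
      = resampledSum D J (fun a z => κ a z - κ' a z) n ω := by
  simp only [resampledSum, Finset.sum_sub_distrib, mul_sub]

/-- The **central limit theorem** for resampled sums of square-integrable kernels. -/
theorem exists_tendsto_charFun_resampledSum (hD : IsIIDSequence P D μ) {c : ℝ}
    (hm : Tendsto m atTop atTop)
    (hc : Tendsto (fun n : ℕ => (n : ℝ) / (m n : ℝ)) atTop (𝓝 c))
    (hJ : IsUniformResampling P D m r J) {ι : Type*} [Fintype ι]
    {κ : ι → (a : A) → (Fin (r a + 1) → E) → ℝ} (hκm : ∀ s a, Measurable (κ s a))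
    (hκ : ∀ s a, MemLp (κ s a) 2 (Measure.pi fun _ => μ))
    (h0 : ∀ s a, ∫ z, κ s a z ∂(Measure.pi fun _ => μ) = 0) :
    ∃ M : ι → ι → ℝ, (∀ s s', M s s' = M s' s) ∧ ∀ t : ι → ℝ,
      0 ≤ ∑ s, ∑ s', t s * t s' * M s s' ∧
      Tendsto (fun n => ∫ ω, Complex.exp
        ((resampledSum D J (fun a z => ∑ s, t s * κ s a z) n ω : ℝ) * Complex.I) ∂P) atTop
        (𝓝 (Complex.exp ((-(∑ s, ∑ s', t s * t s' * M s s') / 2 : ℝ)))) := by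
  have := hD.isProbabilityMeasure
  obtain ⟨C, hC0, hC⟩ := hJ.exists_tail_bound hD hm hc
  -- approximation by product kernels
  choose κ' hκ' h0' happ using fun (N : ℕ) s a => exists_centred_productKernel_approx _ (hκ s a)
    (h0 s a) (Nat.one_div_pos_of_nat (α := ℝ) (n := N))
  have hb := fun N s a => isBddMeas_of_mem_productKernels (hκ' N s a)
  have hbL : ∀ N s a, MemLp (κ' N s a) 2 (Measure.pi fun _ => μ) :=
      fun N s a => (hb N s a).memLp _ _
  choose M hM using fun N => exists_matrix_tendsto_charFun_productKernels hD hm hc hJ (hκ' N) (h0' N)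
  set q : ℕ → (ι → ℝ) → ℝ := fun N t => ∑ s, ∑ s', t s * t s' * M N s s' with hq
  set χ : (ι → ℝ) → ℕ → ℂ := fun t n => ∫ ω, Complex.exp
    ((resampledSum D J (fun a z => ∑ s, t s * κ s a z) n ω : ℝ) * Complex.I) ∂P with hχ
  set χ' : (ι → ℝ) → ℕ → ℕ → ℂ := fun t N n => ∫ ω, Complex.exp
    ((resampledSum D J (fun a z => ∑ s, t s * κ' N s a z) n ω : ℝ) * Complex.I) ∂P with hχ'
  have hsumm : ∀ {h : ι → (a : A) → (Fin (r a + 1) → E) → ℝ}, (∀ s a, Measurable (h s a)) →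
      ∀ t : ι → ℝ, ∀ a, Measurable fun z => ∑ s, t s * h s a z := fun hh t a =>
    Finset.measurable_fun_sum _ fun s _ => (hh s a).const_mul _
  have hsumL : ∀ {h : ι → (a : A) → (Fin (r a + 1) → E) → ℝ},
      (∀ s a, MemLp (h s a) 2 (Measure.pi fun _ => μ)) →
      ∀ t : ι → ℝ, ∀ a, MemLp (fun z => ∑ s, t s * h s a z) 2 (Measure.pi fun _ => μ) :=
    fun hh t a => memLp_finsetSum _ fun s _ => (hh s a).const_mul _
  have hsum0 : ∀ {h : ι → (a : A) → (Fin (r a + 1) → E) → ℝ},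
      (∀ s a, MemLp (h s a) 2 (Measure.pi fun _ => μ)) →
      (∀ s a, ∫ z, h s a z ∂(Measure.pi fun _ => μ) = 0) →
      ∀ t : ι → ℝ, ∀ a, ∫ z, ∑ s, t s * h s a z ∂(Measure.pi fun _ => μ) = 0 := fun hh h0 t a => by
    rw [integral_finsetSum _ fun s _ => ((hh s a).integrable one_le_two).const_mul _]
    simp [integral_const_mul, h0]
  have happrox : ∀ t, ∀ ε > 0, ∀ᶠ N in atTop, ∀ᶠ n in atTop, ‖χ t n - χ' t N n‖ ≤ ε := by
    intro t ε hε
    set K : ℝ := C * ((∑ s, t s ^ 2) * (Fintype.card A * Fintype.card ι)) / (ε / 2) ^ 2 with hK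
    have hK0 : Tendsto (fun N : ℕ => K * (1 / ((N : ℝ) + 1))) atTop (𝓝 0) := by
      simpa using tendsto_one_div_add_atTop_nhds_zero_nat.const_mul K
    filter_upwards [(tendsto_order.1 hK0).2 (ε / 8) (by positivity)] with N hN
    have hdL : ∀ s a, MemLp (fun z => κ s a z - κ' N s a z) 2 (Measure.pi fun _ => μ) :=
      fun s a => (hκ s a).sub (hbL N s a)
    have hdm : ∀ s a, Measurable fun z => κ s a z - κ' N s a z :=
      fun s a => (hκm s a).sub (hb N s a).1
    have hd0 : ∀ s a, ∫ z, κ s a z - κ' N s a z ∂(Measure.pi fun _ => μ) = 0 := fun s a => by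
      rw [integral_sub ((hκ s a).integrable one_le_two) ((hbL N s a).integrable one_le_two),
          h0, h0',
        sub_zero]
    have h1 := hC _ (hsumm hdm t) (hsumL hdL t) (hsum0 hdL hd0 t) (ε / 2) (by positivity) (ε / 8)
      (by positivity)
    filter_upwards [h1] with n hn
    have h2 := norm_integral_cexp_sub_le (P := P)
      (hJ.measurable_resampledSum hD (hsumm hκm t) n)
      (hJ.measurable_resampledSum hD (hsumm (fun s a => (hb N s a).1) t) n)
      (by positivity : 0 ≤ ε / 2)
    simp only [resampledSum_sub, ← Finset.sum_sub_distrib, ← mul_sub] at h2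
    refine h2.trans ?_
    have h3 : ∑ a, ∫ z, (∑ s, t s * (κ s a z - κ' N s a z)) ^ 2 ∂(Measure.pi fun _ => μ)
        ≤ (∑ s, t s ^ 2) * (Fintype.card A * Fintype.card ι) * (1 / ((N : ℝ) + 1)) := by
      calc _ ≤ ∑ a : A, (∑ s, t s ^ 2) * ∑ s : ι, 1 / ((N : ℝ) + 1) := by
            refine Finset.sum_le_sum fun a _ => (integral_sq_sum_le t fun s => hdL s a).trans ?_
            exact mul_le_mul_of_nonneg_left (Finset.sum_le_sum fun s _ => happ N s a)
              (Finset.sum_nonneg fun s _ => sq_nonneg _)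
        _ = _ := by simp; ring
    have h4 : C * (∑ a, ∫ z, (∑ s, t s * (κ s a z - κ' N s a z)) ^ 2 ∂(Measure.pi fun _ => μ))
        / (ε / 2) ^ 2 ≤ K * (1 / ((N : ℝ) + 1)) := by
      rw [hK, div_mul_eq_mul_div, mul_assoc C]
      gcongr
    linarith
  choose e he hχe using fun t => exists_tendsto_of_eventually_approx (fun N => hM N t) (happrox t)
  -- the quadratic forms are bounded, because the tail bound is uniform in the kernels
  set W : ℝ := ∑ a, ∑ s, (2 * ∫ z, κ s a z ^ 2 ∂(Measure.pi fun _ => μ) + 2) with hW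
  have hW0 : 0 ≤ W := Finset.sum_nonneg fun a _ => Finset.sum_nonneg fun s _ => by
    have : 0 ≤ ∫ z, κ s a z ^ 2 ∂(Measure.pi fun _ => μ) := integral_nonneg fun _ => sq_nonneg _
    linarith
  have hWN : ∀ N, ∑ a, ∑ s, ∫ z, κ' N s a z ^ 2 ∂(Measure.pi fun _ => μ) ≤ W := by
    intro N
    refine Finset.sum_le_sum fun a _ => Finset.sum_le_sum fun s _ => ?_
    have hi := (hκ s a).integrable_sq.const_mul 2
    have hi' := ((hκ s a).sub (hbL N s a)).integrable_sq.const_mul 2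
    have h1 : (1 : ℝ) / ((N : ℝ) + 1) ≤ 1 := by
      rw [div_le_one (by positivity)]
      linarith [Nat.cast_nonneg (α := ℝ) N]
    calc ∫ z, κ' N s a z ^ 2 ∂(Measure.pi fun _ => μ)
        ≤ ∫ z, (2 * κ s a z ^ 2 + 2 * (κ s a - κ' N s a) z ^ 2) ∂(Measure.pi fun _ => μ) := by
          refine integral_mono (hbL N s a).integrable_sq (hi.add hi') fun z => ?_
          simp only [Pi.sub_apply]
          nlinarith [sq_nonneg (2 * κ s a z - κ' N s a z)]
      _ = 2 * ∫ z, κ s a z ^ 2 ∂(Measure.pi fun _ => μ)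
          + 2 * ∫ z, (κ s a z - κ' N s a z) ^ 2 ∂(Measure.pi fun _ => μ) := by
          rw [integral_add hi hi', integral_const_mul, integral_const_mul]
          rfl
      _ ≤ _ := by
          have := happ N s a
          linarith
  have hqb : ∀ t, ∃ b : ℝ, ∀ N, q N t ≤ b := by
    intro t
    -- the scale `ρ` is so small that, by the tail bound, the characteristic functions of the
    -- approximating sums at `ρ t` are within `1 / 2` of `1`, which bounds the variance `q N (ρ t)`
    set G : ℝ := C * ((∑ s, t s ^ 2) * W) with hG
    have hG0 : 0 ≤ G := mul_nonneg hC0 (mul_nonneg (Finset.sum_nonneg fun s _ => sq_nonneg _) hW0)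
    set ρ : ℝ := 1 / (16 * (G + 1)) with hρ
    have hρ0 : 0 < ρ := by positivity
    have hGρ : G * ρ ^ 2 / (1 / 4) ^ 2 ≤ 1 / 16 := by
      have h2 : G * ρ ^ 2 = G / (256 * (G + 1) ^ 2) := by rw [hρ]; field_simp; norm_num
      rw [h2, div_div, div_le_div_iff₀ (by positivity) (by norm_num)]
      nlinarith
    refine ⟨2 * Real.log 2 / ρ ^ 2, fun N => ?_⟩
    have hhom : q N (fun s => ρ * t s) = ρ ^ 2 * q N t := by
      simp only [hq, Finset.mul_sum]
      exact Finset.sum_congr rfl fun s _ => Finset.sum_congr rfl fun s' _ => by ring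
    have h1 := hC _ (hsumm (fun s a => (hb N s a).1) fun s => ρ * t s)
      (hsumL (hbL N) fun s => ρ * t s) (hsum0 (hbL N) (h0' N) fun s =>
          ρ * t s) (1 / 4) (by norm_num)
      (1 / 16) (by norm_num)
    have h3 : ∑ a, ∫ z, (∑ s, ρ * t s * κ' N s a z) ^ 2 ∂(Measure.pi fun _ => μ)
        ≤ ρ ^ 2 * ((∑ s, t s ^ 2) * W) := by
      calc _ ≤ ∑ a : A, (∑ s, (ρ * t s) ^ 2) * ∑ s, ∫ z, κ' N s a z ^ 2 ∂(Measure.pi fun _ => μ) :=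
            Finset.sum_le_sum fun a _ => integral_sq_sum_le _ fun s => hbL N s a
        _ = ρ ^ 2 * ((∑ s, t s ^ 2) * ∑ a, ∑ s, ∫ z, κ' N s a z ^ 2 ∂(Measure.pi fun _ => μ)) := by
            rw [← Finset.mul_sum]
            simp only [mul_pow, ← Finset.mul_sum]
            ring
        _ ≤ _ := by
            have : 0 ≤ ∑ s, t s ^ 2 := Finset.sum_nonneg fun s _ => sq_nonneg _
            have := hWN N
            gcongr
    have h4 : ‖Complex.exp ((-(q N fun s => ρ * t s) / 2 : ℝ)) - 1‖ ≤ 1 / 2 := by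
      refine le_of_tendsto ((hM N fun s => ρ * t s).sub_const 1).norm ?_
      filter_upwards [h1] with n hn
      have h2 := norm_integral_cexp_sub_le (P := P)
        (hJ.measurable_resampledSum hD (hsumm (fun s a => (hb N s a).1) fun s => ρ * t s) n)
        (measurable_const (a := (0 : ℝ))) (by norm_num : (0 : ℝ) ≤ 1 / 4)
      simp only [Complex.ofReal_zero, zero_mul, Complex.exp_zero, integral_const, probReal_univ,
        one_smul, sub_zero] at h2
      refine h2.trans ?_
      have h5 : C * (∑ a, ∫ z, (∑ s, ρ * t s * κ' N s a z) ^ 2 ∂(Measure.pi fun _ => μ))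
          / (1 / 4) ^ 2 ≤ G * ρ ^ 2 / (1 / 4) ^ 2 := by
        rw [hG, mul_assoc C, mul_comm _ (ρ ^ 2)]
        gcongr
      linarith
    rw [hhom, ← Complex.ofReal_exp, ← Complex.ofReal_one, ← Complex.ofReal_sub, Complex.norm_real,
      Real.norm_eq_abs, abs_le] at h4
    have h6 : Real.log (1 / 2) ≤ -(ρ ^ 2 * q N t) / 2 := by
      rw [Real.log_le_iff_le_exp (by norm_num)]
      linarith [h4.1]
    rw [one_div, Real.log_inv] at h6
    rw [le_div_iff₀ (by positivity)]
    linarith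
  have hq0 : ∀ N t, 0 ≤ q N t := by
    intro N t
    have h1 : ‖Complex.exp ((-(q N t) / 2 : ℝ))‖ ≤ 1 := by
      refine le_of_tendsto (hM N t).norm (Eventually.of_forall fun n => ?_)
      refine (norm_integral_le_of_norm_le (integrable_const (1 : ℝ))
        (ae_of_all _ fun ω => ?_)).trans (by simp)
      rw [Complex.norm_exp_ofReal_mul_I]
    rw [← Complex.ofReal_exp, Complex.norm_real, Real.norm_eq_abs, abs_of_pos (Real.exp_pos _),
      Real.exp_le_one_iff] at h1
    linarith
  have hqlim : ∀ t, Tendsto (fun N => q N t) atTop (𝓝 (-2 * Real.log (e t).re)) := by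
    intro t
    have h1 : Tendsto (fun N => Real.exp (-(q N t) / 2)) atTop (𝓝 (e t).re) := by
      have := (Complex.continuous_re.tendsto _).comp (he t)
      refine this.congr fun N => ?_
      change (Complex.exp ((-(q N t) / 2 : ℝ))).re = _
      rw [← Complex.ofReal_exp, Complex.ofReal_re]
    obtain ⟨b, hb⟩ := hqb t
    have hpos : 0 < (e t).re := (Real.exp_pos (-b / 2)).trans_le <|
      ge_of_tendsto h1 (Eventually.of_forall fun N => Real.exp_le_exp.2 (by
        have := hb N
        linarith))
    have h2 := ((Real.continuousAt_log hpos.ne').tendsto.comp h1).const_mul (-2)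
    refine h2.congr fun N => ?_
    simp only [Function.comp_apply, Real.log_exp]
    ring
  obtain ⟨M', hsymm, hM'⟩ := exists_symm_of_tendsto_quadratic hqlim
  refine ⟨M', hsymm, fun t => ⟨?_, ?_⟩⟩
  · rw [← hM']
    exact ge_of_tendsto (hqlim t) (Eventually.of_forall fun N => hq0 N t)
  · rw [← hM']
    have h1 : Tendsto (fun N => Complex.exp ((-(q N t) / 2 : ℝ))) atTop
        (𝓝 (Complex.exp ((-(-2 * Real.log (e t).re) / 2 : ℝ)))) := by
      have hcont : Continuous fun x : ℝ => Complex.exp ((-x / 2 : ℝ)) := by fun_prop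
      exact (hcont.tendsto _).comp (hqlim t)
    rw [tendsto_nhds_unique h1 (he t)]
    exact hχe t

end

/-! ### Least squares fits -/

section

open scoped RealInnerProductSpace

variable {E H F : Type*} [NormedAddCommGroup E] [NormedSpace ℝ E] [FiniteDimensional ℝ E]
  [NormedAddCommGroup H] [InnerProductSpace ℝ H] [FiniteDimensional ℝ H]
  [NormedAddCommGroup F] [NormedSpace ℝ F]

/-- The pseudo-inverse of an injective linear map between Euclidean spaces. -/
lemma exists_pseudoInverse (D : E →L[ℝ] H) (hD : Function.Injective D) :
    ∃ A : H →L[ℝ] E, ∀ z h, ⟪z - D (A z), D h⟫ = 0 := by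
  let V := LinearMap.range (D : E →ₗ[ℝ] H)
  let e := LinearEquiv.ofInjective (D : E →ₗ[ℝ] H) hD
  let A : H →ₗ[ℝ] E := e.symm.toLinearMap ∘ₗ (V.orthogonalProjectionOnto : H →ₗ[ℝ] V)
  refine ⟨LinearMap.toContinuousLinearMap A, fun z h => ?_⟩
  have h1 : D (A z) = (V.orthogonalProjectionOnto z : H) := by
    have := congrArg Subtype.val (e.apply_symm_apply (V.orthogonalProjectionOnto z))
    exact this
  change ⟪z - D (A z), D h⟫ = 0
  rw [h1]
  exact Submodule.inner_left_of_mem_orthogonal (K := V) ⟨h, rfl⟩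
    (Submodule.sub_starProjection_mem_orthogonal z)

/-- Stability of least squares fits: if `g` is closest to `Γ g₀ + ρ z` among the points of `S`,
then `g = g₀ + ρ A z + o(ρ)`, uniformly for bounded `z`, where `A` is the pseudo-inverse of the
derivative. The fit is compared with the candidate `g₀ + ρ A z`. -/
lemma leastSquares_expansion {Γ : E → H} {D : E →L[ℝ] H} {A : H →L[ℝ] E} {S : Set E} {g₀ : E}
    (hS : g₀ ∈ interior S) (hΓ : HasFDerivAt Γ D g₀) (hD : Function.Injective D)
    (hA : ∀ z h, ⟪z - D (A z), D h⟫ = 0)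
    (hid : ∀ ε > 0, ∃ δ > 0, ∀ g ∈ S, ε ≤ ‖g - g₀‖ → δ ≤ ‖Γ g - Γ g₀‖) {R ε : ℝ} (hε : 0 < ε) :
    ∃ ρ₀ > 0, ∀ ρ : ℝ, 0 < ρ → ρ < ρ₀ → ∀ z : H, ‖z‖ ≤ R → ∀ g ∈ S,
      (∀ g' ∈ S, ‖Γ g₀ + ρ • z - Γ g‖ ≤ ‖Γ g₀ + ρ • z - Γ g'‖) → ‖g - g₀ - ρ • A z‖ ≤ ε * ρ := by
  wlog hR : 0 < R generalizing R
  · obtain ⟨ρ₀, h0, h⟩ := this (R := 1) one_pos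
    exact ⟨ρ₀, h0, fun ρ hρ hρ' z hz => h ρ hρ hρ' z (hz.trans ((not_lt.1 hR).trans zero_le_one))⟩
  obtain ⟨K, hK0, hK⟩ : ∃ K : ℝ, 0 < K ∧ ∀ h, ‖h‖ ≤ K * ‖D h‖ := by
    obtain ⟨K, hK0, hK⟩ := (LinearMap.injective_iff_antilipschitz (D : E →ₗ[ℝ] H)).1 hD
    exact ⟨K, hK0, fun h => by simpa using hK.le_mul_norm_sub h 0⟩
  -- the two displacements are at most `C ρ`
  set C : ℝ := 4 * K * R + ‖A‖ * R with hC
  have hC0 : 0 < C := by positivity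
  obtain ⟨η, hη0, hη1, hη2⟩ : ∃ η : ℝ, 0 < η ∧ K * η ≤ 1 / 2 ∧
      K ^ 2 * (2 * R * (η * C) + (η * C) ^ 2) ≤ ε ^ 2 := by
    have h1 : Tendsto (fun η : ℝ => K * η) (𝓝[>] 0) (𝓝 0) := by
      have : Continuous fun η : ℝ => K * η := by fun_prop
      simpa using (this.tendsto 0).mono_left nhdsWithin_le_nhds
    have h2 : Tendsto (fun η : ℝ => K ^ 2 * (2 * R * (η * C) + (η * C) ^ 2)) (𝓝[>] 0) (𝓝 0) := by
      have : Continuous fun η : ℝ => K ^ 2 * (2 * R * (η * C) + (η * C) ^ 2) := by fun_prop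
      simpa using (this.tendsto 0).mono_left nhdsWithin_le_nhds
    obtain ⟨η, ⟨ha, hb⟩, hc⟩ := (((tendsto_order.1 h1).2 (1 / 2) (by norm_num)).and
      ((tendsto_order.1 h2).2 (ε ^ 2) (by positivity))).and self_mem_nhdsWithin |>.exists
    exact ⟨η, hc, ha.le, hb.le⟩
  obtain ⟨r, hr0, hr⟩ : ∃ r > 0, ∀ h : E, ‖h‖ < r →
      ‖Γ (g₀ + h) - Γ g₀ - D h‖ ≤ η * ‖h‖ ∧ g₀ + h ∈ S := by
    have h1 : ∀ᶠ g in 𝓝 g₀, ‖Γ g - Γ g₀ - D (g - g₀)‖ ≤ η * ‖g - g₀‖ :=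
      (hasFDerivAt_iff_isLittleO.1 hΓ).def hη0
    obtain ⟨r, hr0, hr⟩ := Metric.eventually_nhds_iff.1 (h1.and
      (show ∀ᶠ g in 𝓝 g₀, g ∈ S from mem_interior_iff_mem_nhds.1 hS))
    refine ⟨r, hr0, fun h hh => ?_⟩
    have := hr (y := g₀ + h) (by simpa [dist_eq_norm] using hh)
    simpa using this
  obtain ⟨δ, hδ0, hδ⟩ := hid r hr0
  refine ⟨min (δ / (2 * R)) (r / C), lt_min (by positivity) (by positivity),
    fun ρ hρ hρ' z hz g hg hmin => ?_⟩
  have hρδ : 2 * ρ * R < δ := by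
    have := hρ'.trans_le (min_le_left _ _)
    rw [lt_div_iff₀ (by positivity)] at this
    linarith
  have hρr : ρ * C < r := by
    have := hρ'.trans_le (min_le_right _ _)
    rwa [lt_div_iff₀ hC0] at this
  have hz' : ‖ρ • z‖ ≤ ρ * R := by
    rw [norm_smul, Real.norm_of_nonneg hρ.le]
    gcongr
  set h := g - g₀ with hh
  set h' := ρ • A z with hh'
  have hgh : g = g₀ + h := by rw [hh]; abel
  clear_value h h'
  have hdist : ‖Γ g - Γ g₀‖ ≤ 2 * ρ * R := by
    have h1 := hmin g₀ (interior_subset hS)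
    rw [add_sub_cancel_left] at h1
    calc ‖Γ g - Γ g₀‖ = ‖ρ • z - (Γ g₀ + ρ • z - Γ g)‖ := by congr 1; abel
      _ ≤ ‖ρ • z‖ + ‖ρ • z‖ := (norm_sub_le _ _).trans (add_le_add le_rfl h1)
      _ ≤ 2 * ρ * R := by linarith
  have hlt : ‖h‖ < r := by
    by_contra hcon
    rw [hh] at hcon
    exact absurd (hδ g hg (not_lt.1 hcon)) (not_le.2 (hdist.trans_lt hρδ))
  obtain ⟨hrem, -⟩ := hr h hlt
  rw [← hgh] at hrem
  have hhle : ‖h‖ ≤ 4 * K * R * ρ := by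
    have h1 : ‖D h‖ ≤ 2 * ρ * R + η * ‖h‖ := by
      calc ‖D h‖ = ‖(Γ g - Γ g₀) - (Γ g - Γ g₀ - D h)‖ := by congr 1; abel
        _ ≤ _ := (norm_sub_le _ _).trans (add_le_add hdist hrem)
    have h2 := (hK h).trans (mul_le_mul_of_nonneg_left h1 hK0.le)
    nlinarith [mul_le_mul_of_nonneg_right hη1 (norm_nonneg h)]
  have hh'le : ‖h'‖ ≤ ‖A‖ * R * ρ := by
    rw [hh', ← map_smul]
    calc ‖A (ρ • z)‖ ≤ ‖A‖ * (ρ * R) := (A.le_opNorm _).trans (by gcongr)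
      _ = _ := by ring
  have hh'r : ‖h'‖ < r := by
    refine (hh'le.trans ?_).trans_lt hρr
    have : 0 ≤ 4 * K * R * ρ := by positivity
    rw [hC]
    linarith
  obtain ⟨hrem', hS'⟩ := hr h' hh'r
  have hcmp := hmin _ hS'
  have horth : ⟪ρ • z - D h', D (h' - h)⟫ = 0 := by
    have h1 : ρ • z - D h' = ρ • (z - D (A z)) := by rw [hh', map_smul, smul_sub]
    rw [h1, inner_smul_left, hA, mul_zero]
  have hpyth : ‖ρ • z - D h‖ ^ 2 = ‖ρ • z - D h'‖ ^ 2 + ‖D (h' - h)‖ ^ 2 := by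
    have h1 : ρ • z - D h = (ρ • z - D h') + D (h' - h) := by rw [map_sub]; abel
    rw [h1, norm_add_sq_real, horth]
    ring
  have hpyth' : ‖ρ • z - D h'‖ ≤ ρ * R := by
    refine le_trans ?_ hz'
    have h0 : ⟪ρ • z - D h', D h'⟫ = 0 := by
      have h1 : ρ • z - D h' = ρ • (z - D (A z)) := by rw [hh', map_smul, smul_sub]
      rw [h1, inner_smul_left, hA, mul_zero]
    have h1 : ‖ρ • z‖ ^ 2 = ‖ρ • z - D h'‖ ^ 2 + ‖D h'‖ ^ 2 := by
      have h2 : ρ • z = (ρ • z - D h') + D h' := (sub_add_cancel _ _).symm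
      nth_rewrite 1 [h2]
      rw [norm_add_sq_real, h0]
      ring
    refine (pow_le_pow_iff_left₀ (norm_nonneg _) (norm_nonneg _) two_ne_zero).1 ?_
    rw [h1]
    exact le_add_of_nonneg_right (sq_nonneg _)
  have hle : ‖ρ • z - D h‖ ≤ ‖ρ • z - D h'‖ + η * C * ρ := by
    calc ‖ρ • z - D h‖ = ‖(Γ g₀ + ρ • z - Γ g) + (Γ g - Γ g₀ - D h)‖ := by congr 1; abel
      _ ≤ ‖Γ g₀ + ρ • z - Γ (g₀ + h')‖ + η * ‖h‖ :=
        (norm_add_le _ _).trans (add_le_add hcmp hrem)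
      _ = ‖(ρ • z - D h') - (Γ (g₀ + h') - Γ g₀ - D h')‖ + η * ‖h‖ := by congr 2; abel
      _ ≤ ‖ρ • z - D h'‖ + η * ‖h'‖ + η * ‖h‖ :=
        add_le_add ((norm_sub_le _ _).trans (add_le_add le_rfl hrem')) le_rfl
      _ ≤ ‖ρ • z - D h'‖ + η * (‖A‖ * R * ρ) + η * (4 * K * R * ρ) := by gcongr
      _ = _ := by rw [hC]; ring
  have hsq : ‖D (h' - h)‖ ^ 2 ≤ ρ ^ 2 * (2 * R * (η * C) + (η * C) ^ 2) := by
    have h1 : ‖ρ • z - D h‖ ^ 2 ≤ (‖ρ • z - D h'‖ + η * C * ρ) ^ 2 :=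
      pow_le_pow_left₀ (norm_nonneg _) hle 2
    have h2 : ‖ρ • z - D h'‖ * (η * C * ρ) ≤ ρ * R * (η * C * ρ) := by gcongr
    rw [hpyth, add_sq] at h1
    calc ‖D (h' - h)‖ ^ 2 ≤ 2 * (ρ * R * (η * C * ρ)) + (η * C * ρ) ^ 2 := by linarith
      _ = _ := by ring
  have hfin : ‖h - h'‖ ^ 2 ≤ (ε * ρ) ^ 2 := by
    calc ‖h - h'‖ ^ 2 = ‖h' - h‖ ^ 2 := by rw [norm_sub_rev]
      _ ≤ (K * ‖D (h' - h)‖) ^ 2 := pow_le_pow_left₀ (norm_nonneg _) (hK _) 2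
      _ ≤ K ^ 2 * (ρ ^ 2 * (2 * R * (η * C) + (η * C) ^ 2)) := by
        rw [mul_pow]
        gcongr
      _ = ρ ^ 2 * (K ^ 2 * (2 * R * (η * C) + (η * C) ^ 2)) := by ring
      _ ≤ ρ ^ 2 * ε ^ 2 := by gcongr
      _ = _ := by ring
  exact (pow_le_pow_iff_left₀ (norm_nonneg _) (by positivity) two_ne_zero).1 hfin

/-- The expansion of a differentiable function `φ` of the least squares fit. -/
lemma leastSquares_expansion_comp {Γ : E → H} {D : E →L[ℝ] H} {A : H →L[ℝ] E} {S : Set E} {g₀ : E}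
    (hS : g₀ ∈ interior S) (hΓ : HasFDerivAt Γ D g₀) (hD : Function.Injective D)
    (hA : ∀ z h, ⟪z - D (A z), D h⟫ = 0)
    (hid : ∀ ε > 0, ∃ δ > 0, ∀ g ∈ S, ε ≤ ‖g - g₀‖ → δ ≤ ‖Γ g - Γ g₀‖)
    {φ : E → F} {φ' : E →L[ℝ] F} (hφ : HasFDerivAt φ φ' g₀) (R : ℝ) {ε : ℝ} (hε : 0 < ε) :
    ∃ ρ₀ > 0, ∀ ρ : ℝ, 0 < ρ → ρ < ρ₀ → ∀ z : H, ‖z‖ ≤ R → ∀ g ∈ S,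
      (∀ g' ∈ S, ‖Γ g₀ + ρ • z - Γ g‖ ≤ ‖Γ g₀ + ρ • z - Γ g'‖) →
      ‖ρ⁻¹ • (φ g - φ g₀) - φ' (A z)‖ ≤ ε := by
  set a : ℝ := ε / (2 * (‖φ'‖ + 1)) with ha
  have ha0 : 0 < a := by positivity
  set C : ℝ := a + ‖A‖ * |R| with hC
  have hC0 : 0 < C := by positivity
  set η : ℝ := ε / (2 * C) with hη
  have hη0 : 0 < η := by positivity
  have h1 : ∀ᶠ g in 𝓝 g₀, ‖φ g - φ g₀ - φ' (g - g₀)‖ ≤ η * ‖g - g₀‖ :=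
    (hasFDerivAt_iff_isLittleO.1 hφ).def hη0
  obtain ⟨r, hr0, hr⟩ := Metric.eventually_nhds_iff.1 h1
  obtain ⟨ρ₁, hρ₁, hexp⟩ := leastSquares_expansion hS hΓ hD hA hid (R := R) ha0
  refine ⟨min ρ₁ (r / C), lt_min hρ₁ (by positivity), fun ρ hρ hρ' z hz g hg hmin => ?_⟩
  have h2 := hexp ρ hρ (hρ'.trans_le (min_le_left _ _)) z hz g hg hmin
  have hρr : ρ * C < r := by
    have := hρ'.trans_le (min_le_right _ _)
    rwa [lt_div_iff₀ hC0] at this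
  have h3 : ‖g - g₀‖ ≤ ρ * C := by
    calc ‖g - g₀‖ = ‖(g - g₀ - ρ • A z) + ρ • A z‖ := by congr 1; abel
      _ ≤ a * ρ + ρ * (‖A‖ * |R|) := by
        refine (norm_add_le _ _).trans (add_le_add h2 ?_)
        rw [norm_smul, Real.norm_of_nonneg hρ.le]
        have := (A.le_opNorm z).trans (mul_le_mul_of_nonneg_left (hz.trans (le_abs_self R))
          (norm_nonneg A))
        gcongr
      _ = _ := by rw [hC]; ring
  have h4 := hr (y := g) (by rw [dist_eq_norm]; exact h3.trans_lt hρr)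
  have h5 : ‖φ g - φ g₀ - ρ • φ' (A z)‖ ≤ ε * ρ := by
    calc ‖φ g - φ g₀ - ρ • φ' (A z)‖
        = ‖(φ g - φ g₀ - φ' (g - g₀)) + φ' (g - g₀ - ρ • A z)‖ := by
          congr 1
          simp only [map_sub, map_smul]
          abel
      _ ≤ η * (ρ * C) + ‖φ'‖ * (a * ρ) := by
          refine (norm_add_le _ _).trans (add_le_add (h4.trans (by gcongr)) ?_)
          exact (φ'.le_opNorm _).trans (by gcongr)
      _ ≤ ε / 2 * ρ + ε / 2 * ρ := by
          refine add_le_add (le_of_eq (by rw [hη]; field_simp)) ?_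
          have : ‖φ'‖ * a ≤ ε / 2 := by
            rw [ha, mul_div_assoc', div_le_div_iff₀ (by positivity) (by norm_num)]
            nlinarith [norm_nonneg φ']
          calc ‖φ'‖ * (a * ρ) = ‖φ'‖ * a * ρ := by ring
            _ ≤ _ := by gcongr
      _ = ε * ρ := by ring
  have h6 : ρ⁻¹ • (φ g - φ g₀) - φ' (A z) = ρ⁻¹ • (φ g - φ g₀ - ρ • φ' (A z)) := by
    rw [smul_sub ρ⁻¹ (φ g - φ g₀), smul_smul, inv_mul_cancel₀ hρ.ne', one_smul]
  rw [h6, norm_smul, norm_inv, Real.norm_of_nonneg hρ.le, inv_mul_le_iff₀ hρ]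
  linarith

end

/-! ### The observation schemes as sequences of independent data -/

section

variable {Ω : Type*} [MeasurableSpace Ω] {P : Measure Ω} [IsProbabilityMeasure P]

/-- The pairs formed from two independent sequences of independent random elements are
independent. -/
lemma iIndepFun_prodMk_of_indepFun {α β : Type*} [MeasurableSpace α] [MeasurableSpace β]
    {X : ℕ → Ω → α} {Y : ℕ → Ω → β} (hXm : ∀ i, Measurable (X i)) (hYm : ∀ i, Measurable (Y i))
    (hX : iIndepFun X P) (hY : iIndepFun Y P)
    (hXY : IndepFun (fun ω i => X i ω) (fun ω i => Y i ω) P) :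
    iIndepFun (fun i ω => (X i ω, Y i ω)) P := by
  have hrect : iIndepSets (fun i => (fun s => (fun ω => (X i ω, Y i ω)) ⁻¹' s) ''
      (Set.image2 (· ×ˢ ·) {s : Set α | MeasurableSet s} {t : Set β | MeasurableSet t})) P := by
    rw [iIndepSets_iff]
    intro S f hf
    have hf' : ∀ i, ∃ A : Set α, ∃ B : Set β, MeasurableSet A ∧ MeasurableSet B ∧
        (i ∈ S → f i = X i ⁻¹' A ∩ Y i ⁻¹' B) := by
      intro i
      by_cases hi : i ∈ S
      · obtain ⟨_, ⟨A, hA, B, hB, rfl⟩, h⟩ := hf i hi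
        exact ⟨A, B, hA, hB, fun _ => by rw [← h]; rfl⟩
      · exact ⟨∅, ∅, .empty, .empty, fun h => absurd h hi⟩
    choose A B hA hB hAB using hf'
    have h1 : ⋂ i ∈ S, f i = (⋂ i ∈ S, X i ⁻¹' A i) ∩ ⋂ i ∈ S, Y i ⁻¹' B i := by
      ext ω
      simp only [Set.mem_iInter, Set.mem_inter_iff, ← forall_and]
      exact forall₂_congr fun i hi => by rw [hAB i hi]; rfl
    have h2 : P ((⋂ i ∈ S, X i ⁻¹' A i) ∩ ⋂ i ∈ S, Y i ⁻¹' B i)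
        = P (⋂ i ∈ S, X i ⁻¹' A i) * P (⋂ i ∈ S, Y i ⁻¹' B i) := by
      have h3 := hXY.measure_inter_preimage_eq_mul
        (⋂ i ∈ S, (fun x : ℕ → α => x i) ⁻¹' A i) (⋂ i ∈ S, (fun y : ℕ → β => y i) ⁻¹' B i)
        (S.measurableSet_biInter fun i _ => measurable_pi_apply i (hA i))
        (S.measurableSet_biInter fun i _ => measurable_pi_apply i (hB i))
      simp only [Set.preimage_iInter] at h3
      exact h3
    rw [h1, h2, hX.measure_inter_preimage_eq_mul S fun i _ => hA i,
      hY.measure_inter_preimage_eq_mul S fun i _ => hB i, ← Finset.prod_mul_distrib]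
    refine Finset.prod_congr rfl fun i hi => ?_
    rw [hAB i hi]
    have h4 : IndepFun (X i) (Y i) P :=
      hXY.comp (measurable_pi_apply i) (measurable_pi_apply i)
    exact (h4.measure_inter_preimage_eq_mul _ _ (hA i) (hB i)).symm
  refine iIndepSets.iIndep (fun i => ((hXm i).prodMk (hYm i)).comap_le) _ (fun i => ?_) (fun i => ?_)
    hrect
  · exact isPiSystem_prod.comap _
  · rw [← MeasurableSpace.comap_generateFrom, generateFrom_prod]

lemma IsIIDSequence.of_comp {E E' : Type*} [MeasurableSpace E] [MeasurableSpace E']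
    {D : ℕ → Ω → E} (hm : ∀ i, Measurable (D i)) (hind : iIndepFun D P)
    (hid : ∀ i, IdentDistrib (D i) (D 0) P P) {φ : E → E'} (hφ : Measurable φ) :
    IsIIDSequence P (fun i ω => φ (D i ω)) (P.map fun ω => φ (D 0 ω)) where
  measurable i := hφ.comp (hm i)
  indep := hind.comp (fun _ => φ) fun _ => hφ
  map_eq i := ((hid i).comp hφ).map_eq

variable {𝒱 : Type*} [MeasurableSpace 𝒱] {d : ℕ}

/-- The law of `(v, x + e)`, where `(v, x)` and `e` are independent with laws `ρ` and `ν`. -/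
noncomputable def additiveErrorLaw (ρ : Measure (𝒱 × Euc d)) (ν : Measure (Euc d)) :
    Measure (𝒱 × Euc d) :=
  (ρ.prod ν).map fun p => (p.1.1, p.1.2 + p.2)

lemma map_additive_error {V : Ω → 𝒱} {X W e u : Ω → Euc d} (hV : Measurable V) (hX : Measurable X)
    (he : Measurable e) (hind : IndepFun (fun ω => (V ω, X ω)) e P) (hW : ∀ ω, W ω = X ω + e ω)
    (hlaw : P.map e = P.map u) :
    P.map (fun ω => (V ω, W ω)) = additiveErrorLaw (P.map fun ω => (V ω, X ω)) (P.map u) := by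
  have h1 := (indepFun_iff_map_prod_eq_prod_map_map (hV.prodMk hX).aemeasurable
    he.aemeasurable).1 hind
  rw [additiveErrorLaw, ← hlaw, ← h1, Measure.map_map (by fun_prop) (by fun_prop)]
  congr 1
  ext ω : 1
  simp [hW]

/-- For independent symmetric errors, `∑ |a_j| U_j` and `∑ a_j U_j` have the same law. -/
lemma map_sum_abs_smul_eq {k : ℕ} {U : Fin k → Ω → Euc d} (hU : ∀ j, Measurable (U j))
    (hind : iIndepFun U P) (hsymm : ∀ j, IdentDistrib (U j) (fun ω => -U j ω) P P) (a : Fin k → ℝ) :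
    P.map (fun ω => ∑ j, |a j| • U j ω) = P.map fun ω => ∑ j, a j • U j ω := by
  have h1 : ∀ b : Fin k → ℝ, P.map (fun ω j => b j • U j ω)
      = Measure.pi fun j => P.map fun ω => b j • U j ω := fun b =>
    (hind.comp (fun j x => b j • x) fun j => measurable_const_smul (b j)).map_fun_eq_pi_map
      fun j => ((hU j).const_smul (b j)).aemeasurable
  have h2 : ∀ j, P.map (fun ω => |a j| • U j ω) = P.map fun ω => a j • U j ω := by
    intro j
    rcases abs_choice (a j) with h | h
    · rw [h]
    · have h3 := ((hsymm j).comp (u := fun x => -a j • x) (measurable_const_smul (-a j))).map_eq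
      rw [h]
      refine h3.trans ?_
      congr 1
      ext ω : 1
      simp
  have h3 : ∀ b : Fin k → ℝ, P.map (fun ω => ∑ j, b j • U j ω)
      = (Measure.pi fun j => P.map fun ω => b j • U j ω).map fun x => ∑ j, x j := fun b => by
    have h4 : Measurable fun ω j => b j • U j ω :=
      measurable_pi_iff.2 fun j => (hU j).const_smul (b j)
    rw [← h1, Measure.map_map (by fun_prop) h4]
    rfl
  rw [h3, h3]
  simp only [h2]

variable {V : ℕ → Ω → 𝒱} {X W u : ℕ → Ω → Euc d} {m : ℕ → ℕ}

/-- Since `∑ |a_j| = 1` and `∑ a_j = 0`, the measurement is `X i + ∑ |a_j| U_{ij}` and the observed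
error is `∑ a_j U_{ij}`; these two errors are dependent but have the same law. -/
lemma IsReplicateSample.iid_and_law {k : ℕ} {a : Fin k → ℝ} {U : ℕ → Fin k → Ω → Euc d}
    (h : IsReplicateSample P V X k a U W u m) :
    IsIIDSequence P (fun i ω => (V i ω, W i ω, u i ω)) (P.map fun ω => (V 0 ω, W 0 ω, u 0 ω)) ∧
      Measurable (X 0) ∧ P.map (fun ω => (V 0 ω, W 0 ω))
        = additiveErrorLaw (P.map fun ω => (V 0 ω, X 0 ω)) (P.map (u 0)) := by
  have hW : ∀ i ω, W i ω = X i ω + ∑ j, |a j| • U i j ω := fun i ω => by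
    rw [h.measurement]
    simp only [smul_add, Finset.sum_add_distrib, ← Finset.sum_smul, h.sum_abs_contrast, one_smul]
  have hu : ∀ i ω, u i ω = ∑ j, a j • U i j ω := fun i ω => by
    rw [h.observed_error]
    simp only [smul_add, Finset.sum_add_distrib, ← Finset.sum_smul, h.sum_contrast, zero_smul,
      zero_add]
  refine ⟨?_, h.measurable_X 0, ?_⟩
  · have hm : ∀ i, Measurable fun ω => ((V i ω, X i ω), fun j => U i j ω) := fun i =>
      ((h.measurable_V i).prodMk (h.measurable_X i)).prodMk (measurable_pi_iff.2 (h.measurable_U i))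
    have := IsIIDSequence.of_comp hm h.indep_subjects h.ident_subjects
      (φ := fun x : (𝒱 × Euc d) × (Fin k → Euc d) =>
        (x.1.1, x.1.2 + ∑ j, |a j| • x.2 j, ∑ j, a j • x.2 j)) (by fun_prop)
    simpa only [← hW, ← hu] using this
  · have hu' : u 0 = fun ω => ∑ j, a j • U 0 j ω := funext (hu 0)
    refine map_additive_error (h.measurable_V 0) (h.measurable_X 0)
      (e := fun ω => ∑ j, |a j| • U 0 j ω)
      (Finset.measurable_fun_sum _ fun j _ => by
        have := h.measurable_U 0 j
        fun_prop) ?_ (hW 0) ?_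
    · exact (h.indep_errors 0).comp (ψ := fun x : Fin k → Euc d => ∑ j, |a j| • x j) measurable_id
        (by fun_prop)
    · rw [hu']
      exact map_sum_abs_smul_eq (h.measurable_U 0) (h.indep_replicates 0) (h.symmetric 0) a

lemma IsAdditiveErrorSample.map_eq (h : IsAdditiveErrorSample P V X W)
    (hu : P.map (fun ω => W 0 ω - X 0 ω) = P.map (u 0)) :
    P.map (fun ω => (V 0 ω, W 0 ω))
      = additiveErrorLaw (P.map fun ω => (V 0 ω, X 0 ω)) (P.map (u 0)) :=
  map_additive_error (h.measurable_V 0) (h.measurable_X 0)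
    ((h.measurable_W 0).sub (h.measurable_X 0)) (h.indep_error 0) (fun _ =>
        (add_sub_cancel _ _).symm) hu

/-- In all three observation schemes the triples `(V i, W i, u i)` are independent and identically
distributed, and `(V i, W i)` is `(V i, X i)` with an independent error of the law of `u i` added.
The dependence between the error in `W i` and `u i` differs between the schemes. -/
lemma IsObservationScheme.iid_and_law (h : IsObservationScheme P V X W u m) :
    IsIIDSequence P (fun i ω => (V i ω, W i ω, u i ω)) (P.map fun ω => (V 0 ω, W 0 ω, u 0 ω)) ∧
      Measurable (X 0) ∧ P.map (fun ω => (V 0 ω, W 0 ω))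
        = additiveErrorLaw (P.map fun ω => (V 0 ω, X 0 ω)) (P.map (u 0)) := by
  rcases h with ⟨k, a, U, h⟩ | h | ⟨X', W', h⟩
  · exact h.iid_and_law
  · have hm := h.model
    refine ⟨?_, hm.measurable_X 0, hm.map_eq ?_⟩
    · have := IsIIDSequence.of_comp (fun i => (hm.measurable_V i).prodMk
        ((hm.measurable_X i).prodMk (hm.measurable_W i))) hm.indep_subjects hm.ident_subjects
        (φ := fun x : 𝒱 × Euc d × Euc d => (x.1, x.2.2, x.2.2 - x.2.1)) (by fun_prop)
      simpa only [← h.observed_error] using this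
    · rw [show u 0 = fun ω => W 0 ω - X 0 ω from funext (h.observed_error 0)]
  · have hm := h.model
    refine ⟨?_, hm.measurable_X 0, hm.map_eq h.transportable.map_eq.symm⟩
    have hm1 : ∀ i, Measurable fun ω => (V i ω, X i ω, W i ω) := fun i =>
      (hm.measurable_V i).prodMk ((hm.measurable_X i).prodMk (hm.measurable_W i))
    have hm2 : ∀ i, Measurable fun ω => (X' i ω, W' i ω) := fun i =>
      (h.measurable_X' i).prodMk (h.measurable_W' i)
    have hind := iIndepFun_prodMk_of_indepFun hm1 hm2 hm.indep_subjects h.indep_pairs h.indep_main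
    have hid : ∀ i, IdentDistrib (fun ω => ((V i ω, X i ω, W i ω), (X' i ω, W' i ω)))
        (fun ω => ((V 0 ω, X 0 ω, W 0 ω), (X' 0 ω, W' 0 ω))) P P := fun i =>
      (hm.ident_subjects i).prodMk (h.ident_pairs i)
        (h.indep_main.comp (measurable_pi_apply i) (measurable_pi_apply i))
        (h.indep_main.comp (measurable_pi_apply 0) (measurable_pi_apply 0))
    have := IsIIDSequence.of_comp (fun i => (hm1 i).prodMk (hm2 i)) hind hid
      (φ := fun x : (𝒱 × Euc d × Euc d) × (Euc d × Euc d) =>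
        (x.1.1, x.1.2.2, x.2.2 - x.2.1)) (by fun_prop)
    simpa only [← h.observed_error] using this

/-- The remeasured data point as a function of the kernel argument. -/
def remeasure {l : ℕ} (y : Fin (l + 1) → 𝒱 × Euc d × Euc d) : 𝒱 × Euc d :=
  ((y 0).1, (y 0).2.1 + ∑ j : Fin l, (y j.succ).2.2)

lemma measurable_remeasure {l : ℕ} :
    Measurable (remeasure : (Fin (l + 1) → 𝒱 × Euc d × Euc d) → 𝒱 × Euc d) := by
  unfold remeasure
  fun_prop

/-- For independent triples, the remeasured data point has the law `F_l`. -/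
lemma map_remeasure_pi {μ : Measure (𝒱 × Euc d × Euc d)} [IsProbabilityMeasure μ]
    {ρ : Measure (𝒱 × Euc d)} [IsProbabilityMeasure ρ] {ν : Measure (Euc d)}
    [IsProbabilityMeasure ν] (hV : μ.map (fun x => (x.1, x.2.1)) = additiveErrorLaw ρ ν)
    (hu : μ.map (fun x => x.2.2) = ν) (l : ℕ) :
    (Measure.pi fun _ : Fin (l + 1) => μ).map remeasure = remeasuredLaw ρ ν l := by
  set τ := additiveErrorLaw ρ ν with hτ
  have h4 : MeasurePreserving (fun p : (𝒱 × Euc d) × Euc d => (p.1.1, p.1.2 + p.2)) (ρ.prod ν) τ :=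
    ⟨by fun_prop, rfl⟩
  have hτp : IsProbabilityMeasure τ :=
    Measure.isProbabilityMeasure_map h4.measurable.aemeasurable
  have h1 := measurePreserving_piFinSuccAbove (fun _ : Fin (l + 1) => μ) 0
  have h2 : MeasurePreserving (fun x : 𝒱 × Euc d × Euc d => (x.1, x.2.1)) μ τ := ⟨by fun_prop, hV⟩
  have h3 : MeasurePreserving (fun (y : Fin l → 𝒱 × Euc d × Euc d) j => (y j).2.2)
      (Measure.pi fun _ => μ) (Measure.pi fun _ => ν) :=
    measurePreserving_pi (fun _ : Fin l => μ) (fun _ => ν) fun _ => ⟨by fun_prop, hu⟩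
  have h5 := (measurePreserving_prodAssoc ρ ν (Measure.pi fun _ : Fin l => ν))
  have h6 := (MeasurePreserving.id ρ).prod
    (measurePreserving_piFinSuccAbove (fun _ : Fin (l + 1) => ν) 0)
  have h7 := (h2.prod h3).comp h1
  have h8 := h4.prod (MeasurePreserving.id (Measure.pi fun _ : Fin l => ν))
  have hg₁ : Measurable fun p : (𝒱 × Euc d) × (Fin l → Euc d) => (p.1.1, p.1.2 + ∑ j, p.2 j) := by
    fun_prop
  have hg₂ : Measurable fun p : (𝒱 × Euc d) × Euc d × (Fin l → Euc d) =>
      (p.1.1, p.1.2 + (p.2.1 + ∑ j, p.2.2 j)) := by fun_prop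
  calc (Measure.pi fun _ : Fin (l + 1) => μ).map remeasure
      = (τ.prod (Measure.pi fun _ : Fin l => ν)).map fun p => (p.1.1, p.1.2 + ∑ j, p.2 j) := by
        rw [← h7.map_eq, Measure.map_map hg₁ h7.measurable]
        rfl
    _ = ((ρ.prod ν).prod (Measure.pi fun _ : Fin l => ν)).map fun p =>
          (p.1.1.1, p.1.1.2 + (p.1.2 + ∑ j, p.2 j)) := by
        rw [← h8.map_eq, Measure.map_map hg₁ h8.measurable]
        congr 1
        ext p : 1
        simp [add_assoc]
    _ = (ρ.prod (ν.prod (Measure.pi fun _ : Fin l => ν))).map fun p =>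
          (p.1.1, p.1.2 + (p.2.1 + ∑ j, p.2.2 j)) := by
        rw [← h5.map_eq, Measure.map_map hg₂ h5.measurable]
        rfl
    _ = remeasuredLaw ρ ν l := by
        rw [← h6.map_eq, Measure.map_map hg₂ h6.measurable, remeasuredLaw]
        congr 1
        ext p : 1
        simp only [Fin.sum_univ_succ]
        rfl

end

/-! ### Asymptotic normality from characteristic functions -/

section

variable {Ω : Type*} [MeasurableSpace Ω] {P : Measure Ω} [IsProbabilityMeasure P]

open Matrix in
/-- Lévy's continuity theorem and Slutsky's lemma for a centred Gaussian limit. -/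
lemma isAsymptoticallyCentredNormal_of_tendsto_charFun {p : ℕ} {Y Z : ℕ → Ω → Euc p}
    (hY : ∀ n, Measurable (Y n)) (hZ : ∀ n, Measurable (Z n)) {M : Fin p → Fin p → ℝ}
    (hM : ∀ s s', M s s' = M s' s) (hM0 : ∀ t : Fin p → ℝ, 0 ≤ ∑ s, ∑ s', t s * t s' * M s s')
    (h : ∀ t : Fin p → ℝ, Tendsto (fun n => ∫ ω, Complex.exp
      ((∑ s, t s * Y n ω s : ℝ) * Complex.I) ∂P) atTop
      (𝓝 (Complex.exp ((-(∑ s, ∑ s', t s * t s' * M s s') / 2 : ℝ)))))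
    (hYZ : IsLittleOProb P fun n ω => ‖Z n ω - Y n ω‖) :
    IsAsymptoticallyCentredNormal P Z := by
  set S : Matrix (Fin p) (Fin p) ℝ := Matrix.of M with hS
  have hquad : ∀ t : Fin p → ℝ, t ⬝ᵥ S *ᵥ t = ∑ s, ∑ s', t s * t s' * M s s' := fun t => by
    simp only [dotProduct, mulVec, hS, Matrix.of_apply, Finset.mul_sum]
    exact Finset.sum_congr rfl fun s _ => Finset.sum_congr rfl fun s' _ => by ring
  have hpsd : S.PosSemidef := by
    refine PosSemidef.of_dotProduct_mulVec_nonneg (Matrix.IsHermitian.ext fun s s' => ?_) fun t => ?_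
    · simp [hS, hM s s']
    · rw [star_trivial, hquad]
      exact hM0 t
  refine ⟨multivariateGaussian 0 S, isGaussian_multivariateGaussian,
    integral_id_multivariateGaussian, ?_⟩
  have hdist : TendstoInDistribution Y atTop (id : Euc p → Euc p) (fun _ => P)
      (multivariateGaussian 0 S) := by
    refine ⟨fun n => (hY n).aemeasurable, aemeasurable_id, ?_⟩
    refine ProbabilityMeasure.tendsto_iff_tendsto_charFun.2 fun t => ?_
    simp only [ProbabilityMeasure.coe_mk, Measure.map_id, charFun_multivariateGaussian hpsd]
    have h1 := h t
    rw [← hquad] at h1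
    convert h1 using 2
    · rename_i n
      rw [charFun_apply, integral_map (hY n).aemeasurable (by fun_prop)]
      congr 1
    · simp [neg_div]
  refine tendstoInDistribution_of_tendstoInMeasure_sub Z id hdist ?_ fun n => (hZ n).aemeasurable
  rw [tendstoInMeasure_iff_norm]
  intro ε hε
  simpa using hYZ ε hε

/-- `R n` is bounded in probability. -/
def IsBoundedInProb {Ω : Type*} [MeasurableSpace Ω] (P : Measure Ω) (R : ℕ → Ω → ℝ) : Prop :=
  ∀ ε : ℝ≥0∞, 0 < ε → ∃ C : ℝ, ∀ᶠ n in atTop, P {ω | C ≤ |R n ω|} ≤ ε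

lemma IsBoundedInProb.add {R R' : ℕ → Ω → ℝ} (h : IsBoundedInProb P R)
    (h' : IsBoundedInProb P R') : IsBoundedInProb P fun n ω => |R n ω| + |R' n ω| := by
  intro ε hε
  obtain ⟨C, hC⟩ := h (ε / 2) (ENNReal.half_pos hε.ne')
  obtain ⟨C', hC'⟩ := h' (ε / 2) (ENNReal.half_pos hε.ne')
  refine ⟨C + C', ?_⟩
  filter_upwards [hC, hC'] with n hn hn'
  refine (measure_mono fun ω hω => ?_).trans
    ((measure_union_le {ω | C ≤ |R n ω|} {ω | C' ≤ |R' n ω|}).trans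
      ((add_le_add hn hn').trans_eq (ENNReal.add_halves ε)))
  by_contra hcon
  simp only [Set.mem_union, Set.mem_ofPred_eq, not_or, not_le] at hcon hω
  rw [abs_of_nonneg (by positivity)] at hω
  linarith

lemma IsBoundedInProb.of_le {R R' : ℕ → Ω → ℝ} (h : IsBoundedInProb P R)
    (hle : ∀ n ω, |R' n ω| ≤ |R n ω|) : IsBoundedInProb P R' := by
  intro ε hε
  obtain ⟨C, hC⟩ := h ε hε
  exact ⟨C, hC.mono fun n hn => (measure_mono fun ω (hω : C ≤ _) => hω.trans (hle n ω)).trans hn⟩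

lemma IsBoundedInProb.sum {ι : Type*} (s : Finset ι) {R : ι → ℕ → Ω → ℝ}
    (h : ∀ i ∈ s, IsBoundedInProb P (R i)) :
    IsBoundedInProb P fun n ω => ∑ i ∈ s, |R i n ω| := by
  classical
  induction s using Finset.induction_on with
  | empty =>
    intro ε _
    exact ⟨1, Eventually.of_forall fun n => by simp [not_le.2 (zero_lt_one (α := ℝ))]⟩
  | insert i s hi ih =>
    refine ((h i (by simp)).add (ih fun j hj => h j (by simp [hj]))).of_le fun n ω => ?_
    rw [Finset.sum_insert hi, abs_of_nonneg (a := ∑ i ∈ s, |R i n ω|)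
      (Finset.sum_nonneg fun _ _ => abs_nonneg _)]

open scoped RealInnerProductSpace in
/-- The expansion of least squares fits in probability. -/
lemma isLittleOProb_leastSquares {E H F : Type*} [NormedAddCommGroup E] [NormedSpace ℝ E]
    [FiniteDimensional ℝ E] [NormedAddCommGroup H] [InnerProductSpace ℝ H] [FiniteDimensional ℝ H]
    [NormedAddCommGroup F] [NormedSpace ℝ F]
    {Γ : E → H} {D : E →L[ℝ] H} {A : H →L[ℝ] E} {S : Set E} {g₀ : E}
    (hS : g₀ ∈ interior S) (hΓ : HasFDerivAt Γ D g₀) (hD : Function.Injective D)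
    (hA : ∀ z h, ⟪z - D (A z), D h⟫ = 0)
    (hid : ∀ ε > 0, ∃ δ > 0, ∀ g ∈ S, ε ≤ ‖g - g₀‖ → δ ≤ ‖Γ g - Γ g₀‖)
    {φ : E → F} {φ' : E →L[ℝ] F} (hφ : HasFDerivAt φ φ' g₀)
    {y s : ℕ → Ω → H} {g : ℕ → Ω → E} (hs : IsBoundedInProb P fun n ω => ‖s n ω‖)
    (hy : IsLittleOProb P fun n ω => ‖√(n : ℝ) • (y n ω - Γ g₀) - s n ω‖)
    (hg : Tendsto (fun n => P {ω | ¬ (g n ω ∈ S ∧ ∀ g' ∈ S, ‖y n ω - Γ (g n ω)‖ ≤ ‖y n ω - Γ g'‖)})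
      atTop (𝓝 0)) :
    IsLittleOProb P fun n ω => ‖√(n : ℝ) • (φ (g n ω) - φ g₀) - φ' (A (s n ω))‖ := by
  intro ε hε
  set K : ℝ := ‖φ'.comp A‖ with hK
  have hK0 : 0 ≤ K := norm_nonneg _
  set τ : ℝ := min 1 (ε / (4 * (K + 1))) with hτ
  have hτ0 : 0 < τ := lt_min one_pos (by positivity)
  have hτK : K * τ ≤ ε / 4 := by
    calc K * τ ≤ K * (ε / (4 * (K + 1))) := mul_le_mul_of_nonneg_left (min_le_right _ _) hK0
      _ ≤ ε / 4 := by
        rw [mul_div_assoc', div_le_div_iff₀ (by positivity) (by norm_num)]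
        nlinarith
  refine ENNReal.tendsto_nhds_zero.2 fun δ hδ => ?_
  obtain ⟨R, hR⟩ := hs (δ / 2) (ENNReal.half_pos hδ.ne')
  obtain ⟨ρ₀, hρ₀, hexp⟩ := leastSquares_expansion_comp hS hΓ hD hA hid hφ (R + 1)
    (by positivity : 0 < ε / 2)
  have hsmall := ENNReal.tendsto_nhds_zero.1 (by simpa only [add_zero] using (hy τ hτ0).add hg) (δ / 2)
    (ENNReal.half_pos hδ.ne')
  have hsq : Tendsto (fun n : ℕ => (√(n : ℝ))⁻¹) atTop (𝓝 0) :=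
    tendsto_inv_atTop_zero.comp (Real.tendsto_sqrt_atTop.comp tendsto_natCast_atTop_atTop)
  filter_upwards [hR, hsmall, (tendsto_order.1 hsq).2 ρ₀ hρ₀, eventually_gt_atTop 0]
    with n hRn hsn hρn hn
  have hsq0 : 0 < √(n : ℝ) := Real.sqrt_pos.2 (by exact_mod_cast hn)
  refine (measure_mono fun ω hω => ?_).trans ((measure_union_le {ω | R ≤ |‖s n ω‖|}
    ({ω | τ ≤ |‖√(n : ℝ) • (y n ω - Γ g₀) - s n ω‖|} ∪ {ω | ¬ (g n ω ∈ S ∧ ∀ g' ∈ S,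
      ‖y n ω - Γ (g n ω)‖ ≤ ‖y n ω - Γ g'‖)})).trans ((add_le_add hRn
        ((measure_union_le _ _).trans hsn)).trans_eq (ENNReal.add_halves δ)))
  by_contra hcon
  simp only [Set.mem_union, Set.mem_ofPred_eq, not_or, not_le, not_not, abs_norm] at hcon hω
  obtain ⟨h1, h2, h3, h4⟩ := hcon
  set z := √(n : ℝ) • (y n ω - Γ g₀) with hz
  have hyz : Γ g₀ + (√(n : ℝ))⁻¹ • z = y n ω := by
    rw [hz, smul_smul, inv_mul_cancel₀ hsq0.ne', one_smul]
    abel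
  have hzR : ‖z‖ ≤ R + 1 := by
    calc ‖z‖ = ‖(z - s n ω) + s n ω‖ := by rw [sub_add_cancel]
      _ ≤ τ + R := (norm_add_le _ _).trans (add_le_add h2.le h1.le)
      _ ≤ R + 1 := by
        have : τ ≤ 1 := min_le_left _ _
        linarith
  have h5 := hexp _ (inv_pos.2 hsq0) hρn z hzR (g n ω) h3 (by rw [hyz]; exact h4)
  rw [inv_inv] at h5
  have h6 : ‖φ' (A z) - φ' (A (s n ω))‖ ≤ ε / 4 := by
    rw [← map_sub, ← map_sub]
    exact ((φ'.comp A).le_opNorm _).trans ((mul_le_mul_of_nonneg_left h2.le hK0).trans hτK)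
  have h7 : ‖√(n : ℝ) • (φ (g n ω) - φ g₀) - φ' (A (s n ω))‖ ≤ ε / 2 + ε / 4 := by
    calc _ = ‖(√(n : ℝ) • (φ (g n ω) - φ g₀) - φ' (A z)) + (φ' (A z) - φ' (A (s n ω)))‖ := by
          rw [sub_add_sub_cancel]
      _ ≤ _ := (norm_add_le _ _).trans (add_le_add h5 h6)
  linarith

end

/-! ### The averaged estimates on the grid -/

section

variable {Ω 𝒱 : Type*} [MeasurableSpace Ω] [MeasurableSpace 𝒱] {P : Measure Ω}
  [IsProbabilityMeasure P] {d p : ℕ} {V : ℕ → Ω → 𝒱} {W u : ℕ → Ω → Euc d} {m : ℕ → ℕ}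
  {B : ℕ} {Λ : Finset ℕ} {I : (n : ℕ) → Fin B → (l : Λ) → Fin n → Fin (l : ℕ) → Ω → ℕ}
  {μ : Measure (𝒱 × Euc d × Euc d)} {ψ : Λ → 𝒱 × Euc d → Euc p}

lemma IsResampling.isUniformResampling (h : IsResampling P V W u m B Λ I) :
    IsUniformResampling P (fun i ω => (V i ω, W i ω, u i ω)) m (fun a : Fin B × Λ => (a.2 : ℕ))
      (fun n a => I n a.1 a.2) where
  measurable n a i j := h.measurable n a.1 a.2 i j
  uniform n hn a i j k hk := h.uniform n hn a.1 a.2 i j k hk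
  indep n hn := (h.indep n hn).precomp
    (g := fun q : Σ s : (Fin B × Λ) × Fin n, Fin (s.1.2 : ℕ) =>
      (q.1.1.1, (⟨q.1.1.2, (q.1.2, q.2)⟩ : Σ l : Λ, Fin n × Fin (l : ℕ)))) (by
      rintro ⟨⟨⟨b, l⟩, i⟩, j⟩ ⟨⟨⟨b', l'⟩, i'⟩, j'⟩ hq
      simp only [Prod.mk.injEq, Sigma.mk.injEq] at hq
      obtain ⟨rfl, rfl, hq⟩ := hq
      simp only [heq_eq_eq, Prod.mk.injEq] at hq
      obtain ⟨rfl, rfl⟩ := hq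
      rfl)
  indep_data n hn := (h.indep_data n hn).comp
    (φ := fun (x : Fin B × (Σ l : Λ, Fin n × Fin (l : ℕ)) → ℕ)
      (q : Σ s : (Fin B × Λ) × Fin n, Fin (s.1.2 : ℕ)) =>
      x (q.1.1.1, ⟨q.1.1.2, (q.1.2, q.2)⟩))
    (measurable_pi_iff.2 fun q => measurable_pi_apply _) measurable_id

/-- The normalized sums of the influence functions, averaged over the remeasured data sets, as a
vector indexed by the grid. -/
noncomputable def gridSum (V : ℕ → Ω → 𝒱) (W u : ℕ → Ω → Euc d)
    (I : (n : ℕ) → Fin B → (l : Λ) → Fin n → Fin (l : ℕ) → Ω → ℕ)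
    (ψ : Λ → 𝒱 × Euc d → Euc p) (n : ℕ) (ω : Ω) : Λ → Euc p :=
  fun l => (B : ℝ)⁻¹ • ∑ b, (√(n : ℝ))⁻¹ • ∑ i : Fin n, ψ l (remeasured V W u i (I n b l i) ω)

/-- The kernels whose resampled sum is the linear functional `Φ` of `gridSum`. -/
noncomputable def gridKernel (B : ℕ) (ψ : Λ → 𝒱 × Euc d → Euc p) (Φ : (Λ → Euc p) →L[ℝ] ℝ)
    (a : Fin B × Λ) (y : Fin ((a.2 : ℕ) + 1) → 𝒱 × Euc d × Euc d) : ℝ :=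
  Φ (Pi.single a.2 ((B : ℝ)⁻¹ • ψ a.2 (remeasure y)))

lemma apply_gridSum (Φ : (Λ → Euc p) →L[ℝ] ℝ) (n : ℕ) (ω : Ω) :
    Φ (gridSum V W u I ψ n ω) = resampledSum (fun i ω => (V i ω, W i ω, u i ω))
      (fun n (a : Fin B × Λ) => I n a.1 a.2) (gridKernel B ψ Φ) n ω := by
  have h1 : gridSum V W u I ψ n ω = (√(n : ℝ))⁻¹ • ∑ s : (Fin B × Λ) × Fin n,
      Pi.single s.1.2 ((B : ℝ)⁻¹ • ψ s.1.2 (remeasured V W u s.2 (I n s.1.1 s.1.2 s.2) ω)) := by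
    ext l : 1
    simp only [gridSum, Fintype.sum_prod_type, Pi.smul_apply, Finset.sum_apply]
    have h2 : ∀ b : Fin B, ∑ l' : Λ, ∑ i : Fin n, (Pi.single l' ((B : ℝ)⁻¹ •
        ψ l' (remeasured V W u i (I n b l' i) ω)) : Λ → Euc p) l
        = (B : ℝ)⁻¹ • ∑ i : Fin n, ψ l (remeasured V W u i (I n b l i) ω) := fun b => by
      rw [Finset.sum_comm, Finset.smul_sum]
      refine Finset.sum_congr rfl fun i _ => ?_
      rw [Finset.sum_eq_single l (fun l' _ hl' => Pi.single_eq_of_ne (Ne.symm hl') _) (by simp)]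
      exact Pi.single_eq_same _ _
    simp only [h2, Finset.smul_sum]
    exact Finset.sum_congr rfl fun b _ => Finset.sum_congr rfl fun i _ => smul_comm _ _ _
  rw [h1, map_smul, map_sum]
  rfl

lemma measurable_gridKernel (hψ : ∀ l, Measurable (ψ l)) (Φ : (Λ → Euc p) →L[ℝ] ℝ)
    (a : Fin B × Λ) : Measurable (gridKernel B ψ Φ a) := by
  have h1 : Measurable fun x : Euc p => Φ (Pi.single a.2 ((B : ℝ)⁻¹ • x)) := by
    have : Continuous fun x : Euc p => Φ (Pi.single a.2 ((B : ℝ)⁻¹ • x)) :=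
      Φ.continuous.comp ((continuous_single a.2).comp (continuous_const_smul _))
    exact this.measurable
  exact h1.comp ((hψ a.2).comp measurable_remeasure)

/-- `x ↦ Φ (0, …, x / B, …, 0)` as a continuous linear map. -/
noncomputable def singleFunctional (B : ℕ) (Φ : (Λ → Euc p) →L[ℝ] ℝ) (l : Λ) : Euc p →L[ℝ] ℝ :=
  (B : ℝ)⁻¹ • Φ.comp (ContinuousLinearMap.single ℝ (fun _ : Λ => Euc p) l)

lemma gridKernel_eq (Φ : (Λ → Euc p) →L[ℝ] ℝ) (a : Fin B × Λ) :
    gridKernel B ψ Φ a = fun y => singleFunctional B Φ a.2 (ψ a.2 (remeasure y)) := by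
  ext y
  simp only [gridKernel, singleFunctional, _root_.smul_apply,
    ContinuousLinearMap.comp_apply, ContinuousLinearMap.single_apply, ← map_smul, Pi.single_smul]

lemma memLp_gridKernel (hψ : ∀ l : Λ, MemLp (fun y : Fin ((l : ℕ) + 1) → 𝒱 × Euc d × Euc d =>
    ψ l (remeasure y)) 2 (Measure.pi fun _ => μ)) (Φ : (Λ → Euc p) →L[ℝ] ℝ) (a : Fin B × Λ) :
    MemLp (gridKernel B ψ Φ a) 2 (Measure.pi fun _ => μ) := by
  rw [gridKernel_eq]
  exact (singleFunctional B Φ a.2).comp_memLp' (hψ a.2)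

lemma integral_gridKernel [IsProbabilityMeasure μ]
    (hψ : ∀ l : Λ, MemLp (fun y : Fin ((l : ℕ) + 1) → 𝒱 × Euc d × Euc d =>
      ψ l (remeasure y)) 2 (Measure.pi fun _ => μ))
    (h0 : ∀ l : Λ, ∫ y : Fin ((l : ℕ) + 1) → 𝒱 × Euc d × Euc d, ψ l (remeasure y)
      ∂(Measure.pi fun _ => μ) = 0) (Φ : (Λ → Euc p) →L[ℝ] ℝ) (a : Fin B × Λ) :
    ∫ y, gridKernel B ψ Φ a y ∂(Measure.pi fun _ => μ) = 0 := by
  rw [gridKernel_eq, ContinuousLinearMap.integral_comp_comm _ ((hψ a.2).integrable one_le_two), h0,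
    map_zero]

lemma isBoundedInProb_apply_gridSum (hD : IsIIDSequence P (fun i ω => (V i ω, W i ω, u i ω)) μ)
    {c : ℝ} (hm : Tendsto m atTop atTop)
    (hc : Tendsto (fun n : ℕ => (n : ℝ) / (m n : ℝ)) atTop (𝓝 c))
    (hI : IsResampling P V W u m B Λ I) (hψm : ∀ l, Measurable (ψ l))
    (hψ : ∀ l : Λ, MemLp (fun y : Fin ((l : ℕ) + 1) → 𝒱 × Euc d × Euc d =>
      ψ l (remeasure y)) 2 (Measure.pi fun _ => μ))
    (h0 : ∀ l : Λ, ∫ y : Fin ((l : ℕ) + 1) → 𝒱 × Euc d × Euc d, ψ l (remeasure y)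
      ∂(Measure.pi fun _ => μ) = 0) (Φ : (Λ → Euc p) →L[ℝ] ℝ) :
    IsBoundedInProb P fun n ω => Φ (gridSum V W u I ψ n ω) := by
  have := hD.isProbabilityMeasure
  simp only [apply_gridSum]
  obtain ⟨C, hC0, hC⟩ := hI.isUniformResampling.exists_tail_bound hD hm hc
  have h1 := hC (gridKernel B ψ Φ) (measurable_gridKernel hψm Φ) (memLp_gridKernel hψ Φ)
    (integral_gridKernel hψ h0 Φ)
  intro ε hε
  obtain ⟨δ, hδ0, hδ⟩ : ∃ δ : ℝ, 0 < δ ∧ ENNReal.ofReal δ ≤ ε := by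
    rcases eq_or_ne ε ∞ with rfl | hne
    · exact ⟨1, one_pos, le_top⟩
    · exact ⟨ε.toReal, ENNReal.toReal_pos hε.ne' hne, ENNReal.ofReal_toReal_le⟩
  set K : ℝ := C * ∑ a : Fin B × Λ, ∫ y, gridKernel B ψ Φ a y ^ 2 ∂(Measure.pi fun _ => μ) with hK
  have h2 : Tendsto (fun η : ℝ => K / η ^ 2) atTop (𝓝 0) :=
    tendsto_const_nhds.div_atTop (tendsto_pow_atTop two_ne_zero)
  obtain ⟨η, hη, hη0⟩ := (((tendsto_order.1 h2).2 (δ / 2) (by positivity)).and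
    (eventually_gt_atTop 0)).exists
  refine ⟨η, ?_⟩
  filter_upwards [h1 η hη0 (δ / 2) (by positivity)] with n hn
  refine le_trans ?_ hδ
  rw [← ofReal_measureReal]
  exact ENNReal.ofReal_le_ofReal (by linarith)

lemma isBoundedInProb_norm_gridSum (hD : IsIIDSequence P (fun i ω => (V i ω, W i ω, u i ω)) μ)
    {c : ℝ} (hm : Tendsto m atTop atTop)
    (hc : Tendsto (fun n : ℕ => (n : ℝ) / (m n : ℝ)) atTop (𝓝 c))
    (hI : IsResampling P V W u m B Λ I) (hψm : ∀ l, Measurable (ψ l))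
    (hψ : ∀ l : Λ, MemLp (fun y : Fin ((l : ℕ) + 1) → 𝒱 × Euc d × Euc d =>
      ψ l (remeasure y)) 2 (Measure.pi fun _ => μ))
    (h0 : ∀ l : Λ, ∫ y : Fin ((l : ℕ) + 1) → 𝒱 × Euc d × Euc d, ψ l (remeasure y)
      ∂(Measure.pi fun _ => μ) = 0) {H : Type*} [NormedAddCommGroup H] [NormedSpace ℝ H]
    (e : (Λ → Euc p) →L[ℝ] H) :
    IsBoundedInProb P fun n ω => ‖e (gridSum V W u I ψ n ω)‖ := by
  have hcoord := fun (l : Λ) (k : Fin p) => isBoundedInProb_apply_gridSum hD hm hc hI hψm hψ h0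
    (‖e‖ • (EuclideanSpace.proj k).comp (ContinuousLinearMap.proj (R := ℝ) (φ := fun _ => Euc p) l))
  refine (IsBoundedInProb.sum Finset.univ fun (x : Λ × Fin p) _ =>
      hcoord x.1 x.2).of_le fun n ω => ?_
  set x := gridSum V W u I ψ n ω
  rw [abs_norm, abs_of_nonneg (Finset.sum_nonneg fun _ _ => abs_nonneg _), Fintype.sum_prod_type]
  simp only [_root_.smul_apply, ContinuousLinearMap.comp_apply,
    ContinuousLinearMap.proj_apply, smul_eq_mul, abs_mul, abs_norm, PiLp.proj_apply]
  simp only [← Finset.mul_sum]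
  refine (e.le_opNorm x).trans (mul_le_mul_of_nonneg_left ?_ (norm_nonneg _))
  have h1 : ∀ v : Euc p, ‖v‖ ≤ ∑ k, |v k| := fun v => by
    conv_lhs => rw [← (EuclideanSpace.basisFun (Fin p) ℝ).sum_repr v]
    refine (norm_sum_le _ _).trans (Finset.sum_le_sum fun k _ => ?_)
    simp [norm_smul]
  refine (pi_norm_le_iff_of_nonneg (Finset.sum_nonneg fun _ _ =>
    Finset.sum_nonneg fun _ _ => abs_nonneg _)).2 fun l => (h1 (x l)).trans ?_
  exact Finset.single_le_sum (f := fun l => ∑ k, |x l k|)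
    (fun _ _ => Finset.sum_nonneg fun _ _ => abs_nonneg _) (Finset.mem_univ l)

end

/-! ### Linear statistics of the grid sums -/

section

variable {Ω 𝒱 : Type*} [MeasurableSpace Ω] [MeasurableSpace 𝒱] {P : Measure Ω}
  [IsProbabilityMeasure P] {d p : ℕ} {V : ℕ → Ω → 𝒱} {W u : ℕ → Ω → Euc d} {m : ℕ → ℕ}
  {B : ℕ} {Λ : Finset ℕ} {I : (n : ℕ) → Fin B → (l : Λ) → Fin n → Fin (l : ℕ) → Ω → ℕ}
  {μ : Measure (𝒱 × Euc d × Euc d)} {ψ : Λ → 𝒱 × Euc d → Euc p}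

/-- A statistic with a linear expansion in the grid sums is asymptotically centred normal. -/
lemma isAsymptoticallyCentredNormal_of_gridSum
    (hD : IsIIDSequence P (fun i ω => (V i ω, W i ω, u i ω)) μ)
    {c : ℝ} (hm : Tendsto m atTop atTop)
    (hc : Tendsto (fun n : ℕ => (n : ℝ) / (m n : ℝ)) atTop (𝓝 c))
    (hI : IsResampling P V W u m B Λ I) (hψm : ∀ l, Measurable (ψ l))
    (hψ : ∀ l : Λ, MemLp (fun y : Fin ((l : ℕ) + 1) → 𝒱 × Euc d × Euc d =>
      ψ l (remeasure y)) 2 (Measure.pi fun _ => μ))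
    (h0 : ∀ l : Λ, ∫ y : Fin ((l : ℕ) + 1) → 𝒱 × Euc d × Euc d, ψ l (remeasure y)
      ∂(Measure.pi fun _ => μ) = 0) {p' : ℕ} (L : (Λ → Euc p) →L[ℝ] Euc p')
    {Z : ℕ → Ω → Euc p'} (hZ : ∀ n, Measurable (Z n))
    (hZL : IsLittleOProb P fun n ω => ‖Z n ω - L (gridSum V W u I ψ n ω)‖) :
    IsAsymptoticallyCentredNormal P Z := by
  have := hD.isProbabilityMeasure
  have hJ := hI.isUniformResampling
  set Φ : Fin p' → (Λ → Euc p) →L[ℝ] ℝ := fun k => (EuclideanSpace.proj k).comp L with hΦ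
  obtain ⟨M, hM, hM'⟩ := exists_tendsto_charFun_resampledSum hD hm hc hJ
    (fun k => measurable_gridKernel (B := B) hψm (Φ k)) (fun k => memLp_gridKernel hψ (Φ k))
    (fun k => integral_gridKernel hψ h0 (Φ k))
  refine isAsymptoticallyCentredNormal_of_tendsto_charFun (Y :=
      fun n ω => L (gridSum V W u I ψ n ω))
    (fun n => ?_) hZ hM (fun t => (hM' t).1) (fun t => ?_) hZL
  · have h1 : Measurable fun ω => fun k => L (gridSum V W u I ψ n ω) k := by
      refine measurable_pi_iff.2 fun k => ?_
      have h2 := hJ.measurable_resampledSum hD (measurable_gridKernel (B := B) hψm (Φ k)) n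
      rwa [show (resampledSum _ _ _ n) = fun ω => L (gridSum V W u I ψ n ω) k from
        funext fun ω => (apply_gridSum (Φ k) n ω).symm] at h2
    exact (MeasurableEquiv.toLp 2 (Fin p' → ℝ)).measurable.comp h1
  · have h1 : ∀ n ω, ∑ k, t k * L (gridSum V W u I ψ n ω) k = resampledSum
        (fun i ω => (V i ω, W i ω, u i ω)) (fun n (a : Fin B × Λ) => I n a.1 a.2)
        (fun a z => ∑ k, t k * gridKernel B ψ (Φ k) a z) n ω := fun n ω => by
      have h2 := apply_gridSum (V := V) (W := W) (u := u) (I := I) (ψ := ψ) (∑ k, t k • Φ k) n ω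
      have h3 : gridKernel B ψ (∑ k, t k • Φ k) = fun a z =>
          ∑ k, t k * gridKernel B ψ (Φ k) a z := by
        ext a z
        simp only [gridKernel, _root_.sum_apply, _root_.smul_apply, smul_eq_mul]
      rw [h3] at h2
      simp only [_root_.sum_apply, _root_.smul_apply, smul_eq_mul] at h2
      exact h2
    simp only [h1]
    exact (hM' t).2

end

/-! ### The weighted least squares criterion -/

section

variable {p : ℕ} {Λ : Finset ℕ}

/-- The linear map `x ↦ (√w_l x_l)_l`, which turns the weighted least squares criterion into the
squared norm of a Euclidean space. -/
noncomputable def weightMap (p : ℕ) (w : Λ → ℝ) :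
    (Λ → Euc p) →L[ℝ] PiLp 2 (fun _ : Λ => Euc p) :=
  (PiLp.continuousLinearEquiv 2 ℝ (fun _ : Λ => Euc p)).symm.toContinuousLinearMap.comp
    (ContinuousLinearMap.pi fun l => √(w l) • ContinuousLinearMap.proj l)

lemma weightMap_apply (w : Λ → ℝ) (x : Λ → Euc p) (l : Λ) :
    weightMap p w x l = √(w l) • x l := rfl

lemma norm_sq_weightMap {w : Λ → ℝ} (hw : ∀ l, 0 < w l) (x : Λ → Euc p) :
    ‖weightMap p w x‖ ^ 2 = ∑ l, w l * ‖x l‖ ^ 2 := by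
  rw [PiLp.norm_sq_eq_of_L2]
  refine Finset.sum_congr rfl fun l _ => ?_
  rw [weightMap_apply, norm_smul, mul_pow, Real.norm_of_nonneg (Real.sqrt_nonneg _),
    Real.sq_sqrt (hw l).le]

lemma norm_le_norm_weightMap (w : Λ → ℝ) (x : Λ → Euc p) (l : Λ) :
    √(w l) * ‖x l‖ ≤ ‖weightMap p w x‖ := by
  have h1 := PiLp.norm_apply_le (weightMap p w x) l
  rwa [weightMap_apply, norm_smul, Real.norm_of_nonneg (Real.sqrt_nonneg _)] at h1

lemma weightMap_injective {w : Λ → ℝ} (hw : ∀ l, 0 < w l) :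
    Function.Injective (weightMap p w) := by
  refine (injective_iff_map_eq_zero _).2 fun x hx => ?_
  ext1 l
  have h1 := norm_le_norm_weightMap w x l
  rw [hx, norm_zero] at h1
  have h2 : 0 < √(w l) := Real.sqrt_pos.2 (hw l)
  have h3 : ‖x l‖ ≤ 0 := by
    by_contra hcon
    exact absurd h1 (not_le.2 (mul_pos h2 (not_le.1 hcon)))
  exact norm_le_zero_iff.1 h3

/-- Identifiability of `g₀` from the grid, in the geometry of the weighted criterion. -/
lemma exists_le_norm_weightMap_sub {q : ℕ} {w : Λ → ℝ} (hw : ∀ l, 0 < w l) {G : ℝ → Euc q → Euc p}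
    {S : Set (Euc q)} {g₀ : Euc q}
    (hG : ∀ ε > 0, ∃ δ > 0, ∀ g ∈ S, ε ≤ ‖g - g₀‖ → ∃ l ∈ Λ, δ ≤ ‖G l g - G l g₀‖) :
    ∀ ε > 0, ∃ δ > 0, ∀ g ∈ S, ε ≤ ‖g - g₀‖ →
      δ ≤ ‖(weightMap p w fun l => G ((l : ℕ) : ℝ) g) - weightMap p w fun l =>
          G ((l : ℕ) : ℝ) g₀‖ := by
  intro ε hε
  obtain ⟨δ, hδ, h1⟩ := hG ε hε
  obtain ⟨κ, hκ, hκw⟩ : ∃ κ > 0, ∀ l, κ ≤ √(w l) := by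
    rcases isEmpty_or_nonempty Λ with hΛ | hΛ
    · exact ⟨1, one_pos, fun l => hΛ.elim l⟩
    · obtain ⟨l, hl⟩ := Finite.exists_min fun l => √(w l)
      exact ⟨√(w l), Real.sqrt_pos.2 (hw l), hl⟩
  refine ⟨κ * δ, mul_pos hκ hδ, fun g hg hgε => ?_⟩
  obtain ⟨l, hl, h2⟩ := h1 g hg hgε
  rw [← map_sub]
  exact (mul_le_mul (hκw ⟨l, hl⟩) h2 hδ.le (Real.sqrt_nonneg _)).trans
    (norm_le_norm_weightMap w
      (fun l : Λ => G ((l : ℕ) : ℝ) g - G ((l : ℕ) : ℝ) g₀) ⟨l, hl⟩)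

lemma isLeastSquaresFit_iff {q : ℕ} {w : Λ → ℝ} (hw : ∀ l, 0 < w l) {G : ℝ → Euc q → Euc p}
    {S : Set (Euc q)} {y : Λ → Euc p} {g : Euc q} :
    IsLeastSquaresFit Λ w G S y g ↔ g ∈ S ∧ ∀ g' ∈ S,
      ‖weightMap p w y - weightMap p w (fun l => G ((l : ℕ) : ℝ) g)‖ ≤
        ‖weightMap p w y - weightMap p w (fun l => G ((l : ℕ) : ℝ) g')‖ := by
  simp only [IsLeastSquaresFit, ← map_sub]
  refine and_congr_right fun _ => forall₂_congr fun g' _ => ?_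
  rw [← pow_le_pow_iff_left₀ (norm_nonneg _) (norm_nonneg _) two_ne_zero, norm_sq_weightMap hw,
    norm_sq_weightMap hw]
  rfl

end

/-! ### The expansion of the averaged estimates -/

section

variable {Ω 𝒱 : Type*} [MeasurableSpace Ω] [MeasurableSpace 𝒱] {P : Measure Ω}
  [IsProbabilityMeasure P] {d p : ℕ} {V : ℕ → Ω → 𝒱} {W u : ℕ → Ω → Euc d}
  {B : ℕ} {Λ : Finset ℕ} {I : (n : ℕ) → Fin B → (l : Λ) → Fin n → Fin (l : ℕ) → Ω → ℕ}
  {T : Measure (𝒱 × Euc d) → Euc p} {F : Λ → Measure (𝒱 × Euc d)} {ψ : Λ → 𝒱 × Euc d → Euc p}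

/-- The averaged estimates on the grid are linear up to `o_p(n^{-1/2})`. -/
lemma isLittleOProb_averagedEstimate (hB : 0 < B)
    (hψ : ∀ (l : Λ) (b : Fin B), AdmitsLinearApproximation P T (F l) (ψ l)
      (fun n i => remeasured V W u i (I n b l i))) {H : Type*} [NormedAddCommGroup H]
    [NormedSpace ℝ H] (e : (Λ → Euc p) →L[ℝ] H) :
    IsLittleOProb P fun (n : ℕ) ω => ‖√(n : ℝ) • (e (fun l => averagedEstimate T V W u I n l ω)
      - e (fun l => T (F l))) - e (gridSum V W u I ψ n ω)‖ := by
  set R : Λ × Fin B → ℕ → Ω → Euc p := fun a n ω =>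
    √(n : ℝ) • (T (empirical fun i : Fin n => remeasured V W u i (I n a.2 a.1 i) ω) - T (F a.1))
      - (√(n : ℝ))⁻¹ • ∑ i : Fin n, ψ a.1 (remeasured V W u i (I n a.2 a.1 i) ω) with hR
  have hRo : ∀ a, IsLittleOProb P fun n ω => ‖R a n ω‖ := fun a ε hε => by
    simpa using tendstoInMeasure_iff_norm.1 (hψ a.1 a.2).remainder ε hε
  have hB' : (B : ℝ) ≠ 0 := Nat.cast_ne_zero.2 hB.ne'
  have key : ∀ (n : ℕ) ω, √(n : ℝ) • (e (fun l => averagedEstimate T V W u I n l ω)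
      - e (fun l => T (F l))) - e (gridSum V W u I ψ n ω)
      = e (fun l => (B : ℝ)⁻¹ • ∑ b, R (l, b) n ω) := fun n ω => by
    rw [← map_sub, ← map_smul, ← map_sub]
    congr 1
    ext1 l
    simp only [Pi.sub_apply, Pi.smul_apply, averagedEstimate, gridSum, hR,
      Finset.sum_sub_distrib, ← Finset.smul_sum, Finset.sum_const, Finset.card_univ,
      Fintype.card_fin, smul_sub, ← Nat.cast_smul_eq_nsmul ℝ, smul_smul]
    rw [mul_comm (√(n : ℝ)) (B : ℝ)⁻¹, mul_comm (√(n : ℝ)) (B : ℝ), inv_mul_cancel_left₀ hB']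
  simp only [key]
  refine ((IsLittleOProb.sum Finset.univ fun a _ => hRo a).const_mul ‖e‖).of_le fun n ω => ?_
  have hR0 : ∀ s : Finset (Λ × Fin B), 0 ≤ ∑ a ∈ s, ‖R a n ω‖ := fun s =>
    Finset.sum_nonneg fun _ _ => norm_nonneg _
  rw [abs_norm, abs_of_nonneg (mul_nonneg (norm_nonneg _) (hR0 _))]
  refine (e.le_opNorm _).trans (mul_le_mul_of_nonneg_left ?_ (norm_nonneg _))
  refine (pi_norm_le_iff_of_nonneg (hR0 _)).2 fun l => ?_
  rw [norm_smul, Fintype.sum_prod_type]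
  have h1 : ‖(B : ℝ)⁻¹‖ ≤ 1 := by
    rw [norm_inv, Real.norm_natCast]
    exact inv_le_one_of_one_le₀ (Nat.one_le_cast.2 hB)
  refine (mul_le_of_le_one_left (norm_nonneg _) h1).trans ((norm_sum_le _ _).trans ?_)
  exact Finset.single_le_sum (f := fun l => ∑ b, ‖R (l, b) n ω‖)
    (fun _ _ => Finset.sum_nonneg fun _ _ => norm_nonneg _) (Finset.mem_univ l)

end

end NPSimex

theorem theorem2 {Ω 𝒱 : Type*} [MeasurableSpace Ω] [MeasurableSpace 𝒱]
    (P : Measure Ω) [IsProbabilityMeasure P] {d p q : ℕ}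
    -- the data, and the number of observed errors
    (V : ℕ → Ω → 𝒱) (X W u : ℕ → Ω → NPSimex.Euc d) (m : ℕ → ℕ)
    (hdata : NPSimex.IsObservationScheme P V X W u m)
    (hm : Tendsto m atTop atTop)
    (c : ℝ) (hc : Tendsto (fun n : ℕ => (n : ℝ) / (m n : ℝ)) atTop (𝓝 c))
    -- the grid, the number of remeasured data sets and the resampling
    (Λ : Finset ℕ) (B : ℕ) (hB : 0 < B)
    (I : (n : ℕ) → Fin B → (l : Λ) → Fin n → Fin (l : ℕ) → Ω → ℕ)
    (hI : NPSimex.IsResampling P V W u m B Λ I)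
    -- the estimator, as a functional with a linear approximation at each `F_l`
    (T : Measure (𝒱 × NPSimex.Euc d) → NPSimex.Euc p)
    (hT : ∀ n : ℕ, Measurable fun x : Fin n → 𝒱 × NPSimex.Euc d => T (NPSimex.empirical x))
    (ψ : Λ → 𝒱 × NPSimex.Euc d → NPSimex.Euc p)
    (hψ : ∀ (l : Λ) (b : Fin B), NPSimex.AdmitsLinearApproximation P T
      (NPSimex.remeasuredLaw (P.map fun ω => (V 0 ω, X 0 ω)) (P.map (u 0)) l) (ψ l)
      (fun n i => NPSimex.remeasured V W u i (I n b l i)))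
    -- the true value
    (θ : NPSimex.Euc p) (hθ : θ = T (P.map fun ω => (V 0 ω, X 0 ω)))
    -- the extrapolant: correct specification, identifiability from the grid, smoothness
    (G : ℝ → NPSimex.Euc q → NPSimex.Euc p) (S : Set (NPSimex.Euc q)) (g₀ : NPSimex.Euc q)
    (hg₀ : g₀ ∈ interior S)
    (hG : ∀ l ∈ Λ, G l g₀ =
      T (NPSimex.remeasuredLaw (P.map fun ω => (V 0 ω, X 0 ω)) (P.map (u 0)) l))
    (hG_neg : G (-1) g₀ = θ)
    (hG_meas : Measurable (G (-1)))
    (hG_ident : ∀ ε > 0, ∃ δ > 0, ∀ g ∈ S, ε ≤ ‖g - g₀‖ → ∃ l ∈ Λ, δ ≤ ‖G l g - G l g₀‖)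
    (hG_diff : ∀ l ∈ Λ, DifferentiableAt ℝ (G l) g₀)
    (hG_diff_neg : DifferentiableAt ℝ (G (-1)) g₀)
    (hG_rank : ∀ h, (∀ l ∈ Λ, fderiv ℝ (G l) g₀ h = 0) → h = 0)
    -- the fitted extrapolant
    (w : Λ → ℝ) (hw : ∀ l, 0 < w l)
    (gHat : ℕ → Ω → NPSimex.Euc q) (hgHat_meas : ∀ n, Measurable (gHat n))
    (hgHat : Tendsto (fun n => P {ω | ¬ NPSimex.IsLeastSquaresFit Λ w G S
      (fun l => NPSimex.averagedEstimate T V W u I n l ω) (gHat n ω)}) atTop (𝓝 0)) :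
    NPSimex.IsAsymptoticallyCentredNormal P
      (fun n ω => √(n : ℝ) • (G (-1) (gHat n ω) - θ)) := by
  -- the observed triples are i.i.d., with a law that determines the laws `F_l`
  obtain ⟨hD, hX0, hlaw⟩ := hdata.iid_and_law
  have hVWu := hD.measurable 0
  have hV0 : Measurable (V 0) := hVWu.fst
  have hW0 : Measurable (W 0) := hVWu.snd.fst
  have hu0 : Measurable (u 0) := hVWu.snd.snd
  set μ := P.map fun ω => (V 0 ω, W 0 ω, u 0 ω) with hμ
  set ρ := P.map fun ω => (V 0 ω, X 0 ω) with hρ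
  set ν := P.map (u 0) with hν
  have : IsProbabilityMeasure μ := Measure.isProbabilityMeasure_map hVWu.aemeasurable
  have : IsProbabilityMeasure ρ := Measure.isProbabilityMeasure_map (hV0.prodMk hX0).aemeasurable
  have : IsProbabilityMeasure ν := Measure.isProbabilityMeasure_map hu0.aemeasurable
  have hmap : ∀ l : ℕ, (Measure.pi fun _ : Fin (l + 1) => μ).map NPSimex.remeasure
      = NPSimex.remeasuredLaw ρ ν l := by
    refine NPSimex.map_remeasure_pi ?_ ?_
    · rw [hμ, Measure.map_map (by fun_prop) hVWu]
      exact hlaw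
    · rw [hμ, Measure.map_map (by fun_prop) hVWu]
      rfl
  have b₀ : Fin B := ⟨0, hB⟩
  have hψm : ∀ l, Measurable (ψ l) := fun l => (hψ l b₀).measurable
  have hψ2 : ∀ l : Λ, MemLp (fun y : Fin ((l : ℕ) + 1) → 𝒱 × NPSimex.Euc d × NPSimex.Euc d =>
      ψ l (NPSimex.remeasure y)) 2 (Measure.pi fun _ => μ) := fun l => by
    have h1 := (hψ l b₀).square_integrable
    rw [← hmap] at h1
    exact h1.comp_of_map NPSimex.measurable_remeasure.aemeasurable
  have hψ0 : ∀ l : Λ, ∫ y : Fin ((l : ℕ) + 1) → 𝒱 × NPSimex.Euc d × NPSimex.Euc d,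
      ψ l (NPSimex.remeasure y) ∂(Measure.pi fun _ => μ) = 0 := fun l => by
    have h1 := (hψ l b₀).centred
    rwa [← hmap, integral_map NPSimex.measurable_remeasure.aemeasurable
      (hψm l).aestronglyMeasurable] at h1
  -- the extrapolant on the grid, in the geometry of the weighted least squares criterion
  set e := NPSimex.weightMap p w with he
  have hΓ : HasFDerivAt (fun g => e fun l : Λ => G ((l : ℕ) : ℝ) g)
      (e.comp (ContinuousLinearMap.pi fun l : Λ => fderiv ℝ (G ((l : ℕ) : ℝ)) g₀)) g₀ :=
    e.hasFDerivAt.comp g₀ (hasFDerivAt_pi.2 fun l => (hG_diff l l.2).hasFDerivAt)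
  have hinj : Function.Injective
      (e.comp (ContinuousLinearMap.pi fun l : Λ => fderiv ℝ (G ((l : ℕ) : ℝ)) g₀)) := by
    refine (injective_iff_map_eq_zero _).2 fun h hh => hG_rank h fun l hl => ?_
    have h1 := NPSimex.weightMap_injective hw (hh.trans (map_zero e).symm)
    exact congrFun h1 ⟨l, hl⟩
  obtain ⟨A, hA⟩ := NPSimex.exists_pseudoInverse _ hinj
  have hid : ∀ ε > 0, ∃ δ > 0, ∀ g ∈ S, ε ≤ ‖g - g₀‖ →
      δ ≤ ‖(e fun l : Λ => G ((l : ℕ) : ℝ) g) - e fun l : Λ => G ((l : ℕ) : ℝ) g₀‖ :=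
    NPSimex.exists_le_norm_weightMap_sub hw hG_ident
  have hGF : (fun l : Λ => G ((l : ℕ) : ℝ) g₀) = fun l : Λ => T (NPSimex.remeasuredLaw ρ ν l) :=
    funext fun l => hG l l.2
  have hy := NPSimex.isLittleOProb_averagedEstimate hB hψ e
  rw [← hGF] at hy
  -- `√n (G(-1, γ̂) - θ)` is linear in the grid sums up to `o_p(1)`
  have key := NPSimex.isLittleOProb_leastSquares hg₀ hΓ hinj hA hid hG_diff_neg.hasFDerivAt
    (NPSimex.isBoundedInProb_norm_gridSum hD hm hc hI hψm hψ2 hψ0 e) hy (g := gHat)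
    (by simpa only [NPSimex.isLeastSquaresFit_iff hw] using hgHat)
  rw [hG_neg] at key
  exact NPSimex.isAsymptoticallyCentredNormal_of_gridSum hD hm hc hI hψm hψ2 hψ0
    (((fderiv ℝ (G (-1)) g₀).comp A).comp e)
    (fun n => (((hG_meas.comp (hgHat_meas n)).sub_const θ).const_smul (√(n : ℝ)) :)) key
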